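/- Let $n\ge 1$ be an integer and let $H:\mathbb R^n\to[0,\infty)$ be a norm of class $C^2(\mathbb R^n\setminus\{0\})$ such that $H^2$ is strictly convex. Let $H_0(x)=\sup_{\xi\neq 0}\langle x,\xi\rangle/H(\xi)$ be its dual norm, and for $z=(x,y)$ and $\zeta=(\xi,\eta)$ in $\mathbb R^n\times\mathbb R=\mathbb R^{n+1}$ put $\Phi(\zeta)=\sqrt{H(\xi)^2+\eta^2}$ and $\Phi_0(z)=\sqrt{H_0(x)^2+y^2}$. Let $\alpha\in(-1,1)$ and $2-\alpha\le b<n+1$. Let $U\subset\mathbb R^{n+1}$ be a bounded domain containing the origin, and let $U^+=\{(x,y)\in U: y>0\}$, $U_0=\{x\in\mathbb R^n:(x,0)\in U\}$, $D=\sup_{z\in U^+}\Phi_0(z)$. For $0<\rho<1$ let $X_1(\rho)=\frac1{1-\ln\rho}$, $X_k(\rho)=X_1(X_{k-1}(\rho))$ for $k\ge 2$, and $P_k=X_1X_2\cdots X_k$, $P_0=1$. Below, $P_i$ and $X_i$ stand for $P_i(\Phi_0(z)/D)$ and $X_i(\Phi_0(z)/D)$. Let $$K(n,\alpha,b)=(1-\alpha)\,\frac{\Gamma(\frac{n-2\alpha-b+3}{4})\,\Gamma(\frac{n+b-1}{4})\,\Gamma(\frac{\alpha+1}{2})}{\Gamma(\frac{3-\alpha}{2})\,\Gamma(\frac{n+1-b}{4})\,\Gamma(\frac{n+2\alpha+b-3}{4})}.$$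 (i) For all $u\in C_0^\infty(U)$, all the integrals below are finite, the series converges, and $$K(n,\alpha,b)\int_{U_0}\frac{u^2(x,0)}{H_0^{1-\alpha}(x)}\,dx+\frac{(\alpha+b-2)^2}{4}\int_{U^+}\frac{y^\alpha u^2}{\Phi_0^2}\,dz+\frac14\sum_{i=1}^\infty\int_{U^+}\frac{y^\alpha P_i^2}{\Phi_0^2}\,u^2\,dz\le\int_{U^+}y^\alpha\,\Phi^2(\nabla u)\,dz .$$ (ii) For $k\ge 1$ put $$I_k[u]=\int_{U^+}y^\alpha\Phi^2(\nabla u)\,dz-K(n,\alpha,b)\int_{U_0}\frac{u^2(x,0)}{H_0^{1-\alpha}(x)}\,dx-\frac{(\alpha+b-2)^2}{4}\int_{U^+}\frac{y^\alpha u^2}{\Phi_0^2}\,dz-\frac14\sum_{i=1}^{k-1}\int_{U^+}\frac{y^\alpha P_i^2}{\Phi_0^2}\,u^2\,dz .$$ For every $k\ge1$ the constant $\frac14$ of the $k$-th remainder term is optimal: $$\frac14=\inf_{u}\ \frac{I_k[u]}{\int_{U^+}\frac{y^\alpha P_k^2}{\Phi_0^2}\,u^2\,dz},$$ the infimum being over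 all $u\in C_0^\infty(U)$ for which the denominator is positive. (iii) The power of the logarithmic weights is optimal: for every $k\ge1$, every real $p<2$ and every $C>0$, the inequality $$C\int_{U^+}\frac{y^\alpha P_{k-1}^2X_k^{p}}{\Phi_0^2}\,u^2\,dz\le I_k[u]$$ fails for some $u\in C_0^\infty(U)$. -/

import Mathlib

open Set MeasureTheory
open scoped ContDiff

noncomputable section

namespace FinslerHardy

/-- The Euclidean space `ℝⁿ`. Points of `ℝⁿ⁺¹` are written `z = (x, y)` in `Rn n × ℝ`, which carries
the Lebesgue measure as its product measure. -/
abbrev Rn (n : ℕ) : Type := EuclideanSpace ℝ (Fin n)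

variable {n : ℕ}

/-- `H` is a norm on `ℝⁿ` of class `C²` away from the origin, with `H²` strictly convex. -/
structure IsFinslerNorm (H : Seminorm ℝ (Rn n)) : Prop where
  eq_zero : ∀ ξ : Rn n, H ξ = 0 → ξ = 0
  contDiffOn : ContDiffOn ℝ 2 H {0}ᶜ
  strictConvexOn : StrictConvexOn ℝ univ (fun ξ : Rn n => H ξ ^ 2)

/-- The dual norm `H₀(x) = sup_{ξ ≠ 0} ⟨x, ξ⟩ / H(ξ)`. -/
def dualNorm (H : Seminorm ℝ (Rn n)) (x : Rn n) : ℝ :=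
  ⨆ ξ : {ξ : Rn n // ξ ≠ 0}, inner ℝ x (ξ : Rn n) / H (ξ : Rn n)

/-- The norm `Φ(ξ, η) = √(H(ξ)² + η²)` on `ℝⁿ⁺¹`. -/
def Phi (H : Seminorm ℝ (Rn n)) (ζ : Rn n × ℝ) : ℝ :=
  Real.sqrt (H ζ.1 ^ 2 + ζ.2 ^ 2)

/-- The norm `Φ₀(x, y) = √(H₀(x)² + y²)` on `ℝⁿ⁺¹`. -/
def Phi0 (H : Seminorm ℝ (Rn n)) (z : Rn n × ℝ) : ℝ :=
  Real.sqrt (dualNorm H z.1 ^ 2 + z.2 ^ 2)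

/-- The gradient `∇u = (∇ₓu, ∂u/∂y)` in `ℝⁿ⁺¹`. -/
def grad (u : Rn n × ℝ → ℝ) (z : Rn n × ℝ) : Rn n × ℝ :=
  (gradient (fun x : Rn n => u (x, z.2)) z.1, deriv (fun y : ℝ => u (z.1, y)) z.2)

/-- `u ∈ C₀^∞(U)`: `u` is smooth on `ℝⁿ⁺¹` with compact support contained in `U`. -/
structure IsTestFunction (U : Set (Rn n × ℝ)) (u : Rn n × ℝ → ℝ) : Prop where
  contDiff : ContDiff ℝ ∞ u
  hasCompactSupport : HasCompactSupport u
  tsupport_subset : tsupport u ⊆ U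

/-- `U⁺ = {(x, y) ∈ U : y > 0}`. -/
def upperPart (U : Set (Rn n × ℝ)) : Set (Rn n × ℝ) := {z | z ∈ U ∧ 0 < z.2}

/-- `U₀ = {x ∈ ℝⁿ : (x, 0) ∈ U}`. -/
def bottomPart (U : Set (Rn n × ℝ)) : Set (Rn n) := {x | (x, (0 : ℝ)) ∈ U}

/-- `D = sup_{z ∈ U⁺} Φ₀(z)`. -/
def radius (H : Seminorm ℝ (Rn n)) (U : Set (Rn n × ℝ)) : ℝ :=
  sSup (Phi0 H '' upperPart U)

/-- The constant `K(n, α, b)`. -/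
def K (n : ℕ) (α b : ℝ) : ℝ :=
  (1 - α) *
    (Real.Gamma ((n - 2 * α - b + 3) / 4) * Real.Gamma ((n + b - 1) / 4) *
      Real.Gamma ((α + 1) / 2)) /
    (Real.Gamma ((3 - α) / 2) * Real.Gamma ((n + 1 - b) / 4) *
      Real.Gamma ((n + 2 * α + b - 3) / 4))

/-- `X₁(ρ) = 1 / (1 - ln ρ)`, `X_{k+1}(ρ) = X₁(X_k(ρ))`; at the unused index `0` the value is `ρ`. -/
def X : ℕ → ℝ → ℝ
  | 0, ρ => ρ
  | k + 1, ρ => 1 / (1 - Real.log (X k ρ))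

/-- `P_k = X₁ X₂ ⋯ X_k`, with `P₀ = 1`. -/
def P (k : ℕ) (ρ : ℝ) : ℝ := ∏ i ∈ Finset.Icc 1 k, X i ρ

/-- The integrand `y^α Φ(∇u)²`. -/
def energyDensity (α : ℝ) (H : Seminorm ℝ (Rn n)) (u : Rn n × ℝ → ℝ) (z : Rn n × ℝ) : ℝ :=
  z.2 ^ α * Phi H (grad u z) ^ 2

/-- The integrand `u(x, 0)² / H₀(x)^(1-α)`. -/
def traceDensity (α : ℝ) (H : Seminorm ℝ (Rn n)) (u : Rn n × ℝ → ℝ) (x : Rn n) : ℝ :=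
  u (x, 0) ^ 2 / dualNorm H x ^ (1 - α)

/-- The integrand `y^α u² / Φ₀²`. -/
def hardyDensity (α : ℝ) (H : Seminorm ℝ (Rn n)) (u : Rn n × ℝ → ℝ) (z : Rn n × ℝ) : ℝ :=
  z.2 ^ α * u z ^ 2 / Phi0 H z ^ 2

/-- The integrand `y^α P_i(Φ₀/D)² u² / Φ₀²`. -/
def logDensity (α : ℝ) (H : Seminorm ℝ (Rn n)) (U : Set (Rn n × ℝ)) (i : ℕ)
    (u : Rn n × ℝ → ℝ) (z : Rn n × ℝ) : ℝ :=
  z.2 ^ α * P i (Phi0 H z / radius H U) ^ 2 / Phi0 H z ^ 2 * u z ^ 2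

/-- The integrand `y^α P_{k-1}(Φ₀/D)² X_k(Φ₀/D)^p u² / Φ₀²`, for `k ≥ 1`. -/
def powerLogDensity (α : ℝ) (H : Seminorm ℝ (Rn n)) (U : Set (Rn n × ℝ)) (k : ℕ) (p : ℝ)
    (u : Rn n × ℝ → ℝ) (z : Rn n × ℝ) : ℝ :=
  z.2 ^ α * P (k - 1) (Phi0 H z / radius H U) ^ 2 * X k (Phi0 H z / radius H U) ^ p /
    Phi0 H z ^ 2 * u z ^ 2

/-- `I_k[u]`, for `k ≥ 1`: the right hand side minus the left hand side of the inequality, with only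
the first `k - 1` terms of the series kept. -/
def deficit (α b : ℝ) (H : Seminorm ℝ (Rn n)) (U : Set (Rn n × ℝ)) (k : ℕ)
    (u : Rn n × ℝ → ℝ) : ℝ :=
  (∫ z in upperPart U, energyDensity α H u z)
    - K n α b * (∫ x in bottomPart U, traceDensity α H u x)
    - (α + b - 2) ^ 2 / 4 * (∫ z in upperPart U, hardyDensity α H u z)
    - 1 / 4 * ∑ i ∈ Finset.Icc 1 (k - 1), ∫ z in upperPart U, logDensity α H U i u z

end FinslerHardy

end

open FinslerHardy

open Filter Topology

noncomputable section

namespace FinslerHardy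

/-! Use polar coordinates adapted to H₀: x = ρ cos θ · v with H₀(v) = 1 and y = ρ sin θ. Then Φ₀ =
ρ, and y^α dz becomes ρ^(n+α) dρ · ω(θ) dθ · dν(v) with ω = sin^α θ cos^(n-1) θ and ν a finite
measure. The duality |⟨x, ∇ₓu⟩| ≤ H₀(x) H(∇ₓu) yields Φ(∇u)² ≥ u_ρ² + (u_θ/ρ)²
(`radDeriv_sq_add_tanDeriv_sq_le`), which reduces the inequality to two one-dimensional ones.

Radial part (`radial_ineq`): with a = (n+α-1)/2, the energy ∫ ρ^(2a+1) u_ρ² controls ∫ ρ^(2a-1) (a²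
+ ¼ Σ P_i²) u². This is a completed square, because Q = ρ^(2a) (a + ½ Σ P_i) solves the Riccati
equation Q' = ρ^(2a-1) (a² + ¼ Σ P_i²) + Q²/ρ^(2a+1); that in turn rests on ρ X_k' = X_k P_k.

Angular part (`angConst_mul_sq_le`): with A = (n+2α+b-3)/4, B = (n+1-b)/4, C = n/2, the function
f(θ) = ₂F₁(A, B; C; cos² θ) solves (ω f')' = M ω f, where M = 4AB = a² - (α+b-2)²/4. Its logarithmic
flux R = -ω f'/f solves a Riccati equation, vanishes at π/2, and bounds ∫ ω (g'² + M g²) below by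
R(0+) g(0)². Gauss' summation formula evaluates both f(0) and the limit of -ω f' at 0, and R(0+) =
K(n, α, b) (`K_eq`).

Of the radial gain a², the share M pays for the angular inequality and (α+b-2)²/4 is left as the
Hardy term (`hardy_trace_finite`). The series follows from bounded partial sums of nonnegative
terms.

Sharpness: the squares vanish on the ground states ρ^(-a) P_k^(-1/2) and f, and the duality is an
equality when ∇ₓu is parallel to ∇(H₀²). So functions w(Φ₀) q(H₀²/Φ₀²) are used, with w the radial
ground state cut off in the variable -log X_k (`radial_sharp`) and q a Taylor polynomial of ₂F₁
(`exists_polynomial_angular`). They are only C¹, since H₀² is only shown to be C¹, and are then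
mollified (`exists_test_of_contDiff_one`). The quotient comes as close to ¼ as desired on functions
living near the origin (`exists_nearly_optimal`). There X_k^(p-2) is arbitrarily large for p < 2,
which settles the optimality of the power. -/

lemma hasSum_of_eq {f g : ℕ → ℝ} {a b : ℝ} (h : HasSum f a) (hf : ∀ k, g k = f k) (hb : b = a) :
    HasSum g b := by
  rw [hb, funext hf]; exact h

/-! ### Power series with polynomially bounded coefficients -/

lemma summable_powerSeries {c : ℕ → ℝ} {M : ℝ} {m : ℕ} (hc : ∀ k, |c k| ≤ M * ((k : ℝ) + 1) ^ m)
    {s : ℝ} (hs : |s| < 1) : Summable (fun k => c k * s ^ k) := by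
  -- The comparison series below is shifted by one index and divided by |s|, so s = 0 is treated
  -- apart.
  rcases eq_or_ne s 0 with rfl | h0
  · refine summable_of_ne_finset_zero (s := {0}) fun k hk => ?_
    have : k ≠ 0 := by simpa using hk
    simp [this]
  have h1 : Summable (fun k : ℕ => ((k : ℝ)) ^ m * |s| ^ k) :=
    summable_pow_mul_geometric_of_norm_lt_one m (by simpa using hs)
  have h2 := ((summable_nat_add_iff 1).2 h1).mul_left (M / |s|)
  refine Summable.of_norm_bounded h2 fun k => ?_
  have hpos : 0 < |s| := abs_pos.2 h0
  rw [Real.norm_eq_abs, abs_mul, abs_pow]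
  calc |c k| * |s| ^ k ≤ M * ((k : ℝ) + 1) ^ m * |s| ^ k := by gcongr; exact hc k
    _ = _ := by push_cast; rw [pow_succ]; field_simp

/-- Polynomially bounded coefficients stay polynomially bounded after differentiation, since k + 2 ≤
2(k + 1). Hence the series can be differentiated repeatedly inside the unit disc. -/
lemma derivCoeff_bound {c : ℕ → ℝ} {M : ℝ} {m : ℕ} (hc : ∀ k, |c k| ≤ M * ((k : ℝ) + 1) ^ m)
    (k : ℕ) : |((k : ℝ) + 1) * c (k + 1)| ≤ (M * 2 ^ m) * ((k : ℝ) + 1) ^ (m + 1) := by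
  have hM : 0 ≤ M := by simpa using (abs_nonneg _).trans (hc 0)
  have h := hc (k + 1)
  push_cast at h
  rw [abs_mul, abs_of_nonneg (by positivity)]
  calc ((k : ℝ) + 1) * |c (k + 1)| ≤ ((k : ℝ) + 1) * (M * ((k : ℝ) + 1 + 1) ^ m) := by gcongr
    _ ≤ ((k : ℝ) + 1) * (M * (2 * ((k : ℝ) + 1)) ^ m) := by
        gcongr; have : (0 : ℝ) ≤ k := by positivity
        linarith
    _ = _ := by rw [mul_pow]; ring

lemma hasDerivAt_powerSeries {c : ℕ → ℝ} {M : ℝ} {m : ℕ}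
    (hc : ∀ k, |c k| ≤ M * ((k : ℝ) + 1) ^ m) {s : ℝ} (hs : |s| < 1) :
    HasDerivAt (fun s => ∑' k, c k * s ^ k) (∑' k : ℕ, ((k : ℝ) + 1) * c (k + 1) * s ^ k) s := by
  obtain ⟨r, hsr, hr1⟩ := exists_between hs
  have hr0 : 0 ≤ r := (abs_nonneg s).trans hsr.le
  have hsum := summable_powerSeries (derivCoeff_bound hc) (s := r) (by rwa [abs_of_nonneg hr0])
  have hsum' : Summable (fun k : ℕ => (k : ℝ) * |c k| * r ^ (k - 1)) := by
    rw [← summable_nat_add_iff 1]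
    have := hsum.abs
    refine this.congr fun k => ?_
    rw [abs_mul, abs_mul, abs_pow, abs_of_nonneg hr0,
      abs_of_nonneg (by positivity : (0 : ℝ) ≤ (k : ℝ) + 1)]
    push_cast; simp
  have key := hasDerivAt_tsum_of_isPreconnected (t := Ioo (-r) r)
    (g := fun (k : ℕ) (x : ℝ) => c k * x ^ k) (g' := fun k x => c k * (k * x ^ (k - 1)))
    (y₀ := s) (y := s) hsum' isOpen_Ioo (convex_Ioo _ _).isPreconnected
    (fun k y _ => (hasDerivAt_pow k y).const_mul (c k)) (fun k y hy => by
      have hy' : |y| ≤ r := abs_le.2 ⟨hy.1.le, hy.2.le⟩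
      rw [Real.norm_eq_abs, abs_mul, abs_mul, abs_pow, Nat.abs_cast]
      calc |c k| * (k * |y| ^ (k - 1)) ≤ |c k| * (k * r ^ (k - 1)) := by gcongr
        _ = _ := by ring) (abs_lt.1 hsr) (summable_powerSeries hc hs) (abs_lt.1 hsr)
  refine key.congr_deriv ?_
  have hs2 := summable_powerSeries (derivCoeff_bound hc) hs
  have : Summable (fun k : ℕ => c k * (k * s ^ (k - 1))) := by
    rw [← summable_nat_add_iff 1]
    refine hs2.congr fun k => ?_
    push_cast [Nat.add_sub_cancel]; ring
  rw [this.tsum_eq_zero_add]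
  simp only [CharP.cast_eq_zero, zero_mul, mul_zero, zero_add]
  refine tsum_congr fun k => ?_
  push_cast [Nat.add_sub_cancel]; ring

/-! ### The hypergeometric series -/

/-- The coefficients of the Gauss hypergeometric series `₂F₁(A, B; C; ·)`. -/
def hyperCoeff (A B C : ℝ) : ℕ → ℝ
  | 0 => 1
  | k + 1 => hyperCoeff A B C k * ((A + k) * (B + k) / ((C + k) * (k + 1)))

lemma hyperCoeff_pos {A B C : ℝ} (hA : 0 < A) (hB : 0 < B) (hC : 0 < C) (k : ℕ) :
    0 < hyperCoeff A B C k := by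
  induction k with
  | zero => simp [hyperCoeff]
  | succ k ih => rw [hyperCoeff]; positivity

/-- The ratio of consecutive coefficients is at most 1 as soon as k (C + 1 - A - B) ≥ AB, so the
coefficients decrease from some index k₀ on. The sum of those up to k₀ bounds them all. -/
lemma hyperCoeff_bound {A B C : ℝ} (hA : 0 < A) (hB : 0 < B) (hC : 0 < C) (h : A + B < C + 1) :
    ∃ M : ℝ, ∀ k, |hyperCoeff A B C k| ≤ M * ((k : ℝ) + 1) ^ 0 := by
  obtain ⟨k₀, hk₀⟩ := exists_nat_gt ((A * B) / (C + 1 - A - B))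
  have hmono : ∀ j, hyperCoeff A B C (k₀ + j) ≤ hyperCoeff A B C k₀ := by
    intro j
    induction j with
    | zero => simp
    | succ j ih =>
      refine le_trans ?_ ih
      rw [← add_assoc, hyperCoeff]
      refine mul_le_of_le_one_right (hyperCoeff_pos hA hB hC _).le ?_
      rw [div_le_one (by positivity)]
      rw [div_lt_iff₀ (by linarith)] at hk₀
      push_cast
      have : (0 : ℝ) ≤ j := by positivity
      nlinarith [mul_nonneg this (by linarith : 0 ≤ C + 1 - A - B)]
  refine ⟨∑ i ∈ Finset.range (k₀ + 1), hyperCoeff A B C i, fun k => ?_⟩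
  rw [abs_of_pos (hyperCoeff_pos hA hB hC k), pow_zero, mul_one]
  have hs : ∀ i ≤ k₀, hyperCoeff A B C i ≤ ∑ i ∈ Finset.range (k₀ + 1), hyperCoeff A B C i :=
    fun i hi => Finset.single_le_sum (fun i _ => (hyperCoeff_pos hA hB hC i).le)
      (Finset.mem_range.2 (by omega))
  rcases le_total k k₀ with hk | hk
  · exact hs k hk
  · obtain ⟨j, rfl⟩ := Nat.exists_eq_add_of_le hk
    exact (hmono j).trans (hs k₀ le_rfl)

/-- The hypergeometric function `₂F₁(A, B; C; s)`. -/
def hyper (A B C s : ℝ) : ℝ := ∑' k, hyperCoeff A B C k * s ^ k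

/-- The derivative of `hyper A B C`. -/
def hyperDeriv (A B C s : ℝ) : ℝ := ∑' k : ℕ, ((k : ℝ) + 1) * hyperCoeff A B C (k + 1) * s ^ k

lemma summable_hyper {A B C : ℝ} (hA : 0 < A) (hB : 0 < B) (hC : 0 < C) (h : A + B < C + 1)
    {s : ℝ} (hs : |s| < 1) : Summable (fun k => hyperCoeff A B C k * s ^ k) := by
  obtain ⟨M, hM⟩ := hyperCoeff_bound hA hB hC h
  exact summable_powerSeries hM hs

lemma summable_hyperDeriv {A B C : ℝ} (hA : 0 < A) (hB : 0 < B) (hC : 0 < C) (h : A + B < C + 1)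
    {s : ℝ} (hs : |s| < 1) :
    Summable (fun k : ℕ => ((k : ℝ) + 1) * hyperCoeff A B C (k + 1) * s ^ k) := by
  obtain ⟨M, hM⟩ := hyperCoeff_bound hA hB hC h
  exact summable_powerSeries (derivCoeff_bound hM) hs

lemma hasDerivAt_hyper {A B C : ℝ} (hA : 0 < A) (hB : 0 < B) (hC : 0 < C) (h : A + B < C + 1)
    {s : ℝ} (hs : |s| < 1) : HasDerivAt (hyper A B C) (hyperDeriv A B C s) s := by
  obtain ⟨M, hM⟩ := hyperCoeff_bound hA hB hC h
  exact hasDerivAt_powerSeries hM hs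

lemma one_le_hyper {A B C : ℝ} (hA : 0 < A) (hB : 0 < B) (hC : 0 < C) (h : A + B < C + 1)
    {s : ℝ} (hs0 : 0 ≤ s) (hs : s < 1) : 1 ≤ hyper A B C s := by
  have := (summable_hyper hA hB hC h (s := s) (by rwa [abs_of_nonneg hs0])).sum_le_tsum {0}
    (fun k _ => mul_nonneg (hyperCoeff_pos hA hB hC k).le (by positivity))
  simpa [hyperCoeff, hyper] using this

lemma hyperDeriv_nonneg {A B C : ℝ} (hA : 0 < A) (hB : 0 < B) (hC : 0 < C)
    {s : ℝ} (hs0 : 0 ≤ s) : 0 ≤ hyperDeriv A B C s :=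
  tsum_nonneg fun k => mul_nonneg (mul_nonneg (by positivity) (hyperCoeff_pos hA hB hC _).le)
    (by positivity)

/-- The hypergeometric differential equation. -/
lemma exists_hasDerivAt_hyperDeriv {A B C : ℝ} (hA : 0 < A) (hB : 0 < B) (hC : 0 < C)
    (h : A + B < C + 1) {s : ℝ} (hs : |s| < 1) :
    ∃ F2 : ℝ, HasDerivAt (hyperDeriv A B C) F2 s ∧
      s * (1 - s) * F2 + (C - (A + B + 1) * s) * hyperDeriv A B C s = A * B * hyper A B C s := by
  obtain ⟨M, hM⟩ := hyperCoeff_bound hA hB hC h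
  have hM1 := derivCoeff_bound hM
  have hd := hasDerivAt_powerSeries hM1 hs
  refine ⟨_, hd, ?_⟩
  have s0 := (summable_powerSeries hM hs).hasSum
  have s1 := (summable_powerSeries hM1 hs).hasSum
  have s2 := (summable_powerSeries (derivCoeff_bound hM1) hs).hasSum
  set c := hyperCoeff A B C with hc
  change HasSum _ (hyper A B C s) at s0
  change HasSum _ (hyperDeriv A B C s) at s1
  set F2 := ∑' k : ℕ, ((k : ℝ) + 1) * ((((k + 1 : ℕ) : ℝ) + 1) * c (k + 1 + 1)) * s ^ k with hF2
  -- The series of sF', sF'' and s²F'' are re-indexed to the common power s^k. The differential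
  -- equation then reduces to the coefficient recursion, term by term.
  have t1 : HasSum (fun k : ℕ => (k : ℝ) * c k * s ^ k) (s * hyperDeriv A B C s) := by
    rw [← hasSum_nat_add_iff' 1]
    simp only [Finset.range_one, Finset.sum_singleton, CharP.cast_eq_zero, zero_mul, sub_zero]
    exact hasSum_of_eq (s1.mul_left s) (fun k => by push_cast; ring) (by ring)
  have t2 : HasSum (fun k : ℕ => (k : ℝ) * ((k : ℝ) + 1) * c (k + 1) * s ^ k) (s * F2) := by
    rw [← hasSum_nat_add_iff' 1]
    simp only [Finset.range_one, Finset.sum_singleton, CharP.cast_eq_zero, zero_mul, sub_zero]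
    exact hasSum_of_eq (s2.mul_left s) (fun k => by push_cast; ring) (by ring)
  have t3 : HasSum (fun k : ℕ => (k : ℝ) * ((k : ℝ) - 1) * c k * s ^ k) (s * (s * F2)) := by
    rw [← hasSum_nat_add_iff' 1]
    simp only [Finset.range_one, Finset.sum_singleton, CharP.cast_eq_zero, zero_mul, sub_zero]
    exact hasSum_of_eq (t2.mul_left s) (fun k => by push_cast; ring) (by ring)
  have e1 := (((t2.sub t3).add (s1.mul_left C)).sub (t1.mul_left (A + B + 1)))
  have e2 := s0.mul_left (A * B)
  have := e1.unique (hasSum_of_eq e2 (fun k => by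
    have hk : c (k + 1) = c k * ((A + k) * (B + k) / ((C + k) * (k + 1))) := by
      rw [hc, hyperCoeff]
    rw [hk]
    field_simp
    ring) rfl)
  linarith

/-! ### Gauss' summation formula -/

/-- The beta density has total mass one. Lower integrals are used so that sums of nonnegative terms
can be exchanged with the integral without any integrability check. -/
lemma lintegral_beta {a b : ℝ} (ha : 0 < a) (hb : 0 < b) :
    ∫⁻ x in Ioo (0 : ℝ) 1, ENNReal.ofReal (x ^ (a - 1) * (1 - x) ^ (b - 1)) =
      ENNReal.ofReal (ProbabilityTheory.beta a b) := by
  have h := ProbabilityTheory.lintegral_betaPDF_eq_one ha hb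
  have hp := ProbabilityTheory.beta_pos ha hb
  rw [ProbabilityTheory.lintegral_betaPDF] at h
  simp_rw [mul_assoc, ENNReal.ofReal_mul (one_div_pos.2 hp).le] at h
  rw [lintegral_const_mul' _ _ ENNReal.ofReal_ne_top] at h
  calc _ = ENNReal.ofReal (ProbabilityTheory.beta a b) *
        (ENNReal.ofReal (1 / ProbabilityTheory.beta a b) *
        ∫⁻ x in Ioo (0 : ℝ) 1, ENNReal.ofReal (x ^ (a - 1) * (1 - x) ^ (b - 1))) := by
        rw [← mul_assoc, ← ENNReal.ofReal_mul hp.le, mul_one_div_cancel hp.ne']; simp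
    _ = _ := by rw [h, mul_one]

lemma beta_add_one_left {a b : ℝ} (ha : 0 < a) (hb : 0 < b) :
    ProbabilityTheory.beta (a + 1) b = ProbabilityTheory.beta a b * (a / (a + b)) := by
  unfold ProbabilityTheory.beta
  have h1 : a + 1 + b = (a + b) + 1 := by ring
  rw [h1, Real.Gamma_add_one ha.ne', Real.Gamma_add_one (by positivity)]
  have : Real.Gamma (a + b) ≠ 0 := (Real.Gamma_pos_of_pos (by positivity)).ne'
  field_simp

lemma hasSum_of_tsum_ofReal {f : ℕ → ℝ} {g : ℝ} (hf : ∀ k, 0 ≤ f k) (hg : 0 ≤ g)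
    (h : ∑' k, ENNReal.ofReal (f k) = ENNReal.ofReal g) : HasSum f g := by
  have h1 := ENNReal.hasSum_toReal (f := fun k => ENNReal.ofReal (f k))
    (by rw [h]; exact ENNReal.ofReal_ne_top)
  have h2 : ∑' k, (ENNReal.ofReal (f k)).toReal = g := by
    rw [← ENNReal.tsum_toReal_eq (fun _ => ENNReal.ofReal_ne_top), h, ENNReal.toReal_ofReal hg]
  rw [h2] at h1
  simpa [ENNReal.toReal_ofReal (hf _)] using h1

/-- With B = C = 1 the recursion produces the rising factorial of A divided by k!, so this is the
binomial series. -/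
lemma hasSum_one_sub_rpow_neg (A : ℝ) {t : ℝ} (ht : |t| < 1) :
    HasSum (fun k => hyperCoeff A 1 1 k * t ^ k) ((1 - t) ^ (-A)) := by
  have h := (Real.one_div_one_sub_rpow_hasFPowerSeriesOnBall_zero A).hasSum (y := t)
    (by simpa [enorm_eq_nnnorm, ← NNReal.coe_lt_coe] using ht)
  have hcoef : ∀ k : ℕ, Ring.choose (A + k - 1) k = hyperCoeff A 1 1 k := by
    intro k
    rw [← Ring.multichoose_eq]
    have hf : ∀ k : ℕ, ((k.factorial : ℕ) : ℝ) * hyperCoeff A 1 1 k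
        = Polynomial.eval A (ascPochhammer ℝ k) := by
      intro k
      induction k with
      | zero => simp [hyperCoeff]
      | succ k ih =>
        rw [ascPochhammer_succ_eval, ← ih, hyperCoeff, Nat.factorial_succ]
        push_cast; field_simp
    have h2 := Ring.factorial_nsmul_multichoose_eq_ascPochhammer A k
    rw [Polynomial.ascPochhammer_smeval_eq_eval, ← hf k, nsmul_eq_mul] at h2
    exact mul_left_cancel₀ (by positivity) h2
  have hpos : 0 ≤ 1 - t := by linarith [(abs_lt.1 ht).2]
  simp only [zero_add, one_div, ← Real.rpow_neg hpos] at h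
  refine hasSum_of_eq h (fun k => ?_) rfl
  simp [hcoef, mul_comm]

/-- Gauss' formula for `₂F₁(A, B; C; 1)`. -/
lemma hasSum_hyperCoeff {A B C : ℝ} (hA : 0 < A) (hB : 0 < B) (h : A + B < C) :
    HasSum (hyperCoeff A B C)
      (Real.Gamma C * Real.Gamma (C - A - B) / (Real.Gamma (C - A) * Real.Gamma (C - B))) := by
  have hCB : 0 < C - B := by linarith
  have hCAB : 0 < C - B - A := by linarith
  have hβ := ProbabilityTheory.beta_pos hB hCB
  -- Euler's integral: up to the factor beta(B, C-B), the k-th coefficient is the integral of the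
  -- k-th term of the binomial series of (1-x)^(-A) against x^(B-1) (1-x)^(C-B-1). Summing leaves
  -- one beta integral.
  have hcoef : ∀ k : ℕ, hyperCoeff A B C k * ProbabilityTheory.beta B (C - B)
      = hyperCoeff A 1 1 k * ProbabilityTheory.beta (B + k) (C - B) := by
    intro k
    induction k with
    | zero => simp [hyperCoeff]
    | succ k ih =>
      have e : B + ((k + 1 : ℕ) : ℝ) = (B + k) + 1 := by push_cast; ring
      rw [e, beta_add_one_left (by positivity) hCB, hyperCoeff, hyperCoeff]
      have e2 : B + (k : ℝ) + (C - B) = C + k := by ring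
      rw [e2]
      have : 0 < C := by linarith
      calc _ = (hyperCoeff A B C k * ProbabilityTheory.beta B (C - B)) *
            ((A + k) * (B + k) / ((C + k) * (k + 1))) := by ring
        _ = _ := by rw [ih]; field_simp
  have hsum : ∑' k, ENNReal.ofReal (hyperCoeff A B C k * ProbabilityTheory.beta B (C - B))
      = ENNReal.ofReal (ProbabilityTheory.beta B (C - B - A)) := by
    rw [← lintegral_beta hB hCAB]
    have hpt : ∀ x ∈ Ioo (0 : ℝ) 1, ENNReal.ofReal (x ^ (B - 1) * (1 - x) ^ (C - B - A - 1))
        = ∑' k : ℕ, ENNReal.ofReal (hyperCoeff A 1 1 k *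
            (x ^ (B + k - 1) * (1 - x) ^ (C - B - 1))) := by
      intro x hx
      have hx1 : 0 < 1 - x := by linarith [hx.2]
      have hs := (hasSum_one_sub_rpow_neg A (t := x) (by rw [abs_of_pos hx.1]; exact hx.2)).mul_left
        (x ^ (B - 1) * (1 - x) ^ (C - B - 1))
      have hs' : HasSum (fun k : ℕ => hyperCoeff A 1 1 k *
            (x ^ (B + k - 1) * (1 - x) ^ (C - B - 1)))
          (x ^ (B - 1) * (1 - x) ^ (C - B - A - 1)) := by
        refine hasSum_of_eq hs (fun k => ?_) ?_
        · rw [show B + (k : ℝ) - 1 = (B - 1) + k by ring, Real.rpow_add hx.1, Real.rpow_natCast]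
          ring
        · rw [show C - B - A - 1 = (C - B - 1) + -A by ring, Real.rpow_add hx1]; ring
      rw [← hs'.tsum_eq]
      exact ENNReal.ofReal_tsum_of_nonneg (fun k => mul_nonneg
        (hyperCoeff_pos hA one_pos one_pos k).le
        (mul_nonneg (Real.rpow_nonneg hx.1.le _) (Real.rpow_nonneg hx1.le _))) hs'.summable
    rw [setLIntegral_congr_fun measurableSet_Ioo hpt, lintegral_tsum (fun k => by fun_prop)]
    refine tsum_congr fun k => ?_
    simp_rw [ENNReal.ofReal_mul (hyperCoeff_pos hA one_pos one_pos k).le]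
    rw [lintegral_const_mul' _ _ ENNReal.ofReal_ne_top, lintegral_beta (by positivity) hCB,
      ← ENNReal.ofReal_mul (hyperCoeff_pos hA one_pos one_pos k).le, hcoef]
  have hC : 0 < C := by linarith
  have := (hasSum_of_tsum_ofReal (fun k => (mul_pos (hyperCoeff_pos hA hB hC k) hβ).le)
    (ProbabilityTheory.beta_pos hB hCAB).le hsum).div_const (ProbabilityTheory.beta B (C - B))
  simp only [mul_div_cancel_right₀ _ hβ.ne'] at this
  refine hasSum_of_eq this (fun k => rfl) ?_
  unfold ProbabilityTheory.beta
  rw [show B + (C - B) = C by ring, show B + (C - B - A) = C - A by ring,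
    show C - B - A = C - A - B by ring]
  have g1 := (Real.Gamma_pos_of_pos hB).ne'
  have g2 := (Real.Gamma_pos_of_pos hCB).ne'
  have g3 := (Real.Gamma_pos_of_pos hC).ne'
  have g4 := (Real.Gamma_pos_of_pos (by linarith : 0 < C - A)).ne'
  field_simp

/-! ### The flux of the hypergeometric function at the endpoint `1` -/

/-- The flux `s^C (1-s)^β F'(s)` of the hypergeometric function `F = ₂F₁(A, B; C; ·)`. -/
def flux (A B C β s : ℝ) : ℝ := s ^ C * (1 - s) ^ β * hyperDeriv A B C s

/-- The limit of the flux at `1`. -/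
def fluxLimit (A B C β : ℝ) : ℝ :=
  Real.Gamma C * Real.Gamma β / (Real.Gamma A * Real.Gamma B)

/-- The hypergeometric equation in divergence form. The integrating factor is s^(C-1) (1-s)^(β-1),
and C + β = A + B + 1 is what makes it one. -/
lemma hasDerivAt_flux {A B C β : ℝ} (hA : 0 < A) (hB : 0 < B) (hC : 0 < C) (hβ : 0 < β)
    (hβ1 : β < 1) (h : C + β = A + B + 1) {s : ℝ} (hs : s ∈ Ioo (0 : ℝ) 1) :
    HasDerivAt (flux A B C β)
      (A * B * (s ^ (C - 1) * (1 - s) ^ (β - 1) * hyper A B C s)) s := by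
  have hs1 : 0 < 1 - s := by linarith [hs.2]
  obtain ⟨F2, hF2, hode⟩ := exists_hasDerivAt_hyperDeriv hA hB hC (by linarith)
    (s := s) (by rw [abs_of_pos hs.1]; exact hs.2)
  have d1 := (hasDerivAt_id s).rpow_const (p := C) (Or.inl hs.1.ne')
  have d2 := ((hasDerivAt_id s).const_sub 1).rpow_const (p := β) (Or.inl hs1.ne')
  refine ((d1.mul d2).mul hF2).congr_deriv ?_
  have e1 : s ^ C = s ^ (C - 1) * s := by
    rw [Real.rpow_sub_one hs.1.ne']; field_simp [hs.1.ne']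
  have e2 : (1 - s) ^ β = (1 - s) ^ (β - 1) * (1 - s) := by
    rw [Real.rpow_sub_one hs1.ne']; field_simp [hs1.ne']
  simp only [id, Pi.mul_apply]
  rw [e1, e2]
  have hβ' : β = A + B + 1 - C := by linarith
  linear_combination (s ^ (C - 1) * (1 - s) ^ (β - 1)) * hode -
    (s ^ (C - 1) * (1 - s) ^ (β - 1) * s * hyperDeriv A B C s) * hβ'

/-- Integrating term by term multiplies the k-th coefficient by beta(C+k, β). Because C + β = A + B
+ 1, this replaces the parameter C by A + B + 1, and Gauss' formula applies to the new series. -/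
lemma lintegral_fluxDensity {A B C β : ℝ} (hA : 0 < A) (hB : 0 < B) (hC : 0 < C) (hβ : 0 < β)
    (hβ1 : β < 1) (h : C + β = A + B + 1) :
    ∫⁻ s in Ioo (0 : ℝ) 1,
      ENNReal.ofReal (A * B * (s ^ (C - 1) * (1 - s) ^ (β - 1) * hyper A B C s)) =
      ENNReal.ofReal (fluxLimit A B C β) := by
  have hAB : 0 < A + B + 1 := by positivity
  have hpt : ∀ s ∈ Ioo (0 : ℝ) 1,
      ENNReal.ofReal (A * B * (s ^ (C - 1) * (1 - s) ^ (β - 1) * hyper A B C s)) =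
      ∑' k : ℕ, ENNReal.ofReal (A * B * hyperCoeff A B C k *
        (s ^ (C + k - 1) * (1 - s) ^ (β - 1))) := by
    intro s hs
    have hs1 : 0 < 1 - s := by linarith [hs.2]
    have hsum := ((summable_hyper hA hB hC (by linarith) (s := s)
      (by rw [abs_of_pos hs.1]; exact hs.2)).hasSum).mul_left
        (A * B * (s ^ (C - 1) * (1 - s) ^ (β - 1)))
    have hsum' : HasSum (fun k : ℕ => A * B * hyperCoeff A B C k *
        (s ^ (C + k - 1) * (1 - s) ^ (β - 1)))
        (A * B * (s ^ (C - 1) * (1 - s) ^ (β - 1) * hyper A B C s)) := by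
      refine hasSum_of_eq hsum (fun k => ?_) (by rw [hyper]; ring)
      rw [show C + (k : ℝ) - 1 = (C - 1) + k by ring, Real.rpow_add hs.1, Real.rpow_natCast]
      ring
    rw [← hsum'.tsum_eq]
    refine ENNReal.ofReal_tsum_of_nonneg (fun k => ?_) hsum'.summable
    have := (hyperCoeff_pos hA hB hC k).le
    have := Real.rpow_nonneg hs.1.le (C + k - 1)
    have := Real.rpow_nonneg hs1.le (β - 1)
    positivity
  rw [setLIntegral_congr_fun measurableSet_Ioo hpt, lintegral_tsum (fun k => by fun_prop)]
  have hpos : ∀ k, 0 ≤ A * B * hyperCoeff A B C k := fun k =>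
    mul_nonneg (by positivity) (hyperCoeff_pos hA hB hC k).le
  have hcoef : ∀ k : ℕ, hyperCoeff A B C k * ProbabilityTheory.beta (C + k) β =
      ProbabilityTheory.beta C β * hyperCoeff A B (A + B + 1) k := by
    intro k
    induction k with
    | zero => simp [hyperCoeff]
    | succ k ih =>
      have e : C + ((k + 1 : ℕ) : ℝ) = (C + k) + 1 := by push_cast; ring
      rw [e, beta_add_one_left (by positivity) hβ, hyperCoeff, hyperCoeff]
      have e2 : C + (k : ℝ) + β = A + B + 1 + k := by linarith
      rw [e2]
      calc _ = (hyperCoeff A B C k * ProbabilityTheory.beta (C + k) β) *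
            ((A + k) * (B + k) / ((A + B + 1 + k) * (k + 1))) := by field_simp
        _ = _ := by rw [ih]; ring
  have hterm : ∀ k : ℕ, ∫⁻ s in Ioo (0 : ℝ) 1, ENNReal.ofReal (A * B * hyperCoeff A B C k *
        (s ^ (C + k - 1) * (1 - s) ^ (β - 1))) = ENNReal.ofReal
        (A * B * ProbabilityTheory.beta C β * hyperCoeff A B (A + B + 1) k) := by
    intro k
    simp_rw [ENNReal.ofReal_mul (hpos k)]
    rw [lintegral_const_mul' _ _ ENNReal.ofReal_ne_top, lintegral_beta (by positivity) hβ,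
      ← ENNReal.ofReal_mul (hpos k), mul_assoc (A * B), hcoef]
    ring_nf
  simp_rw [hterm]
  have hg := (hasSum_hyperCoeff hA hB (show A + B < A + B + 1 by linarith)).mul_left
    (A * B * ProbabilityTheory.beta C β)
  rw [← ENNReal.ofReal_tsum_of_nonneg (fun k => ?_) hg.summable, hg.tsum_eq]
  · congr 1
    unfold ProbabilityTheory.beta fluxLimit
    rw [h, show A + B + 1 - A - B = 1 by ring, show A + B + 1 - A = B + 1 by ring,
      show A + B + 1 - B = A + 1 by ring, Real.Gamma_one, Real.Gamma_add_one hA.ne',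
      Real.Gamma_add_one hB.ne']
    have g1 := (Real.Gamma_pos_of_pos hA).ne'
    have g2 := (Real.Gamma_pos_of_pos hB).ne'
    have g3 := (Real.Gamma_pos_of_pos hAB).ne'
    field_simp
  · have := (ProbabilityTheory.beta_pos hC hβ).le
    have := (hyperCoeff_pos hA hB hAB k).le
    positivity

lemma continuousAt_hyperDeriv {A B C : ℝ} (hA : 0 < A) (hB : 0 < B) (hC : 0 < C)
    (h : A + B < C + 1) {s : ℝ} (hs : |s| < 1) : ContinuousAt (hyperDeriv A B C) s := by
  obtain ⟨F2, hF2, _⟩ := exists_hasDerivAt_hyperDeriv hA hB hC h hs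
  exact hF2.continuousAt

lemma fluxDensity_nonneg {A B C β : ℝ} (hA : 0 < A) (hB : 0 < B) (hC : 0 < C)
    (h : A + B < C + 1) {s : ℝ} (hs : s ∈ Ioo (0 : ℝ) 1) :
    0 ≤ A * B * (s ^ (C - 1) * (1 - s) ^ (β - 1) * hyper A B C s) := by
  have := Real.rpow_nonneg hs.1.le (C - 1)
  have := Real.rpow_nonneg (sub_pos.2 hs.2).le (β - 1)
  have := one_le_hyper hA hB hC h hs.1.le hs.2
  positivity

lemma fluxLimit_pos {A B C β : ℝ} (hA : 0 < A) (hB : 0 < B) (hC : 0 < C) (hβ : 0 < β) :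
    0 < fluxLimit A B C β := by
  have g1 := (Real.Gamma_pos_of_pos hA)
  have g2 := (Real.Gamma_pos_of_pos hB)
  have g3 := (Real.Gamma_pos_of_pos hC)
  have g4 := (Real.Gamma_pos_of_pos hβ)
  unfold fluxLimit; positivity

/-- F' itself is unbounded at 1, but the flux is the primitive, vanishing at 0, of a nonnegative
density of finite total mass `fluxLimit A B C β`. It is therefore bounded by that mass and tends to
it. -/
lemma tendsto_flux_and_le {A B C β : ℝ} (hA : 0 < A) (hB : 0 < B) (hC : 0 < C) (hβ : 0 < β)
    (hβ1 : β < 1) (h : C + β = A + B + 1) :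
    Tendsto (flux A B C β) (𝓝[<] 1) (𝓝 (fluxLimit A B C β)) ∧
      ∀ s ∈ Ioo (0 : ℝ) 1, flux A B C β s ≤ fluxLimit A B C β := by
  set f : ℝ → ℝ := fun s => A * B * (s ^ (C - 1) * (1 - s) ^ (β - 1) * hyper A B C s) with hf
  have hlt : A + B < C + 1 := by linarith
  have hnn : ∀ s ∈ Ioo (0 : ℝ) 1, 0 ≤ f s := fun s hs => fluxDensity_nonneg hA hB hC hlt hs
  have hcont : ContinuousOn f (Ioo (0 : ℝ) 1) := by
    intro s hs
    have hs' : |s| < 1 := by rw [abs_of_pos hs.1]; exact hs.2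
    have c1 : ContinuousAt (fun s : ℝ => s ^ (C - 1)) s :=
      continuousAt_id.rpow_const (Or.inl hs.1.ne')
    have c2 : ContinuousAt (fun s : ℝ => (1 - s) ^ (β - 1)) s :=
      (by fun_prop : ContinuousAt (fun s : ℝ => 1 - s) s).rpow_const
        (Or.inl (sub_pos.2 hs.2).ne')
    exact (continuousAt_const.mul ((c1.mul c2).mul
      (hasDerivAt_hyper hA hB hC hlt hs').continuousAt)).continuousWithinAt
  have hmeas : AEStronglyMeasurable f (volume.restrict (Ioo (0 : ℝ) 1)) :=
    hcont.aestronglyMeasurable measurableSet_Ioo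
  have hae : 0 ≤ᵐ[volume.restrict (Ioo (0 : ℝ) 1)] f :=
    ae_restrict_of_forall_mem measurableSet_Ioo hnn
  have hlint := lintegral_fluxDensity hA hB hC hβ hβ1 h
  have hint : IntegrableOn f (Ioo (0 : ℝ) 1) := by
    refine ⟨hmeas, ?_⟩
    rw [hasFiniteIntegral_iff_ofReal hae, hlint]
    exact ENNReal.ofReal_lt_top
  have hval : ∫ s in Ioo (0 : ℝ) 1, f s = fluxLimit A B C β := by
    rw [integral_eq_lintegral_of_nonneg_ae hae hmeas, hlint,
      ENNReal.toReal_ofReal (fluxLimit_pos hA hB hC hβ).le]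
  have hint' : IntegrableOn f (uIcc (0 : ℝ) 1) := by
    rw [uIcc_of_le zero_le_one]; exact (integrableOn_Icc_iff_integrableOn_Ioo).2 hint
  have hii : IntervalIntegrable f volume 0 1 :=
    (intervalIntegrable_iff_integrableOn_Ioo_of_le zero_le_one).2 hint
  have hFTC : ∀ x ∈ Ioo (0 : ℝ) 1, ∫ s in (0 : ℝ)..x, f s = flux A B C β x := by
    intro x hx
    have h0 : Tendsto (flux A B C β) (𝓝[>] 0) (𝓝 0) := by
      have c : ContinuousAt (flux A B C β) 0 := by
        refine ((continuousAt_id.rpow_const (Or.inr hC.le)).mul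
          ((by fun_prop : ContinuousAt (fun s : ℝ => 1 - s) 0).rpow_const (Or.inr hβ.le))).mul
          (continuousAt_hyperDeriv hA hB hC hlt (by simp))
      have := c.tendsto
      simp only [flux, Real.zero_rpow hC.ne', zero_mul] at this
      exact this.mono_left nhdsWithin_le_nhds
    have hx' : Tendsto (flux A B C β) (𝓝[<] x) (𝓝 (flux A B C β x)) :=
      (hasDerivAt_flux hA hB hC hβ hβ1 h hx).continuousAt.tendsto.mono_left nhdsWithin_le_nhds
    have := intervalIntegral.integral_eq_sub_of_hasDerivAt_of_tendsto hx.1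
      (fun s hs => hasDerivAt_flux hA hB hC hβ hβ1 h ⟨hs.1, hs.2.trans hx.2⟩)
      (hii.mono_set (by
        rw [uIcc_of_le hx.1.le, uIcc_of_le zero_le_one]
        exact Icc_subset_Icc_right hx.2.le)) h0 hx'
    rw [this, sub_zero]
  constructor
  · have hc := (intervalIntegral.continuousOn_primitive_interval hint') 1 right_mem_uIcc
    have hc' : Tendsto (fun x => ∫ s in (0 : ℝ)..x, f s) (𝓝[<] 1)
        (𝓝 (∫ s in (0 : ℝ)..1, f s)) := by
      have : 𝓝[<] (1 : ℝ) = 𝓝[Ioo 0 1] 1 := (nhdsWithin_Ioo_eq_nhdsLT one_pos).symm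
      rw [this]
      refine hc.tendsto.mono_left (nhdsWithin_mono _ ?_)
      rw [uIcc_of_le zero_le_one]; exact Ioo_subset_Icc_self
    rw [intervalIntegral.integral_of_le zero_le_one, integral_Ioc_eq_integral_Ioo, hval] at hc'
    refine hc'.congr' ?_
    filter_upwards [Ioo_mem_nhdsLT (zero_lt_one' ℝ)] with x hx using hFTC x hx
  · intro s hs
    rw [← hFTC s hs, ← hval, intervalIntegral.integral_of_le hs.1.le,
      integral_Ioc_eq_integral_Ioo]
    exact setIntegral_mono_set hint hae (Ioo_subset_Ioo_right hs.2.le).eventuallyLE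

/-- Abel's theorem; the series converges at 1 because A + B < C. -/
lemma tendsto_hyper {A B C : ℝ} (hA : 0 < A) (hB : 0 < B) (h : A + B < C) :
    Tendsto (hyper A B C) (𝓝[<] 1) (𝓝 (∑' k, hyperCoeff A B C k)) :=
  Real.tendsto_tsum_powerSeries_nhdsWithin_lt
    (hasSum_hyperCoeff hA hB h).summable.hasSum.tendsto_sum_nat

/-! ### The angular inequality -/

/-- Exhaustion by compact intervals. The weights may be singular at the endpoints, so the
fundamental theorem of calculus is applied only on closed subintervals. -/
lemma lintegral_Ioo_le_of_forall {h : ℝ → ENNReal} {p q : ℝ} {c : ENNReal} (hpq : p < q)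
    (hm : AEMeasurable h (volume.restrict (Ioo p q)))
    (H : ∀ a b, p < a → a ≤ b → b < q → ∫⁻ x in Icc a b, h x ≤ c) :
    ∫⁻ x in Ioo p q, h x ≤ c := by
  -- The shift by 3 keeps the distance to each endpoint below half the length, so the truncated
  -- endpoints stay in order.
  have h3 : ∀ i : ℕ, (0 : ℝ) < (i : ℝ) + 3 := fun i => by positivity
  have ht : Tendsto (fun i : ℕ => (q - p) / ((i : ℝ) + 3)) atTop (𝓝 0) :=
    tendsto_const_nhds.div_atTop
      (tendsto_atTop_add_const_right _ _ tendsto_natCast_atTop_atTop)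
  have ha : Tendsto (fun i : ℕ => p + (q - p) / ((i : ℝ) + 3)) atTop (𝓝 p) := by
    simpa using ht.const_add p
  have hb : Tendsto (fun i : ℕ => q - (q - p) / ((i : ℝ) + 3)) atTop (𝓝 q) := by
    simpa using ht.const_sub q
  have key := (aecover_Ioo_of_Icc (μ := volume) ha hb).lintegral_tendsto_of_countably_generated hm
  refine le_of_tendsto' key fun i => ?_
  have hpos : 0 < (q - p) / ((i : ℝ) + 3) := div_pos (by linarith) (h3 i)
  have hle : (q - p) / ((i : ℝ) + 3) ≤ (q - p) / 2 := by
    have : (0 : ℝ) ≤ i := by positivity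
    gcongr
    · linarith
  refine le_trans (lintegral_mono' (Measure.restrict_mono le_rfl Measure.restrict_le_self) le_rfl)
    (H _ _ ?_ ?_ ?_) <;> linarith

/-- The angular weight `sin^α θ cos^(n-1) θ`. -/
def angWeight (n : ℕ) (α θ : ℝ) : ℝ := Real.sin θ ^ α * Real.cos θ ^ (n - 1)

lemma sin_pos_of_mem {θ : ℝ} (h : θ ∈ Ioo 0 (Real.pi / 2)) : 0 < Real.sin θ :=
  Real.sin_pos_of_pos_of_lt_pi h.1 (by linarith [h.2, Real.pi_pos])

lemma cos_pos_of_mem {θ : ℝ} (h : θ ∈ Ioo 0 (Real.pi / 2)) : 0 < Real.cos θ :=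
  Real.cos_pos_of_mem_Ioo ⟨by linarith [h.1, Real.pi_pos], h.2⟩

lemma cos_sq_mem {θ : ℝ} (h : θ ∈ Ioo 0 (Real.pi / 2)) : Real.cos θ ^ 2 ∈ Ioo (0 : ℝ) 1 := by
  have h1 := sin_pos_of_mem h
  have h2 := cos_pos_of_mem h
  have h3 := Real.sin_sq_add_cos_sq θ
  constructor <;> nlinarith

lemma angWeight_pos {n : ℕ} {α θ : ℝ} (h : θ ∈ Ioo 0 (Real.pi / 2)) : 0 < angWeight n α θ :=
  mul_pos (Real.rpow_pos_of_pos (sin_pos_of_mem h) _) (pow_pos (cos_pos_of_mem h) _)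

lemma continuousAt_angWeight {n : ℕ} {α θ : ℝ} (h : θ ∈ Ioo 0 (Real.pi / 2)) :
    ContinuousAt (angWeight n α) θ :=
  (Real.continuous_sin.continuousAt.rpow_const (Or.inl (sin_pos_of_mem h).ne')).mul
    (by fun_prop)

@[fun_prop]
lemma measurable_angWeight {n : ℕ} {α : ℝ} : Measurable (angWeight n α) := by
  unfold angWeight; fun_prop

/-- The angular flux `-w f'` of `f(θ) = ₂F₁(A, B; C; cos² θ)` for the weight `w = angWeight n α`. -/
def angFlux (n : ℕ) (α A B C θ : ℝ) : ℝ :=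
  angWeight n α θ * (2 * Real.cos θ * Real.sin θ * hyperDeriv A B C (Real.cos θ ^ 2))

section Angular

variable {n : ℕ} {α A B C β : ℝ}

/-- With s = cos² θ one has cos^n θ = s^(n/2) and sin^(α+1) θ = (1-s)^((1+α)/2), which dictates C =
n/2 and β = (1+α)/2. -/
lemma angFlux_eq (hn : 1 ≤ n) (hC : C = n / 2) (hβ : β = (1 + α) / 2) {θ : ℝ}
    (h : θ ∈ Ioo 0 (Real.pi / 2)) :
    angFlux n α A B C θ = 2 * flux A B C β (Real.cos θ ^ 2) := by
  have hs := sin_pos_of_mem h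
  have hc := cos_pos_of_mem h
  have e : 1 - Real.cos θ ^ 2 = Real.sin θ ^ 2 := by linarith [Real.sin_sq_add_cos_sq θ]
  unfold angFlux flux angWeight
  rw [e, ← Real.rpow_natCast_mul hc.le, ← Real.rpow_natCast_mul hs.le, hC, hβ]
  push_cast
  rw [show (2 : ℝ) * ((n : ℝ) / 2) = n by ring, show 2 * ((1 + α) / 2) = α + 1 by ring,
    Real.rpow_natCast, Real.rpow_add_one hs.ne']
  obtain ⟨m, rfl⟩ : ∃ m, n = m + 1 := ⟨n - 1, by omega⟩
  rw [Nat.add_sub_cancel, pow_succ]; ring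

/-- This is (w f')' = 4AB w f for f(θ) = F(cos² θ). The chain rule factor -2 cos θ sin θ raises
s^(C-1) (1-s)^(β-1) to the weight w = cos^(n-1) θ sin^α θ. -/
lemma hasDerivAt_angFlux (hn : 1 ≤ n) (hA : 0 < A) (hB : 0 < B) (hC : C = n / 2)
    (hβ : β = (1 + α) / 2) (hβ0 : 0 < β) (hβ1 : β < 1) (h : C + β = A + B + 1) {θ : ℝ}
    (hθ : θ ∈ Ioo 0 (Real.pi / 2)) :
    HasDerivAt (angFlux n α A B C)
      (-(4 * A * B) * angWeight n α θ * hyper A B C (Real.cos θ ^ 2)) θ := by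
  have hs := sin_pos_of_mem hθ
  have hc := cos_pos_of_mem hθ
  have hC0 : 0 < C := by rw [hC]; have : (1 : ℝ) ≤ n := by exact_mod_cast hn
                         positivity
  have d0 : HasDerivAt (fun θ => Real.cos θ ^ 2) (-(2 * Real.cos θ * Real.sin θ)) θ := by
    refine ((Real.hasDerivAt_cos θ).pow 2).congr_deriv ?_
    ring
  have d := ((hasDerivAt_flux hA hB hC0 hβ0 hβ1 h (cos_sq_mem hθ)).comp θ d0).const_mul 2
  refine (d.congr_of_eventuallyEq ?_).congr_deriv ?_
  · filter_upwards [Ioo_mem_nhds hθ.1 hθ.2] with x hx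
    rw [angFlux_eq hn hC hβ hx]; rfl
  · have e : 1 - Real.cos θ ^ 2 = Real.sin θ ^ 2 := by linarith [Real.sin_sq_add_cos_sq θ]
    have e1 : (Real.sin θ ^ 2) ^ (β - 1) * Real.sin θ = Real.sin θ ^ α := by
      rw [← Real.rpow_natCast_mul hs.le, ← Real.rpow_add_one hs.ne', hβ]
      congr 1; push_cast; ring
    have e2 : (Real.cos θ ^ 2) ^ (C - 1) * Real.cos θ = Real.cos θ ^ (n - 1) := by
      rw [← Real.rpow_natCast_mul hc.le, ← Real.rpow_add_one hc.ne', hC, ← Real.rpow_natCast]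
      congr 1; push_cast [hn]; ring
    unfold angWeight
    rw [e, ← e1, ← e2]; ring

lemma hasDerivAt_hyper_cos (hA : 0 < A) (hB : 0 < B) (hC : 0 < C) (h : A + B < C + 1) {θ : ℝ}
    (hθ : θ ∈ Ioo 0 (Real.pi / 2)) :
    HasDerivAt (fun θ => hyper A B C (Real.cos θ ^ 2))
      (-(2 * Real.cos θ * Real.sin θ * hyperDeriv A B C (Real.cos θ ^ 2))) θ := by
  have hcs := cos_sq_mem hθ
  have d0 : HasDerivAt (fun θ => Real.cos θ ^ 2) (-(2 * Real.cos θ * Real.sin θ)) θ := by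
    refine ((Real.hasDerivAt_cos θ).pow 2).congr_deriv ?_
    ring
  refine ((hasDerivAt_hyper hA hB hC h (by rw [abs_of_pos hcs.1]; exact hcs.2)).comp θ
    d0).congr_deriv ?_
  ring

lemma tendsto_cos_sq : Tendsto (fun θ => Real.cos θ ^ 2) (𝓝[>] 0) (𝓝[<] 1) := by
  refine tendsto_nhdsWithin_iff.2 ⟨?_, ?_⟩
  · have : ContinuousAt (fun θ => Real.cos θ ^ 2) 0 := by fun_prop
    have := this.tendsto
    simp only [Real.cos_zero, one_pow] at this
    exact this.mono_left nhdsWithin_le_nhds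
  · filter_upwards [Ioo_mem_nhdsGT (show (0 : ℝ) < Real.pi / 2 by positivity)] with θ hθ
    exact (cos_sq_mem hθ).2

/-- The constant of the angular inequality. -/
def angConst (A B C β : ℝ) : ℝ := 2 * fluxLimit A B C β / ∑' k, hyperCoeff A B C k

lemma tendsto_angFlux (hn : 1 ≤ n) (hA : 0 < A) (hB : 0 < B) (hC : C = n / 2)
    (hβ : β = (1 + α) / 2) (hβ0 : 0 < β) (hβ1 : β < 1) (h : C + β = A + B + 1) :
    Tendsto (angFlux n α A B C) (𝓝[>] 0) (𝓝 (2 * fluxLimit A B C β)) := by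
  have hC0 : 0 < C := by rw [hC]; have : (1 : ℝ) ≤ n := by exact_mod_cast hn
                         positivity
  have := ((tendsto_flux_and_le hA hB hC0 hβ0 hβ1 h).1.comp tendsto_cos_sq).const_mul 2
  refine this.congr' ?_
  filter_upwards [Ioo_mem_nhdsGT (show (0 : ℝ) < Real.pi / 2 by positivity)] with θ hθ
  rw [angFlux_eq hn hC hβ hθ]; rfl

/-- The weighted one-dimensional trace inequality on `(0, π/2)`. -/
lemma angConst_mul_sq_le (hn : 1 ≤ n) (hA : 0 < A) (hB : 0 < B) (hC : C = n / 2)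
    (hβ : β = (1 + α) / 2) (hβ0 : 0 < β) (hβ1 : β < 1) (h : C + β = A + B + 1)
    {g g' : ℝ → ℝ} (hg : ∀ θ, HasDerivAt g (g' θ) θ) (hg' : Continuous g') :
    ENNReal.ofReal (angConst A B C β * g 0 ^ 2) ≤ ∫⁻ θ in Ioo 0 (Real.pi / 2),
      ENNReal.ofReal (angWeight n α θ * (g' θ ^ 2 + 4 * A * B * g θ ^ 2)) := by
  have hC0 : 0 < C := by rw [hC]; have : (1 : ℝ) ≤ n := by exact_mod_cast hn
                         positivity
  have hlt : A + B < C + 1 := by linarith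
  have hlt' : A + B < C := by linarith
  have hgc : Continuous g := continuous_iff_continuousAt.2 fun θ => (hg θ).continuousAt
  set R : ℝ → ℝ := fun θ => angFlux n α A B C θ / hyper A B C (Real.cos θ ^ 2) with hR
  have hF : ∀ θ ∈ Ioo 0 (Real.pi / 2), 1 ≤ hyper A B C (Real.cos θ ^ 2) := fun θ hθ =>
    one_le_hyper hA hB hC0 hlt (cos_sq_mem hθ).1.le (cos_sq_mem hθ).2
  -- R = -w f'/f satisfies the Riccati equation R' = -4AB w + R²/w.
  have hRd : ∀ θ ∈ Ioo 0 (Real.pi / 2), HasDerivAt R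
      (-(4 * A * B) * angWeight n α θ + R θ ^ 2 / angWeight n α θ) θ := by
    intro θ hθ
    have hF' : hyper A B C (Real.cos θ ^ 2) ≠ 0 := (zero_lt_one.trans_le (hF θ hθ)).ne'
    refine ((hasDerivAt_angFlux hn hA hB hC hβ hβ0 hβ1 h hθ).div
      (hasDerivAt_hyper_cos hA hB hC0 hlt hθ) hF').congr_deriv ?_
    have hw := (angWeight_pos (n := n) (α := α) hθ).ne'
    simp only [hR, angFlux]
    field_simp
    ring
  have hstep : ∀ a b, 0 < a → a ≤ b → b < Real.pi / 2 →
      ENNReal.ofReal (R a * g a ^ 2 - R b * g b ^ 2) ≤ ∫⁻ θ in Ioo 0 (Real.pi / 2),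
        ENNReal.ofReal (angWeight n α θ * (g' θ ^ 2 + 4 * A * B * g θ ^ 2)) := by
    intro a b ha hab hb
    have hsub : Icc a b ⊆ Ioo 0 (Real.pi / 2) := fun x hx => ⟨ha.trans_le hx.1, hx.2.trans_lt hb⟩
    have hφc : ContinuousOn (fun θ => angWeight n α θ * (g' θ ^ 2 + 4 * A * B * g θ ^ 2))
        (Icc a b) := fun x hx => ((continuousAt_angWeight (hsub hx)).mul
          (by fun_prop)).continuousWithinAt
    have hderiv : ∀ x ∈ Ioo 0 (Real.pi / 2), HasDerivAt (fun θ => -(R θ * g θ ^ 2))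
        (-((-(4 * A * B) * angWeight n α x + R x ^ 2 / angWeight n α x) * g x ^ 2 +
          R x * (2 * g x * g' x))) x := by
      intro x hx
      refine ((hRd x hx).mul ((hg x).pow 2)).neg.congr_deriv ?_
      simp
    have hi := hφc.integrableOn_compact isCompact_Icc (μ := volume)
    -- By the Riccati equation, w (g'² + 4AB g²) exceeds the derivative of -R g² by the square w (g'
    -- + R g/w)². Only this inequality is integrated, so the derivative of R g² need not be shown
    -- integrable.
    have := intervalIntegral.sub_le_integral_of_hasDeriv_right_of_le hab
      (fun x hx => (hderiv x (hsub hx)).continuousAt.continuousWithinAt)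
      (fun x hx => (hderiv x (hsub (Ioo_subset_Icc_self hx))).hasDerivWithinAt) hi (by
        intro x hx
        have hw := angWeight_pos (n := n) (α := α) (hsub (Ioo_subset_Icc_self hx))
        have : 0 ≤ angWeight n α x * (g' x + R x / angWeight n α x * g x) ^ 2 := by positivity
        have e : angWeight n α x * (g' x + R x / angWeight n α x * g x) ^ 2 =
          angWeight n α x * g' x ^ 2 + 2 * R x * g x * g' x +
            R x ^ 2 / angWeight n α x * g x ^ 2 := by field_simp; ring
        linarith)
    rw [intervalIntegral.integral_of_le hab, ← integral_Icc_eq_integral_Ioc] at this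
    calc _ ≤ ENNReal.ofReal (∫ θ in Icc a b,
          angWeight n α θ * (g' θ ^ 2 + 4 * A * B * g θ ^ 2)) :=
          ENNReal.ofReal_le_ofReal (by linarith)
      _ = ∫⁻ θ in Icc a b, ENNReal.ofReal
          (angWeight n α θ * (g' θ ^ 2 + 4 * A * B * g θ ^ 2)) := by
          refine ofReal_integral_eq_lintegral_ofReal hi
            (ae_restrict_of_forall_mem measurableSet_Icc fun x hx => ?_)
          have := (angWeight_pos (n := n) (α := α) (hsub hx)).le
          simp only [Pi.zero_apply]
          positivity
      _ ≤ _ := lintegral_mono_set hsub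
  -- The factor cos θ makes the flux vanish at π/2, and f ≥ 1 there, so no boundary term survives at
  -- that end.
  have hRb : Tendsto R (𝓝[<] (Real.pi / 2)) (𝓝 0) := by
    have h1 : Tendsto (angFlux n α A B C) (𝓝[<] (Real.pi / 2)) (𝓝 0) := by
      have c : ContinuousAt (angFlux n α A B C) (Real.pi / 2) := by
        have hs : ContinuousAt (angWeight n α) (Real.pi / 2) :=
          (Real.continuous_sin.continuousAt.rpow_const (Or.inl (by simp))).mul (by fun_prop)
        refine hs.mul ((by fun_prop : ContinuousAt (fun θ => 2 * Real.cos θ * Real.sin θ)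
          (Real.pi / 2)).mul ?_)
        have c1 : ContinuousAt (hyperDeriv A B C) (Real.cos (Real.pi / 2) ^ 2) :=
          continuousAt_hyperDeriv hA hB hC0 hlt (by simp)
        exact ContinuousAt.comp (f := fun θ => Real.cos θ ^ 2) c1 (by fun_prop)
      have := c.tendsto
      simp only [angFlux, Real.cos_pi_div_two, mul_zero, zero_mul] at this
      exact this.mono_left nhdsWithin_le_nhds
    refine squeeze_zero_norm' ?_ (tendsto_norm_zero.comp h1)
    filter_upwards [Ioo_mem_nhdsLT (show (0 : ℝ) < Real.pi / 2 by positivity)] with θ hθ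
    have := hF θ hθ
    simp only [hR, norm_div, Function.comp]
    refine div_le_self (norm_nonneg _) ?_
    rw [Real.norm_eq_abs]; exact this.trans (le_abs_self _)
  have hRa : Tendsto R (𝓝[>] 0) (𝓝 (angConst A B C β)) := by
    refine (tendsto_angFlux hn hA hB hC hβ hβ0 hβ1 h).div
      ((tendsto_hyper hA hB hlt').comp tendsto_cos_sq) ?_
    have hs := (hasSum_hyperCoeff hA hB hlt').summable
    exact (hs.tsum_pos (fun k => (hyperCoeff_pos hA hB hC0 k).le) 0
      (hyperCoeff_pos hA hB hC0 0)).ne'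
  have hstep2 : ∀ a ∈ Ioo 0 (Real.pi / 2),
      ENNReal.ofReal (R a * g a ^ 2) ≤ ∫⁻ θ in Ioo 0 (Real.pi / 2),
        ENNReal.ofReal (angWeight n α θ * (g' θ ^ 2 + 4 * A * B * g θ ^ 2)) := by
    intro a ha
    have ht : Tendsto (fun b => ENNReal.ofReal (R a * g a ^ 2 - R b * g b ^ 2))
        (𝓝[<] (Real.pi / 2)) (𝓝 (ENNReal.ofReal (R a * g a ^ 2 - 0 * g (Real.pi / 2) ^ 2))) := by
      refine ENNReal.tendsto_ofReal (tendsto_const_nhds.sub (hRb.mul ?_))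
      exact ((hgc.pow 2).tendsto _).mono_left nhdsWithin_le_nhds
    rw [zero_mul, sub_zero] at ht
    refine le_of_tendsto ht ?_
    filter_upwards [Ioo_mem_nhdsLT ha.2] with b hb using hstep a b ha.1 hb.1.le hb.2
  refine le_of_tendsto (ENNReal.tendsto_ofReal (hRa.mul
    (((hgc.pow 2).tendsto 0).mono_left nhdsWithin_le_nhds))) ?_
  filter_upwards [Ioo_mem_nhdsGT (show (0 : ℝ) < Real.pi / 2 by positivity)] with a ha
    using hstep2 a ha

/-- For g = f the completed square vanishes and the integrand is exactly the derivative of w f f'.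
The boundary term at π/2 has the right sign. At 0 it is at most 2 · `fluxLimit` · F(1), by the bound
on the flux and the monotonicity of F, and this equals the constant times F(1)². -/
lemma lintegral_angular_hyper_le (hn : 1 ≤ n) (hA : 0 < A) (hB : 0 < B) (hC : C = n / 2)
    (hβ : β = (1 + α) / 2) (hβ0 : 0 < β) (hβ1 : β < 1) (h : C + β = A + B + 1) :
    ∫⁻ θ in Ioo 0 (Real.pi / 2), ENNReal.ofReal (angWeight n α θ *
      ((2 * Real.cos θ * Real.sin θ * hyperDeriv A B C (Real.cos θ ^ 2)) ^ 2 +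
        4 * A * B * hyper A B C (Real.cos θ ^ 2) ^ 2)) ≤
      ENNReal.ofReal (angConst A B C β * (∑' k, hyperCoeff A B C k) ^ 2) := by
  have hC0 : 0 < C := by rw [hC]; have : (1 : ℝ) ≤ n := by exact_mod_cast hn
                         positivity
  have hlt : A + B < C + 1 := by linarith
  have hlt' : A + B < C := by linarith
  have hs := (hasSum_hyperCoeff hA hB hlt').summable
  have hS : 0 < ∑' k, hyperCoeff A B C k := hs.tsum_pos (fun k => (hyperCoeff_pos hA hB hC0 k).le) 0
      (hyperCoeff_pos hA hB hC0 0)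
  set φ : ℝ → ℝ := fun θ => angWeight n α θ *
      ((2 * Real.cos θ * Real.sin θ * hyperDeriv A B C (Real.cos θ ^ 2)) ^ 2 +
        4 * A * B * hyper A B C (Real.cos θ ^ 2) ^ 2) with hφ
  have hFd : ∀ θ ∈ Ioo 0 (Real.pi / 2), HasDerivAt (fun θ => hyper A B C (Real.cos θ ^ 2))
      (-(2 * Real.cos θ * Real.sin θ * hyperDeriv A B C (Real.cos θ ^ 2))) θ :=
    fun θ hθ => hasDerivAt_hyper_cos hA hB hC0 hlt hθ
  have hφc : ∀ θ ∈ Ioo 0 (Real.pi / 2), ContinuousAt φ θ := by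
    intro θ hθ
    have c1 : ContinuousAt (hyperDeriv A B C) (Real.cos θ ^ 2) :=
      continuousAt_hyperDeriv hA hB hC0 hlt
        (by rw [abs_of_pos (cos_sq_mem hθ).1]; exact (cos_sq_mem hθ).2)
    have c2 : ContinuousAt (fun θ => hyperDeriv A B C (Real.cos θ ^ 2)) θ :=
      ContinuousAt.comp (f := fun θ => Real.cos θ ^ 2) c1 (by fun_prop)
    exact (continuousAt_angWeight hθ).mul
      ((((by fun_prop : ContinuousAt (fun θ => 2 * Real.cos θ * Real.sin θ) θ).mul c2).pow 2).add
        (continuousAt_const.mul ((hFd θ hθ).continuousAt.pow 2)))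
  have hφm : AEMeasurable (fun θ => ENNReal.ofReal (φ θ))
      (volume.restrict (Ioo 0 (Real.pi / 2))) :=
    (ContinuousOn.aemeasurable (fun θ hθ => (hφc θ hθ).continuousWithinAt)
      measurableSet_Ioo).ennreal_ofReal
  have hflux0 : ∀ θ ∈ Ioo 0 (Real.pi / 2), 0 ≤ angFlux n α A B C θ := by
    intro θ hθ
    have h1 := (sin_pos_of_mem hθ).le
    have h2 := (cos_pos_of_mem hθ).le
    have h3 := hyperDeriv_nonneg hA hB hC0 (sq_nonneg (Real.cos θ))
    have h4 := (angWeight_pos (n := n) (α := α) hθ).le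
    unfold angFlux; positivity
  have hfluxle : ∀ θ ∈ Ioo 0 (Real.pi / 2), angFlux n α A B C θ ≤ 2 * fluxLimit A B C β := by
    intro θ hθ
    rw [angFlux_eq hn hC hβ hθ]
    linarith [(tendsto_flux_and_le hA hB hC0 hβ0 hβ1 h).2 _ (cos_sq_mem hθ)]
  have hF1 : ∀ θ ∈ Ioo 0 (Real.pi / 2), 1 ≤ hyper A B C (Real.cos θ ^ 2) := fun θ hθ =>
    one_le_hyper hA hB hC0 hlt (cos_sq_mem hθ).1.le (cos_sq_mem hθ).2
  have hFle : ∀ θ ∈ Ioo 0 (Real.pi / 2),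
      hyper A B C (Real.cos θ ^ 2) ≤ ∑' k, hyperCoeff A B C k := by
    intro θ hθ
    have hcs := cos_sq_mem hθ
    refine (summable_hyper hA hB hC0 hlt (by rw [abs_of_pos hcs.1]; exact hcs.2)).tsum_le_tsum
      (fun k => ?_) hs
    exact mul_le_of_le_one_right (hyperCoeff_pos hA hB hC0 k).le (pow_le_one₀ hcs.1.le hcs.2.le)
  refine lintegral_Ioo_le_of_forall (by positivity) hφm fun a b ha hab hb => ?_
  have hsub : Icc a b ⊆ Ioo 0 (Real.pi / 2) := fun x hx => ⟨ha.trans_le hx.1, hx.2.trans_lt hb⟩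
  have hcont : ContinuousOn φ (Icc a b) := fun x hx => (hφc x (hsub hx)).continuousWithinAt
  have hi := hcont.integrableOn_compact isCompact_Icc (μ := volume)
  rw [← ofReal_integral_eq_lintegral_ofReal hi
    (ae_restrict_of_forall_mem measurableSet_Icc fun x hx => by
      have := (angWeight_pos (n := n) (α := α) (hsub hx)).le
      simp only [Pi.zero_apply, hφ]
      positivity)]
  refine ENNReal.ofReal_le_ofReal ?_
  rw [integral_Icc_eq_integral_Ioc, ← intervalIntegral.integral_of_le hab]
  have hd : ∀ x ∈ Ioo 0 (Real.pi / 2), HasDerivAt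
      (fun θ => -(angFlux n α A B C θ * hyper A B C (Real.cos θ ^ 2))) (φ x) x := by
    intro x hx
    refine ((hasDerivAt_angFlux hn hA hB hC hβ hβ0 hβ1 h hx).mul (hFd x hx)).neg.congr_deriv ?_
    simp only [hφ, angFlux]; ring
  rw [intervalIntegral.integral_eq_sub_of_hasDerivAt
    (fun x hx => hd x (hsub (by rwa [uIcc_of_le hab] at hx)))
    (hcont.intervalIntegrable_of_Icc hab)]
  have ha' := hsub (left_mem_Icc.2 hab)
  have hb' := hsub (right_mem_Icc.2 hab)
  have k1 := mul_nonneg (hflux0 b hb') (zero_le_one.trans (hF1 b hb'))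
  have k2 := mul_le_mul (hfluxle a ha') (hFle a ha') (zero_le_one.trans (hF1 a ha'))
    ((hflux0 a ha').trans (hfluxle a ha'))
  have k3 : angConst A B C β * (∑' k, hyperCoeff A B C k) ^ 2 =
      2 * fluxLimit A B C β * ∑' k, hyperCoeff A B C k := by
    unfold angConst; field_simp
  linarith

end Angular

/-- The Taylor polynomials of the hypergeometric function. -/
def hyperPoly (A B C : ℝ) (m : ℕ) : Polynomial ℝ :=
  ∑ k ∈ Finset.range (m + 1), Polynomial.C (hyperCoeff A B C k) * Polynomial.X ^ k

lemma hyperPoly_eval (A B C : ℝ) (m : ℕ) (s : ℝ) :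
    (hyperPoly A B C m).eval s = ∑ k ∈ Finset.range (m + 1), hyperCoeff A B C k * s ^ k := by
  simp [hyperPoly, Polynomial.eval_finsetSum]

lemma hyperPoly_derivative_eval (A B C : ℝ) (m : ℕ) (s : ℝ) :
    (hyperPoly A B C m).derivative.eval s =
      ∑ k ∈ Finset.range m, ((k : ℝ) + 1) * hyperCoeff A B C (k + 1) * s ^ k := by
  rw [hyperPoly, Polynomial.derivative_sum, Polynomial.eval_finsetSum, Finset.sum_range_succ']
  simp only [Polynomial.derivative_C_mul_X_pow]
  simp
  refine Finset.sum_congr rfl fun k _ => ?_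
  ring

/-- The derivative of f can blow up at θ = 0, so f is replaced by Taylor polynomials in cos² θ.
Since all coefficients are positive, the polynomials and their derivatives stay below those of F.
The energy therefore does not increase, while the value at 1 tends to F(1). The constant term 1
gives q ≥ 1. -/
lemma exists_polynomial_angular {n : ℕ} {α A B C β : ℝ} (hn : 1 ≤ n) (hA : 0 < A) (hB : 0 < B)
    (hC : C = n / 2) (hβ : β = (1 + α) / 2) (hβ0 : 0 < β) (hβ1 : β < 1)
    (h : C + β = A + B + 1) {ε : ℝ} (hε : 0 < ε) :
    ∃ q : Polynomial ℝ, (∀ s, 0 ≤ s → 1 ≤ q.eval s) ∧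
      ∫⁻ θ in Ioo 0 (Real.pi / 2), ENNReal.ofReal (angWeight n α θ *
        ((2 * Real.cos θ * Real.sin θ * q.derivative.eval (Real.cos θ ^ 2)) ^ 2 +
          4 * A * B * q.eval (Real.cos θ ^ 2) ^ 2)) ≤
        ENNReal.ofReal (angConst A B C β * q.eval 1 ^ 2 + ε) := by
  have hC0 : 0 < C := by rw [hC]; have : (1 : ℝ) ≤ n := by exact_mod_cast hn
                         positivity
  have hlt : A + B < C + 1 := by linarith
  have hlt' : A + B < C := by linarith
  have hs := (hasSum_hyperCoeff hA hB hlt').summable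
  have hpos := hyperCoeff_pos hA hB hC0
  have ht : Tendsto (fun m => angConst A B C β * (hyperPoly A B C m).eval 1 ^ 2 + ε) atTop
      (𝓝 (angConst A B C β * (∑' k, hyperCoeff A B C k) ^ 2 + ε)) := by
    refine Tendsto.add_const _ (Tendsto.const_mul _ (Tendsto.pow ?_ 2))
    simp only [hyperPoly_eval, one_pow, mul_one]
    exact hs.hasSum.tendsto_sum_nat.comp (tendsto_add_atTop_nat 1)
  obtain ⟨m, hm⟩ := (ht.eventually_const_lt
    (show angConst A B C β * (∑' k, hyperCoeff A B C k) ^ 2 < _ by linarith)).exists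
  refine ⟨hyperPoly A B C m, fun s hs0 => ?_, ?_⟩
  · rw [hyperPoly_eval, Finset.sum_range_succ']
    have : 0 ≤ ∑ k ∈ Finset.range m, hyperCoeff A B C (k + 1) * s ^ (k + 1) :=
      Finset.sum_nonneg fun k _ => mul_nonneg (hpos _).le (by positivity)
    simpa [hyperCoeff] using this
  · refine le_trans ?_ ((lintegral_angular_hyper_le hn hA hB hC hβ hβ0 hβ1 h).trans
      (ENNReal.ofReal_le_ofReal hm.le))
    refine setLIntegral_mono' measurableSet_Ioo fun θ hθ => ENNReal.ofReal_le_ofReal ?_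
    have hcs := cos_sq_mem hθ
    have habs : |Real.cos θ ^ 2| < 1 := by rw [abs_of_pos hcs.1]; exact hcs.2
    have h1 : 0 ≤ (hyperPoly A B C m).derivative.eval (Real.cos θ ^ 2) := by
      rw [hyperPoly_derivative_eval]
      exact Finset.sum_nonneg fun k _ => mul_nonneg (mul_nonneg (by positivity) (hpos _).le)
        (by positivity)
    have h2 : (hyperPoly A B C m).derivative.eval (Real.cos θ ^ 2) ≤
        hyperDeriv A B C (Real.cos θ ^ 2) := by
      rw [hyperPoly_derivative_eval]
      exact (summable_hyperDeriv hA hB hC0 hlt habs).sum_le_tsum _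
        fun k _ => mul_nonneg (mul_nonneg (by positivity) (hpos _).le) (by positivity)
    have h3 : 0 ≤ (hyperPoly A B C m).eval (Real.cos θ ^ 2) := by
      rw [hyperPoly_eval]
      exact Finset.sum_nonneg fun k _ => mul_nonneg (hpos _).le (by positivity)
    have h4 : (hyperPoly A B C m).eval (Real.cos θ ^ 2) ≤ hyper A B C (Real.cos θ ^ 2) := by
      rw [hyperPoly_eval]
      exact (summable_hyper hA hB hC0 hlt habs).sum_le_tsum _
        fun k _ => mul_nonneg (hpos _).le (by positivity)
    have hw := (angWeight_pos (n := n) (α := α) hθ).le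
    have hcs0 : 0 ≤ 2 * Real.cos θ * Real.sin θ := by
      have := sin_pos_of_mem hθ
      have := cos_pos_of_mem hθ
      positivity
    gcongr

/-! ### The constant `K(n, α, b)` -/

section Constant

variable {n : ℕ} {α b : ℝ}

lemma one_le_dim (hα : α ∈ Ioo (-1 : ℝ) 1) (hb : 2 - α ≤ b) (hbn : b < n + 1) : 1 ≤ n := by
  by_contra h
  obtain rfl : n = 0 := by omega
  have := hα.2
  norm_num at hbn
  linarith

lemma dim_cast_add_pos (hb : 2 - α ≤ b) (hbn : b < n + 1) :
    0 < n + α - 1 := by linarith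

lemma fst_param_pos (hb : 2 - α ≤ b) (hbn : b < n + 1) :
    0 < (n + 2 * α + b - 3) / 4 := by linarith

/-- With these parameters C - A - B = (1-α)/2, and the Gamma factors of the flux limit and of Gauss'
formula combine. The prefactor 1-α turns into the 2 of `angConst` through Γ((3-α)/2) = ((1-α)/2)
Γ((1-α)/2). -/
lemma K_eq (hα : α ∈ Ioo (-1 : ℝ) 1) (hb : 2 - α ≤ b) (hbn : b < n + 1) :
    K n α b = angConst ((n + 2 * α + b - 3) / 4) ((n + 1 - b) / 4) (n / 2) ((1 + α) / 2) := by
  have hA := fst_param_pos hb hbn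
  have hB : 0 < (n + 1 - b) / 4 := by linarith
  obtain ⟨h1, h2⟩ := hα
  have hn : (1 : ℝ) ≤ n := by exact_mod_cast one_le_dim ⟨h1, h2⟩ hb hbn
  unfold angConst K fluxLimit
  rw [(hasSum_hyperCoeff hA hB (show _ < (n : ℝ) / 2 by linarith)).tsum_eq,
    show (n : ℝ) / 2 - (n + 2 * α + b - 3) / 4 - (n + 1 - b) / 4 = (1 - α) / 2 by ring,
    show (n : ℝ) / 2 - (n + 2 * α + b - 3) / 4 = (n - 2 * α - b + 3) / 4 by ring,
    show (n : ℝ) / 2 - (n + 1 - b) / 4 = (n + b - 1) / 4 by ring,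
    show (3 - α) / 2 = (1 - α) / 2 + 1 by ring, Real.Gamma_add_one (by linarith),
    show (α + 1) / 2 = (1 + α) / 2 by ring]
  have g1 := (Real.Gamma_pos_of_pos hA).ne'
  have g2 := (Real.Gamma_pos_of_pos hB).ne'
  have g3 := (Real.Gamma_pos_of_pos (show 0 < (1 - α) / 2 by linarith)).ne'
  have g4 := (Real.Gamma_pos_of_pos (show 0 < (n - 2 * α - b + 3) / 4 by linarith)).ne'
  have g5 := (Real.Gamma_pos_of_pos (show 0 < (n + b - 1) / 4 by linarith)).ne'
  have g6 := (Real.Gamma_pos_of_pos (show 0 < (n : ℝ) / 2 by linarith)).ne'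
  have g7 : 1 - α ≠ 0 := by linarith
  field_simp

lemma K_pos (hα : α ∈ Ioo (-1 : ℝ) 1) (hb : 2 - α ≤ b) (hbn : b < n + 1) : 0 < K n α b := by
  have hA := fst_param_pos hb hbn
  have hB : 0 < (n + 1 - b) / 4 := by linarith
  have hn : (1 : ℝ) ≤ n := by exact_mod_cast one_le_dim hα hb hbn
  obtain ⟨h1, h2⟩ := hα
  unfold K
  have g1 := (Real.Gamma_pos_of_pos hA)
  have g2 := (Real.Gamma_pos_of_pos hB)
  have g3 := (Real.Gamma_pos_of_pos (show 0 < (3 - α) / 2 by linarith))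
  have g4 := (Real.Gamma_pos_of_pos (show 0 < (n - 2 * α - b + 3) / 4 by linarith))
  have g5 := (Real.Gamma_pos_of_pos (show 0 < (n + b - 1) / 4 by linarith))
  have g6 := (Real.Gamma_pos_of_pos (show 0 < (α + 1) / 2 by linarith))
  have g7 : 0 < 1 - α := by linarith
  positivity

/-- The eigenvalue `((n+α-1)² - (α+b-2)²)/4` in the angular equation. -/
def angEigen (n : ℕ) (α b : ℝ) : ℝ := ((n + α - 1) ^ 2 - (α + b - 2) ^ 2) / 4

lemma angEigen_eq : angEigen n α b = 4 * ((n + 2 * α + b - 3) / 4) * ((n + 1 - b) / 4) := by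
  unfold angEigen; ring

lemma angEigen_pos (hb : 2 - α ≤ b) (hbn : b < n + 1) : 0 < angEigen n α b := by
  have hA := fst_param_pos hb hbn
  have hB : 0 < (n + 1 - b) / 4 := by linarith
  rw [angEigen_eq]; positivity

lemma angular_ineq (hα : α ∈ Ioo (-1 : ℝ) 1) (hb : 2 - α ≤ b) (hbn : b < n + 1)
    {g g' : ℝ → ℝ} (hg : ∀ θ, HasDerivAt g (g' θ) θ) (hg' : Continuous g') :
    ENNReal.ofReal (K n α b * g 0 ^ 2) ≤ ∫⁻ θ in Ioo 0 (Real.pi / 2),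
      ENNReal.ofReal (angWeight n α θ * (g' θ ^ 2 + angEigen n α b * g θ ^ 2)) := by
  rw [K_eq hα hb hbn, angEigen_eq]
  obtain ⟨h1, h2⟩ := hα
  exact angConst_mul_sq_le (one_le_dim ⟨h1, h2⟩ hb hbn) (fst_param_pos hb hbn) (by linarith) rfl rfl
    (by linarith) (by linarith) (by ring) hg hg'

lemma angular_sharp (hα : α ∈ Ioo (-1 : ℝ) 1) (hb : 2 - α ≤ b) (hbn : b < n + 1)
    {ε : ℝ} (hε : 0 < ε) :
    ∃ q : Polynomial ℝ, (∀ s, 0 ≤ s → 1 ≤ q.eval s) ∧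
      ∫⁻ θ in Ioo 0 (Real.pi / 2), ENNReal.ofReal (angWeight n α θ *
        ((2 * Real.cos θ * Real.sin θ * q.derivative.eval (Real.cos θ ^ 2)) ^ 2 +
          angEigen n α b * q.eval (Real.cos θ ^ 2) ^ 2)) ≤
        ENNReal.ofReal (K n α b * q.eval 1 ^ 2 + ε) := by
  rw [K_eq hα hb hbn, angEigen_eq]
  obtain ⟨h1, h2⟩ := hα
  exact exists_polynomial_angular (one_le_dim ⟨h1, h2⟩ hb hbn) (fst_param_pos hb hbn)
    (by linarith) rfl rfl (by linarith) (by linarith) (by ring) hε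

end Constant

/-! ### The iterated logarithms -/

lemma X_mem {ρ : ℝ} (h0 : 0 < ρ) (h1 : ρ ≤ 1) (k : ℕ) : 0 < X k ρ ∧ X k ρ ≤ 1 := by
  induction k with
  | zero => exact ⟨h0, h1⟩
  | succ k ih =>
    have hl := Real.log_nonpos ih.1.le ih.2
    have : 1 ≤ 1 - Real.log (X k ρ) := by linarith
    simp only [X]
    exact ⟨by positivity, (div_le_one (by linarith)).2 this⟩

lemma X_mono {ρ σ : ℝ} (h0 : 0 < ρ) (h : ρ ≤ σ) (h1 : σ ≤ 1) (k : ℕ) : X k ρ ≤ X k σ := by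
  induction k with
  | zero => exact h
  | succ k ih =>
    have hσ := X_mem (h0.trans_le h) h1 k
    have hρ := X_mem h0 (h.trans h1) k
    have hl := Real.log_nonpos hσ.1.le hσ.2
    have hll := Real.log_le_log hρ.1 ih
    simp only [X]
    exact one_div_le_one_div_of_le (by linarith) (by linarith)

lemma tendsto_X (k : ℕ) : Tendsto (X k) (𝓝[>] 0) (𝓝[>] 0) := by
  induction k with
  | zero => exact tendsto_id
  | succ k ih =>
    have h1 : Tendsto (fun ρ => 1 - Real.log (X k ρ)) (𝓝[>] 0) atTop := by
      refine tendsto_atTop_add_const_left _ 1 (tendsto_neg_atBot_atTop.comp ?_)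
      exact Real.tendsto_log_nhdsGT_zero.comp ih
    simpa [X, one_div] using! tendsto_inv_atTop_nhdsGT_zero.comp h1

lemma P_succ (k : ℕ) (ρ : ℝ) : P (k + 1) ρ = P k ρ * X (k + 1) ρ := by
  simp [P, Finset.prod_Icc_succ_top]

lemma P_mem {ρ : ℝ} (h0 : 0 < ρ) (h1 : ρ ≤ 1) (k : ℕ) : 0 < P k ρ ∧ P k ρ ≤ 1 :=
  ⟨Finset.prod_pos fun i _ => (X_mem h0 h1 i).1,
    Finset.prod_le_one (fun i _ => (X_mem h0 h1 i).1.le) fun i _ => (X_mem h0 h1 i).2⟩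

/-- The sum `P₁ + ⋯ + P_m`. -/
def sumP (m : ℕ) (ρ : ℝ) : ℝ := ∑ i ∈ Finset.Icc 1 m, P i ρ

/-- The sum `P₁² + ⋯ + P_m²`. -/
def sumSqP (m : ℕ) (ρ : ℝ) : ℝ := ∑ i ∈ Finset.Icc 1 m, P i ρ ^ 2

lemma sumP_succ (m : ℕ) (ρ : ℝ) : sumP (m + 1) ρ = sumP m ρ + P (m + 1) ρ := by
  simp [sumP, Finset.sum_Icc_succ_top]

lemma sumSqP_succ (m : ℕ) (ρ : ℝ) : sumSqP (m + 1) ρ = sumSqP m ρ + P (m + 1) ρ ^ 2 := by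
  simp [sumSqP, Finset.sum_Icc_succ_top]

lemma sumSqP_nonneg (m : ℕ) (ρ : ℝ) : 0 ≤ sumSqP m ρ := Finset.sum_nonneg fun _ _ => sq_nonneg _

lemma sumP_nonneg {ρ : ℝ} (h0 : 0 < ρ) (h1 : ρ ≤ 1) (m : ℕ) : 0 ≤ sumP m ρ :=
  Finset.sum_nonneg fun i _ => (P_mem h0 h1 i).1.le

/-- ρ X_k' = X_k P_k by induction: differentiating X_{k+1} = 1/(1 - log X_k) gives X_{k+1}² X_k'/X_k
= X_{k+1}² P_k/ρ, and X_{k+1} P_k = P_{k+1}. The convention X_0(ρ) = ρ makes k = 0 a valid start. -/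
lemma hasDerivAt_X {ρ : ℝ} (h0 : 0 < ρ) (h1 : ρ ≤ 1) (k : ℕ) :
    HasDerivAt (X k) (X k ρ * P k ρ / ρ) ρ := by
  induction k with
  | zero =>
    refine (hasDerivAt_id ρ).congr_deriv ?_
    simp [X, P, h0.ne']
  | succ k ih =>
    have hX := X_mem h0 h1 k
    have hl := Real.log_nonpos hX.1.le hX.2
    have hne : 1 - Real.log (X k ρ) ≠ 0 := by linarith
    refine ((((ih.log hX.1.ne').const_sub 1).fun_inv hne).congr_of_eventuallyEq
      (.of_forall fun x => by simp [X])).congr_deriv ?_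
    rw [P_succ]
    simp only [X]
    have := hX.1.ne'
    field_simp

lemma hasDerivAt_P {ρ : ℝ} (h0 : 0 < ρ) (h1 : ρ ≤ 1) (k : ℕ) :
    HasDerivAt (P k) (P k ρ * sumP k ρ / ρ) ρ := by
  induction k with
  | zero =>
    have : P 0 = fun _ => (1 : ℝ) := by ext; simp [P]
    rw [this]
    exact (hasDerivAt_const ρ (1 : ℝ)).congr_deriv (by simp [sumP])
  | succ k ih =>
    have e : P (k + 1) = fun ρ => P k ρ * X (k + 1) ρ := funext fun ρ => P_succ k ρ
    rw [e]
    refine (ih.mul (hasDerivAt_X h0 h1 (k + 1))).congr_deriv ?_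
    rw [sumP_succ, P_succ]
    ring

/-- The derivative is the sum of P_i P_j/ρ over 1 ≤ j ≤ i ≤ m; symmetrising, this is half of the
full square plus half of the diagonal. The diagonal is where the remainder terms P_i² come from. -/
lemma hasDerivAt_sumP {ρ : ℝ} (h0 : 0 < ρ) (h1 : ρ ≤ 1) (m : ℕ) :
    HasDerivAt (sumP m) ((sumP m ρ ^ 2 + sumSqP m ρ) / (2 * ρ)) ρ := by
  induction m with
  | zero =>
    have : sumP 0 = fun _ => (0 : ℝ) := by ext; simp [sumP]
    rw [this]
    exact (hasDerivAt_const ρ (0 : ℝ)).congr_deriv (by simp [sumSqP])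
  | succ k ih =>
    have e : sumP (k + 1) = fun ρ => sumP k ρ + P (k + 1) ρ := funext fun ρ => sumP_succ k ρ
    rw [e]
    refine (ih.add (hasDerivAt_P h0 h1 (k + 1))).congr_deriv ?_
    rw [sumP_succ, sumSqP_succ]
    field_simp
    ring

@[fun_prop]
lemma measurable_X (k : ℕ) : Measurable (X k) := by
  induction k with
  | zero => exact measurable_id
  | succ k ih =>
    have : X (k + 1) = fun ρ => 1 / (1 - Real.log (X k ρ)) := rfl
    rw [this]; fun_prop

@[fun_prop]
lemma measurable_P (k : ℕ) : Measurable (P k) := by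
  have : P k = fun ρ => ∏ i ∈ Finset.Icc 1 k, X i ρ := rfl
  rw [this]; fun_prop

@[fun_prop]
lemma measurable_sumSqP (k : ℕ) : Measurable (sumSqP k) := by
  have : sumSqP k = fun ρ => ∑ i ∈ Finset.Icc 1 k, P i ρ ^ 2 := rfl
  rw [this]; fun_prop

lemma contDiffAt_X {ρ : ℝ} (h0 : 0 < ρ) (h1 : ρ ≤ 1) (k : ℕ) : ContDiffAt ℝ ∞ (X k) ρ := by
  induction k with
  | zero => exact contDiffAt_id
  | succ k ih =>
    have hX := X_mem h0 h1 k
    have hl := Real.log_nonpos hX.1.le hX.2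
    have e : X (k + 1) = fun ρ => 1 / (1 - Real.log (X k ρ)) := rfl
    rw [e]
    exact contDiffAt_const.div (contDiffAt_const.sub (ih.log hX.1.ne')) (by linarith)

lemma contDiffAt_P {ρ : ℝ} (h0 : 0 < ρ) (h1 : ρ ≤ 1) (k : ℕ) : ContDiffAt ℝ ∞ (P k) ρ := by
  have : P k = fun ρ => ∏ i ∈ Finset.Icc 1 k, X i ρ := rfl
  rw [this]
  exact contDiffAt_prod fun i _ => contDiffAt_X h0 h1 i

/-! ### The radial inequality -/

/-- The radial flux `ρ^{2a}(a + S_m/2)`. -/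
def radFlux (a D : ℝ) (m : ℕ) (ρ : ℝ) : ℝ := ρ ^ (2 * a) * (a + sumP m (ρ / D) / 2)

/-- The radial Riccati equation: the second summand is Q²/ρ^(2a+1) for Q = `radFlux a D m`. -/
lemma hasDerivAt_radFlux {a D ρ : ℝ} (hD : 0 < D) (h0 : 0 < ρ) (h1 : ρ ≤ D) (m : ℕ) :
    HasDerivAt (radFlux a D m)
      (ρ ^ (2 * a - 1) * (a ^ 2 + sumSqP m (ρ / D) / 4) +
        ρ ^ (2 * a + 1) * ((a + sumP m (ρ / D) / 2) / ρ) ^ 2) ρ := by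
  have d1 := (hasDerivAt_id ρ).rpow_const (p := 2 * a) (Or.inl h0.ne')
  have d2 := (hasDerivAt_sumP (div_pos h0 hD) ((div_le_one hD).2 h1) m).comp ρ
    ((hasDerivAt_id ρ).div_const D)
  refine (d1.mul ((d2.div_const 2).const_add a)).congr_deriv ?_
  have e1 : ρ ^ (2 * a) = ρ ^ (2 * a - 1) * ρ := by
    rw [← Real.rpow_add_one h0.ne']; ring_nf
  have e2 : ρ ^ (2 * a + 1) = ρ ^ (2 * a - 1) * ρ ^ 2 := by
    rw [Real.rpow_add_one h0.ne', e1]; ring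
  simp only [id, Function.comp]
  rw [e2, e1]
  field_simp
  ring

/-- Completing the square in the radial energy. -/
lemma radial_square {a D ρ u u' : ℝ} (h0 : 0 < ρ) (m : ℕ) :
    ρ ^ (2 * a + 1) * u' ^ 2 =
      ρ ^ (2 * a + 1) * (u' + (a + sumP m (ρ / D) / 2) / ρ * u) ^ 2 -
        ((ρ ^ (2 * a - 1) * (a ^ 2 + sumSqP m (ρ / D) / 4) +
          ρ ^ (2 * a + 1) * ((a + sumP m (ρ / D) / 2) / ρ) ^ 2) * u ^ 2 +
            radFlux a D m ρ * (2 * u * u')) +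
        ρ ^ (2 * a - 1) * (a ^ 2 + sumSqP m (ρ / D) / 4) * u ^ 2 := by
  have e1 : ρ ^ (2 * a + 1) = ρ ^ (2 * a) * ρ := Real.rpow_add_one h0.ne' _
  rw [radFlux, e1]
  field_simp
  ring

/-- Dropping the completed square leaves the derivative of Q w², with Q = `radFlux a D m`. On [p, D]
the boundary term vanishes at D, and at p it is -Q(p) w(p)² ≤ 0. It can thus be discarded for every
p > 0, whatever the behaviour at the origin. -/
lemma radial_ineq {a D : ℝ} (ha : 0 < a) (hD : 0 < D) (m : ℕ) {w w' : ℝ → ℝ}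
    (hw : ∀ ρ, HasDerivAt w (w' ρ) ρ) (hw' : Continuous w') (hwD : ∀ ρ, D ≤ ρ → w ρ = 0) :
    ∫⁻ ρ in Ioi (0 : ℝ), ENNReal.ofReal
      (ρ ^ (2 * a - 1) * (a ^ 2 + sumSqP m (ρ / D) / 4) * w ρ ^ 2) ≤
    ∫⁻ ρ in Ioi (0 : ℝ), ENNReal.ofReal (ρ ^ (2 * a + 1) * w' ρ ^ 2) := by
  have hwc : Continuous w := continuous_iff_continuousAt.2 fun θ => (hw θ).continuousAt
  set φ : ℝ → ℝ := fun ρ => ρ ^ (2 * a - 1) * (a ^ 2 + sumSqP m (ρ / D) / 4) * w ρ ^ 2 with hφ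
  set χ : ℝ → ℝ := fun ρ => ρ ^ (2 * a + 1) * w' ρ ^ 2 with hχ
  have hsplit : ∫⁻ ρ in Ioi (0 : ℝ), ENNReal.ofReal (φ ρ) =
      ∫⁻ ρ in Ioo 0 D, ENNReal.ofReal (φ ρ) := by
    have e : Ioi (0 : ℝ) = Ioo 0 D ∪ Ici D := (Ioo_union_Ici_eq_Ioi hD).symm
    rw [e, lintegral_union measurableSet_Ici (by
      rw [Set.disjoint_left]; intro x hx hx'; exact absurd hx.2 (not_lt.2 hx')),
      setLIntegral_eq_zero (s := Ici D) measurableSet_Ici (fun x hx => by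
        simp [hφ, hwD x hx]), add_zero]
  rw [hsplit]
  refine lintegral_Ioo_le_of_forall hD (by fun_prop) fun p b hp hpb hb => ?_
  have hpD : p ≤ D := hpb.trans hb.le
  have hpos : ∀ x ∈ Icc p D, 0 < x := fun x hx => hp.trans_le hx.1
  have hcS : ∀ x ∈ Icc p D, ContinuousAt (fun ρ => sumSqP m (ρ / D)) x := by
    intro x hx
    have h1 : 0 < x / D := div_pos (hpos x hx) hD
    have h2 : x / D ≤ 1 := (div_le_one hD).2 hx.2
    have : ContinuousAt (sumSqP m) (x / D) := by
      have e : sumSqP m = fun ρ => ∑ i ∈ Finset.Icc 1 m, P i ρ ^ 2 := rfl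
      rw [e]
      exact tendsto_finsetSum _ fun i _ => ((hasDerivAt_P h1 h2 i).continuousAt.pow 2)
    exact ContinuousAt.comp (f := fun ρ => ρ / D) this (by fun_prop)
  have hφc : ContinuousOn φ (Icc p D) := fun x hx =>
    ((((continuousAt_id.rpow_const (Or.inl (hpos x hx).ne')).mul
      (continuousAt_const.add ((hcS x hx).div_const 4))).mul
      (by fun_prop : ContinuousAt (fun ρ => w ρ ^ 2) x))).continuousWithinAt
  have hχc : ContinuousOn χ (Icc p D) := fun x hx =>
    ((continuousAt_id.rpow_const (Or.inl (hpos x hx).ne')).mul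
      (by fun_prop : ContinuousAt (fun ρ => w' ρ ^ 2) x)).continuousWithinAt
  have hφi := hφc.integrableOn_compact isCompact_Icc (μ := volume)
  have hχi := hχc.integrableOn_compact isCompact_Icc (μ := volume)
  have hd : ∀ x ∈ Icc p D, HasDerivAt (fun ρ => radFlux a D m ρ * w ρ ^ 2)
      ((x ^ (2 * a - 1) * (a ^ 2 + sumSqP m (x / D) / 4) +
          x ^ (2 * a + 1) * ((a + sumP m (x / D) / 2) / x) ^ 2) * w x ^ 2 +
            radFlux a D m x * (2 * w x * w' x)) x := by
    intro x hx
    refine ((hasDerivAt_radFlux hD (hpos x hx) hx.2 m).mul ((hw x).pow 2)).congr_deriv ?_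
    simp
  have key := intervalIntegral.integral_le_sub_of_hasDeriv_right_of_le hpD
    (fun x hx => (hd x hx).continuousAt.continuousWithinAt)
    (fun x hx => (hd x (Ioo_subset_Icc_self hx)).hasDerivWithinAt) (hφi.sub hχi) (by
      intro x hx
      have hx0 := hpos x (Ioo_subset_Icc_self hx)
      have := radial_square (a := a) (D := D) (u := w x) (u' := w' x) hx0 m
      have h2 : 0 ≤ x ^ (2 * a + 1) * (w' x + (a + sumP m (x / D) / 2) / x * w x) ^ 2 := by
        positivity
      simp only [Pi.sub_apply, hφ, hχ]
      linarith)
  rw [hwD D le_rfl] at key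
  have hflux : 0 ≤ radFlux a D m p * w p ^ 2 := by
    have := sumP_nonneg (div_pos hp hD) ((div_le_one hD).2 hpD) m
    unfold radFlux; positivity
  rw [intervalIntegral.integral_of_le hpD, ← integral_Icc_eq_integral_Ioc] at key
  simp only [Pi.sub_apply] at key
  rw [integral_sub hφi hχi] at key
  have hφ0 : 0 ≤ᵐ[volume.restrict (Icc p D)] φ :=
    ae_restrict_of_forall_mem measurableSet_Icc fun x hx => by
      have := hpos x hx
      have := sumSqP_nonneg m (x / D)
      simp only [Pi.zero_apply, hφ]; positivity
  have hχ0 : 0 ≤ᵐ[volume.restrict (Icc p D)] χ :=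
    ae_restrict_of_forall_mem measurableSet_Icc fun x hx => by
      have := hpos x hx
      simp only [Pi.zero_apply, hχ]; positivity
  calc ∫⁻ x in Icc p b, ENNReal.ofReal (φ x) ≤ ∫⁻ x in Icc p D, ENNReal.ofReal (φ x) :=
        lintegral_mono_set (Icc_subset_Icc_right hb.le)
    _ = ENNReal.ofReal (∫ x in Icc p D, φ x) :=
        (ofReal_integral_eq_lintegral_ofReal hφi hφ0).symm
    _ ≤ ENNReal.ofReal (∫ x in Icc p D, χ x) := by
        refine ENNReal.ofReal_le_ofReal ?_
        simp only [zero_pow two_ne_zero, mul_zero, zero_sub] at key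
        linarith
    _ = ∫⁻ x in Icc p D, ENNReal.ofReal (χ x) := ofReal_integral_eq_lintegral_ofReal hχi hχ0
    _ ≤ _ := lintegral_mono_set fun x hx => hpos x hx

/-! ### Sharpness of the radial inequality -/

/-- In the variable τ = -log X_k(ρ/D) the measure P_k dρ/ρ becomes Lebesgue measure up to
orientation. This is the scale on which the ground state is cut off. -/
lemma hasDerivAt_log_X {D ρ : ℝ} (hD : 0 < D) (h0 : 0 < ρ) (h1 : ρ ≤ D) (k : ℕ) :
    HasDerivAt (fun ρ => -Real.log (X k (ρ / D))) (-(P k (ρ / D) / ρ)) ρ := by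
  have hy0 : 0 < ρ / D := div_pos h0 hD
  have hy1 : ρ / D ≤ 1 := (div_le_one hD).2 h1
  have hX := (X_mem hy0 hy1 k).1
  have d := ((hasDerivAt_X hy0 hy1 k).comp ρ ((hasDerivAt_id ρ).div_const D)).log hX.ne'
  refine d.neg.congr_deriv ?_
  simp only [Function.comp, id]
  field_simp

/-- The radial ground state `ρ^{-a} P_k^{-1/2}`. -/
def radGround (a D : ℝ) (k : ℕ) (ρ : ℝ) : ℝ := ρ ^ (-a) * P k (ρ / D) ^ (-(1 / 2) : ℝ)

/-- Up to a constant factor, the ground state is the solution of the first-order equation that makes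
the square in `radial_square` vanish, for m = k. -/
lemma hasDerivAt_radGround {a D ρ : ℝ} (hD : 0 < D) (h0 : 0 < ρ) (h1 : ρ ≤ D) (k : ℕ) :
    HasDerivAt (radGround a D k)
      (-((a + sumP k (ρ / D) / 2) / ρ * radGround a D k ρ)) ρ := by
  have hy0 : 0 < ρ / D := div_pos h0 hD
  have hy1 : ρ / D ≤ 1 := (div_le_one hD).2 h1
  have hP := (P_mem hy0 hy1 k).1
  have d1 := (hasDerivAt_id ρ).rpow_const (p := -a) (Or.inl h0.ne')
  have d2 := ((hasDerivAt_P hy0 hy1 k).comp ρ ((hasDerivAt_id ρ).div_const D)).rpow_const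
    (p := -(1 / 2)) (Or.inl hP.ne')
  refine (d1.mul d2).congr_deriv ?_
  simp only [id, Function.comp]
  unfold radGround
  rw [Real.rpow_sub_one h0.ne', Real.rpow_sub_one hP.ne']
  field_simp
  ring

lemma radGround_sq {a D ρ : ℝ} (hD : 0 < D) (h0 : 0 < ρ) (h1 : ρ ≤ D) (k : ℕ) :
    ρ ^ (2 * a) * radGround a D k ρ ^ 2 = (P k (ρ / D))⁻¹ := by
  have hP := (P_mem (div_pos h0 hD) ((div_le_one hD).2 h1) k).1
  unfold radGround
  rw [mul_pow, ← Real.rpow_mul_natCast h0.le, ← Real.rpow_mul_natCast hP.le, ← mul_assoc,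
    ← Real.rpow_add h0]
  norm_num
  rw [show 2 * a + -(a * 2) = 0 by ring, Real.rpow_zero, one_mul, Real.rpow_neg_one]

lemma exists_unit_bump : ∃ β : ℝ → ℝ, ContDiff ℝ ∞ β ∧ (∀ t, 0 ≤ β t) ∧
    (∀ t, t ∉ Ioo (1 / 4 : ℝ) (3 / 4) → β t = 0) ∧ 0 < ∫ t in (0 : ℝ)..1, β t ^ 2 := by
  let b : ContDiffBump (1 / 2 : ℝ) := ⟨1 / 8, 1 / 4, by norm_num, by norm_num⟩
  have hb : ContDiff ℝ ∞ b := b.contDiff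
  refine ⟨b, hb, fun t => b.nonneg, fun t ht => ?_, ?_⟩
  · refine b.zero_of_le_dist (le_of_not_gt fun hlt => ht ?_)
    change dist t (1 / 2) < 1 / 4 at hlt
    rw [Real.dist_eq, abs_lt] at hlt
    constructor <;> linarith [hlt.1, hlt.2]
  · refine intervalIntegral.integral_pos zero_lt_one (hb.continuous.pow 2).continuousOn
      (fun x _ => sq_nonneg _) ⟨1 / 2, by norm_num, ?_⟩
    have : b (1 / 2) = 1 := b.one_of_mem_closedBall (Metric.mem_closedBall_self (by norm_num))
    rw [this]; norm_num

/-- Functions supported near the origin that nearly saturate the `k`-th radial inequality. -/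
lemma radial_sharp {a D : ℝ} (hD : 0 < D) (k : ℕ) {ε δ : ℝ} (hε : 0 < ε)
    (hδ : 0 < δ) (hδD : δ ≤ D) :
    ∃ w : ℝ → ℝ, ∃ ρ₁ : ℝ, 0 < ρ₁ ∧ ContDiff ℝ 1 w ∧ (∀ ρ, ρ ∉ Ioo ρ₁ δ → w ρ = 0 ∧ deriv w ρ = 0) ∧
      0 < ∫ ρ in Ioi (0 : ℝ), ρ ^ (2 * a - 1) * P k (ρ / D) ^ 2 * w ρ ^ 2 ∧
      ∫ ρ in Ioi (0 : ℝ), ρ ^ (2 * a + 1) * deriv w ρ ^ 2 ≤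
        (∫ ρ in Ioi (0 : ℝ), ρ ^ (2 * a - 1) * (a ^ 2 + sumSqP k (ρ / D) / 4) * w ρ ^ 2) +
        ε * ∫ ρ in Ioi (0 : ℝ), ρ ^ (2 * a - 1) * P k (ρ / D) ^ 2 * w ρ ^ 2 := by
  obtain ⟨β, hβs, hβ0, hβsupp, hβpos⟩ := exists_unit_bump
  set B0 := ∫ t in (0 : ℝ)..1, β t ^ 2 with hB0
  set B1 := ∫ t in (0 : ℝ)..1, deriv β t ^ 2 with hB1
  have hB1n : 0 ≤ B1 := intervalIntegral.integral_nonneg zero_le_one fun _ _ => sq_nonneg _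
  have hβ1 : ContDiff ℝ 1 β := hβs.of_le (by exact_mod_cast le_top)
  have hβc : Continuous β := hβs.continuous
  have hβd : ∀ t, HasDerivAt β (deriv β t) t := fun t =>
    (hβ1.differentiable one_ne_zero t).hasDerivAt
  have hβdc : Continuous (deriv β) := hβ1.continuous_deriv le_rfl
  set τ : ℝ → ℝ := fun ρ => -Real.log (X k (ρ / D)) with hτ
  set ρ₂ := δ / 2 with hρ₂
  have hρ₂0 : 0 < ρ₂ := by positivity
  -- The cut-off lives on a τ-interval of length ℓ. The integral of the square will be B1/ℓ and the
  -- remainder integral ℓ B0, so ℓ > 1 and ℓ > B1/(ε B0) suffice; such lengths exist because τ tends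
  -- to infinity at 0.
  obtain ⟨ρ₁, ⟨hρ₁0, hρ₁₂⟩, hρ₁⟩ : ∃ ρ₁ ∈ Ioo 0 ρ₂, τ ρ₂ + (1 + B1 / (ε * B0)) < τ ρ₁ := by
    have hdiv : Tendsto (fun ρ : ℝ => ρ / D) (𝓝[>] 0) (𝓝[>] 0) := by
      refine tendsto_nhdsWithin_iff.2 ⟨?_, ?_⟩
      · have : ContinuousAt (fun ρ : ℝ => ρ / D) 0 := by fun_prop
        simpa using this.tendsto.mono_left nhdsWithin_le_nhds
      · filter_upwards [self_mem_nhdsWithin] with ρ hρ using div_pos hρ hD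
    have ht : Tendsto τ (𝓝[>] 0) atTop :=
      tendsto_neg_atBot_atTop.comp (Real.tendsto_log_nhdsGT_zero.comp ((tendsto_X k).comp hdiv))
    obtain ⟨x, hx1, hx2⟩ := ((ht.eventually_gt_atTop (τ ρ₂ + (1 + B1 / (ε * B0)))).and
      (Ioo_mem_nhdsGT hρ₂0)).exists
    exact ⟨x, hx2, hx1⟩
  set ℓ := τ ρ₁ - τ ρ₂ with hℓ
  have hℓ1 : 1 + B1 / (ε * B0) < ℓ := by linarith
  have hB1q : 0 ≤ B1 / (ε * B0) := by positivity
  have hℓ0 : 0 < ℓ := by linarith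
  have hIcc : ∀ ρ ∈ Icc ρ₁ ρ₂, 0 < ρ ∧ ρ ≤ D := fun ρ hρ =>
    ⟨hρ₁0.trans_le hρ.1, by linarith [hρ.2]⟩
  have hτmono : ∀ x y, 0 < x → x ≤ y → y ≤ D → τ y ≤ τ x := by
    intro x y hx hxy hy
    have hx' : 0 < x / D := div_pos hx hD
    have hxy' : x / D ≤ y / D := by gcongr
    have hy' : y / D ≤ 1 := (div_le_one hD).2 hy
    exact neg_le_neg (Real.log_le_log (X_mem hx' (hxy'.trans hy') k).1 (X_mono hx' hxy' hy' k))
  set T : ℝ → ℝ := fun ρ => (τ ρ - τ ρ₂) / ℓ with hT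
  have hTd : ∀ ρ, 0 < ρ → ρ ≤ D → HasDerivAt T (-(P k (ρ / D) / ρ) / ℓ) ρ := fun ρ h0 h1 =>
    ((hasDerivAt_log_X hD h0 h1 k).sub_const _).div_const ℓ
  have hT1 : T ρ₁ = 1 := div_self hℓ0.ne'
  have hT2 : T ρ₂ = 0 := by simp [hT]
  set ψ := radGround a D k with hψ
  -- Ground state times a bump in the affine parameter T, which runs from 1 at ρ₁ to 0 at ρ₂. The
  -- case distinction only discards points where the logarithms are not controlled.
  set w : ℝ → ℝ := fun ρ => if ρ ∈ Ioo 0 δ then ψ ρ * β (T ρ) else 0 with hw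
  have hw0 : ∀ ρ, ρ ∉ Ioo ρ₁ ρ₂ → w ρ = 0 := by
    intro ρ hρ
    simp only [hw]
    split_ifs with h
    · rw [hβsupp, mul_zero]
      rintro ⟨h1, h2⟩
      apply hρ
      constructor
      · by_contra hle
        have h3 := hτmono ρ ρ₁ h.1 (not_lt.1 hle) (by linarith)
        have : 1 ≤ T ρ := by rw [hT, le_div_iff₀ hℓ0]; simp only [hℓ]; linarith
        linarith
      · by_contra hle
        have h3 := hτmono ρ₂ ρ hρ₂0 (not_lt.1 hle) (h.2.le.trans hδD)
        have : T ρ ≤ 0 := div_nonpos_of_nonpos_of_nonneg (by linarith) hℓ0.le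
        linarith
    · rfl
  have hwnn : ∀ ρ, 0 ≤ w ρ := by
    intro ρ
    simp only [hw]
    split_ifs with h
    · refine mul_nonneg (mul_nonneg (Real.rpow_nonneg h.1.le _) (Real.rpow_nonneg ?_ _)) (hβ0 _)
      exact (P_mem (div_pos h.1 hD) ((div_le_one hD).2 (h.2.le.trans hδD)) k).1.le
    · exact le_rfl
  have hwd0 : ∀ ρ, ρ ∉ Ioo ρ₁ ρ₂ → deriv w ρ = 0 := by
    intro ρ hρ
    -- Since w ≥ 0, each of its zeros is a minimum.
    refine IsLocalMin.deriv_eq_zero (Filter.Eventually.of_forall fun x => ?_)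
    rw [hw0 ρ hρ]; exact hwnn x
  have hweq : ∀ ρ ∈ Ioo 0 δ, w =ᶠ[𝓝 ρ] fun ρ => ψ ρ * β (T ρ) := by
    intro ρ hρ
    filter_upwards [Ioo_mem_nhds hρ.1 hρ.2] with x hx
    simp only [hw, if_pos hx]
  have hwC : ContDiff ℝ 1 w := by
    refine contDiff_iff_contDiffAt.2 fun ρ => ?_
    have hzero : ∀ s ∈ 𝓝 ρ, (∀ x ∈ s, x ∉ Ioo ρ₁ ρ₂) → ContDiffAt ℝ 1 w ρ := by
      intro s hs hs'
      refine (contDiffAt_const (c := (0 : ℝ))).congr_of_eventuallyEq ?_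
      filter_upwards [hs] with x hx using hw0 x (hs' x hx)
    rcases lt_or_ge ρ ρ₁ with h | h
    · exact hzero _ (Iio_mem_nhds h) fun x hx hx' => lt_asymm hx hx'.1
    rcases lt_or_ge ρ₂ ρ with h' | h'
    · exact hzero _ (Ioi_mem_nhds h') fun x hx hx' => lt_asymm hx hx'.2
    · have hρ0 : 0 < ρ := hρ₁0.trans_le h
      have hρδ : ρ < δ := by linarith
      have hy0 : 0 < ρ / D := div_pos hρ0 hD
      have hy1 : ρ / D ≤ 1 := (div_le_one hD).2 (hρδ.le.trans hδD)
      refine ContDiffAt.congr_of_eventuallyEq ?_ (hweq ρ ⟨hρ0, hρδ⟩)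
      have hdiv : ContDiffAt ℝ 1 (fun ρ : ℝ => ρ / D) ρ := by fun_prop
      have cP : ContDiffAt ℝ 1 (fun ρ => P k (ρ / D)) ρ :=
        ContDiffAt.comp (g := P k) ρ ((contDiffAt_P hy0 hy1 k).of_le (by exact_mod_cast le_top)) hdiv
      have cX : ContDiffAt ℝ 1 (fun ρ => X k (ρ / D)) ρ :=
        ContDiffAt.comp (g := X k) ρ ((contDiffAt_X hy0 hy1 k).of_le (by exact_mod_cast le_top)) hdiv
      have cτ : ContDiffAt ℝ 1 T ρ :=
        ((cX.log (X_mem hy0 hy1 k).1.ne').neg.sub contDiffAt_const).div_const _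
      exact ((contDiffAt_id.rpow_const_of_ne hρ0.ne').mul
        (cP.rpow_const_of_ne (P_mem hy0 hy1 k).1.ne')).mul (hβ1.contDiffAt.comp ρ cτ)
  have hwd : ∀ ρ, HasDerivAt w (deriv w ρ) ρ := fun ρ =>
    (hwC.differentiable one_ne_zero ρ).hasDerivAt
  have hwdc : Continuous (deriv w) := hwC.continuous_deriv le_rfl
  have hwc : Continuous w := hwC.continuous
  have hval : ∀ ρ ∈ Icc ρ₁ ρ₂, w ρ = ψ ρ * β (T ρ) := fun ρ hρ =>
    (hweq ρ ⟨(hIcc ρ hρ).1, by linarith [hρ.2]⟩).eq_of_nhds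
  have hdval : ∀ ρ ∈ Icc ρ₁ ρ₂, deriv w ρ + (a + sumP k (ρ / D) / 2) / ρ * w ρ =
      ψ ρ * (deriv β (T ρ) * (-(P k (ρ / D) / ρ) / ℓ)) := by
    intro ρ hρ
    obtain ⟨h0, h1⟩ := hIcc ρ hρ
    have hd : HasDerivAt w _ ρ := ((hasDerivAt_radGround (a := a) hD h0 h1 k).mul
      ((hβd (T ρ)).comp ρ (hTd ρ h0 h1))).congr_of_eventuallyEq
        (hweq ρ ⟨h0, by linarith [hρ.2]⟩)
    rw [hd.deriv, hval ρ hρ]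
    simp only [Function.comp]
    ring
  -- reduction of the three integrals to the interval `[ρ₁, ρ₂]`
  have hred : ∀ f : ℝ → ℝ, (∀ ρ, ρ ∉ Ioo ρ₁ ρ₂ → f ρ = 0) →
      ∫ ρ in Ioi (0 : ℝ), f ρ = ∫ ρ in ρ₁..ρ₂, f ρ := by
    intro f hf
    rw [intervalIntegral.integral_of_le hρ₁₂.le]
    refine setIntegral_eq_of_subset_of_forall_sdiff_eq_zero measurableSet_Ioi
      (fun x hx => hρ₁0.trans hx.1) fun x hx => hf x fun h => hx.2 ⟨h.1, h.2.le⟩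
  have huIcc : uIcc ρ₁ ρ₂ = Icc ρ₁ ρ₂ := uIcc_of_le hρ₁₂.le
  have hcP : ContinuousOn (fun ρ => P k (ρ / D)) (Icc ρ₁ ρ₂) := fun ρ hρ => by
    obtain ⟨h0, h1⟩ := hIcc ρ hρ
    have := (hasDerivAt_P (div_pos h0 hD) ((div_le_one hD).2 h1) k).continuousAt
    exact (ContinuousAt.comp (f := fun ρ => ρ / D) this (by fun_prop)).continuousWithinAt
  have hcT' : ContinuousOn (fun ρ => -(P k (ρ / D) / ρ) / ℓ) (Icc ρ₁ ρ₂) :=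
    ((hcP.div continuousOn_id fun x hx => (hIcc x hx).1.ne').neg).div_const ℓ
  have hcTc : ContinuousOn T (Icc ρ₁ ρ₂) := fun ρ hρ =>
    (hTd ρ (hIcc ρ hρ).1 (hIcc ρ hρ).2).continuousAt.continuousWithinAt
  have hsubst : ∀ g : ℝ → ℝ, Continuous g →
      ∫ ρ in ρ₁..ρ₂, g (T ρ) * (P k (ρ / D) / ρ / ℓ) = ∫ t in (0 : ℝ)..1, g t := by
    intro g hg
    have := intervalIntegral.integral_comp_mul_deriv (a := ρ₁) (b := ρ₂) (f := T)
      (f' := fun ρ => -(P k (ρ / D) / ρ) / ℓ) (g := g)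
      (fun x hx => by rw [huIcc] at hx; exact hTd x (hIcc x hx).1 (hIcc x hx).2)
      (by rw [huIcc]; exact hcT') hg
    rw [hT1, hT2, intervalIntegral.integral_symm 0 1] at this
    rw [← neg_eq_iff_eq_neg] at this
    rw [← this, ← intervalIntegral.integral_neg]
    refine intervalIntegral.integral_congr fun x _ => ?_
    simp only [Function.comp]; ring
  -- ρ^(2a) ψ² = 1/P_k reduces the density to P_k/ρ times the squared bump, and the substitution T
  -- turns P_k dρ/ρ into ℓ dT.
  have hJ : ∫ ρ in Ioi (0 : ℝ), ρ ^ (2 * a - 1) * P k (ρ / D) ^ 2 * w ρ ^ 2 = ℓ * B0 := by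
    rw [hred _ (fun ρ hρ => by rw [hw0 ρ hρ]; ring), hB0, ← hsubst (fun t => β t ^ 2) (by fun_prop),
      ← intervalIntegral.integral_const_mul]
    refine intervalIntegral.integral_congr fun ρ hρ => ?_
    rw [huIcc] at hρ
    obtain ⟨h0, h1⟩ := hIcc ρ hρ
    have hP := (P_mem (div_pos h0 hD) ((div_le_one hD).2 h1) k).1
    have hsq := radGround_sq (a := a) hD h0 h1 k
    have e : ρ ^ (2 * a - 1) = ρ ^ (2 * a) / ρ := Real.rpow_sub_one h0.ne' _
    rw [hval ρ hρ, e]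
    calc _ = (ρ ^ (2 * a) * radGround a D k ρ ^ 2) * P k (ρ / D) ^ 2 * β (T ρ) ^ 2 / ρ := by
          rw [hψ]; ring
      _ = _ := by rw [hsq]; field_simp
  have hsqint : ∫ ρ in ρ₁..ρ₂, ρ ^ (2 * a + 1) *
      (deriv w ρ + (a + sumP k (ρ / D) / 2) / ρ * w ρ) ^ 2 = B1 / ℓ := by
    rw [hB1, ← hsubst (fun t => deriv β t ^ 2) (by fun_prop), ← intervalIntegral.integral_div]
    refine intervalIntegral.integral_congr fun ρ hρ => ?_
    rw [huIcc] at hρ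
    obtain ⟨h0, h1⟩ := hIcc ρ hρ
    have hP := (P_mem (div_pos h0 hD) ((div_le_one hD).2 h1) k).1
    have hsq := radGround_sq (a := a) hD h0 h1 k
    have e : ρ ^ (2 * a + 1) = ρ ^ (2 * a) * ρ := Real.rpow_add_one h0.ne' _
    rw [hdval ρ hρ, e]
    calc _ = (ρ ^ (2 * a) * radGround a D k ρ ^ 2) * ρ *
          (deriv β (T ρ) * (-(P k (ρ / D) / ρ) / ℓ)) ^ 2 := by rw [hψ]; ring
      _ = _ := by rw [hsq]; field_simp
  have hcont : ∀ s : ℝ, ContinuousOn (fun ρ : ℝ => ρ ^ s) (Icc ρ₁ ρ₂) := fun s ρ hρ =>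
    (continuousAt_id.rpow_const (Or.inl (hIcc ρ hρ).1.ne')).continuousWithinAt
  have hcS : ContinuousOn (fun ρ => sumP k (ρ / D)) (Icc ρ₁ ρ₂) := fun ρ hρ => by
    obtain ⟨h0, h1⟩ := hIcc ρ hρ
    have := (hasDerivAt_sumP (div_pos h0 hD) ((div_le_one hD).2 h1) k).continuousAt
    exact (ContinuousAt.comp (f := fun ρ => ρ / D) this (by fun_prop)).continuousWithinAt
  have hcQ : ContinuousOn (fun ρ => sumSqP k (ρ / D)) (Icc ρ₁ ρ₂) := by
    have e : sumSqP k = fun ρ => ∑ i ∈ Finset.Icc 1 k, P i ρ ^ 2 := rfl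
    rw [e]
    refine continuousOn_finsetSum _ fun i _ => ContinuousOn.pow ?_ 2
    intro ρ hρ
    obtain ⟨h0, h1⟩ := hIcc ρ hρ
    have := (hasDerivAt_P (div_pos h0 hD) ((div_le_one hD).2 h1) i).continuousAt
    exact (ContinuousAt.comp (f := fun ρ => ρ / D) this (by fun_prop)).continuousWithinAt
  have hi0 : IntervalIntegrable (fun ρ => ρ ^ (2 * a + 1) *
      (deriv w ρ + (a + sumP k (ρ / D) / 2) / ρ * w ρ) ^ 2) volume ρ₁ ρ₂ :=
    ContinuousOn.intervalIntegrable_of_Icc hρ₁₂.le ((hcont _).mul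
      ((hwdc.continuousOn.add (((continuousOn_const.add (hcS.div_const 2)).div continuousOn_id
        fun x hx => (hIcc x hx).1.ne').mul hwc.continuousOn)).pow 2))
  have hi1 : IntervalIntegrable (fun ρ => ρ ^ (2 * a + 1) * deriv w ρ ^ 2) volume ρ₁ ρ₂ :=
    ContinuousOn.intervalIntegrable_of_Icc hρ₁₂.le ((hcont _).mul (hwdc.continuousOn.pow 2))
  have hi2 : IntervalIntegrable (fun ρ => ρ ^ (2 * a - 1) * (a ^ 2 + sumSqP k (ρ / D) / 4) *
      w ρ ^ 2) volume ρ₁ ρ₂ :=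
    ContinuousOn.intervalIntegrable_of_Icc hρ₁₂.le (((hcont _).mul
      (continuousOn_const.add (hcQ.div_const 4))).mul (hwc.continuousOn.pow 2))
  -- The integrand is the derivative of Q w² with Q = `radFlux a D k`, and w vanishes at both ends;
  -- the energy is therefore exactly the weighted term plus the square.
  have hG : ∫ ρ in ρ₁..ρ₂, (ρ ^ (2 * a + 1) *
      (deriv w ρ + (a + sumP k (ρ / D) / 2) / ρ * w ρ) ^ 2 +
      ρ ^ (2 * a - 1) * (a ^ 2 + sumSqP k (ρ / D) / 4) * w ρ ^ 2 -
      ρ ^ (2 * a + 1) * deriv w ρ ^ 2) = 0 := by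
    have hd : ∀ x ∈ uIcc ρ₁ ρ₂, HasDerivAt (fun ρ => radFlux a D k ρ * w ρ ^ 2)
        (x ^ (2 * a + 1) * (deriv w x + (a + sumP k (x / D) / 2) / x * w x) ^ 2 +
          x ^ (2 * a - 1) * (a ^ 2 + sumSqP k (x / D) / 4) * w x ^ 2 -
          x ^ (2 * a + 1) * deriv w x ^ 2) x := by
      intro x hx
      rw [huIcc] at hx
      obtain ⟨h0, h1⟩ := hIcc x hx
      refine ((hasDerivAt_radFlux hD h0 h1 k).mul ((hwd x).pow 2)).congr_deriv ?_
      rw [radial_square (a := a) (D := D) (u := w x) (u' := deriv w x) h0 k]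
      simp
    rw [intervalIntegral.integral_eq_sub_of_hasDerivAt hd ((hi0.add hi2).sub hi1),
      hw0 ρ₁ (by simp), hw0 ρ₂ (by simp)]
    ring
  rw [intervalIntegral.integral_sub (hi0.add hi2) hi1, intervalIntegral.integral_add hi0 hi2,
    hsqint] at hG
  refine ⟨w, ρ₁, hρ₁0, hwC, fun ρ hρ => ?_, ?_, ?_⟩
  · have : ρ ∉ Ioo ρ₁ ρ₂ := fun h => hρ ⟨h.1, by linarith [h.2]⟩
    exact ⟨hw0 ρ this, hwd0 ρ this⟩
  · rw [hJ]; positivity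
  · rw [hJ, hred _ (fun ρ hρ => by rw [hwd0 ρ hρ]; ring), hred _ (fun ρ hρ => by rw [hw0 ρ hρ]; ring)]
    have h3 : B1 / ℓ ≤ ε * (ℓ * B0) := by
      have h4 : B1 ≤ (ε * B0) * ℓ := by
        have := (div_le_iff₀ (by positivity : 0 < ε * B0)).1 (by linarith : B1 / (ε * B0) ≤ ℓ)
        linarith
      rw [div_le_iff₀ hℓ0]
      have : (ε * B0 * ℓ) * 1 ≤ (ε * B0 * ℓ) * ℓ :=
        mul_le_mul_of_nonneg_left (by linarith) (by positivity)
      nlinarith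
    linarith

/-! ### The norm and its dual -/

section Norm

variable {n : ℕ} {H : Seminorm ℝ (Rn n)}

lemma continuous_seminorm (H : Seminorm ℝ (Rn n)) : Continuous H :=
  continuousOn_univ.1 (H.convexOn.continuousOn isOpen_univ)

lemma IsFinslerNorm.pos (hH : IsFinslerNorm H) {ξ : Rn n} (h : ξ ≠ 0) : 0 < H ξ :=
  lt_of_le_of_ne (apply_nonneg H ξ) fun h0 => h (hH.eq_zero ξ h0.symm)

lemma IsFinslerNorm.exists_lower_bound (hH : IsFinslerNorm H) :
    ∃ c : ℝ, 0 < c ∧ ∀ ξ : Rn n, c * ‖ξ‖ ≤ H ξ := by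
  rcases (Metric.sphere (0 : Rn n) 1).eq_empty_or_nonempty with he | hne
  · refine ⟨1, one_pos, fun ξ => ?_⟩
    rcases eq_or_ne ξ 0 with rfl | h
    · simp
    · exfalso
      have : ‖ξ‖⁻¹ • ξ ∈ Metric.sphere (0 : Rn n) 1 := by
        simp [norm_smul, inv_mul_cancel₀ (norm_ne_zero_iff.2 h)]
      rw [he] at this; exact this
  · obtain ⟨ξ₀, hξ₀, hmin⟩ := (isCompact_sphere (0 : Rn n) 1).exists_isMinOn hne
      (continuous_seminorm H).continuousOn
    have h0 : ξ₀ ≠ 0 := by rintro rfl; simp at hξ₀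
    refine ⟨H ξ₀, hH.pos h0, fun ξ => ?_⟩
    rcases eq_or_ne ξ 0 with rfl | h
    · simp
    · have hn : 0 < ‖ξ‖ := norm_pos_iff.2 h
      have : ‖ξ‖⁻¹ • ξ ∈ Metric.sphere (0 : Rn n) 1 := by
        simp [norm_smul, inv_mul_cancel₀ hn.ne']
      have := hmin this
      rw [mem_ofPred_eq, map_smul_eq_mul, norm_inv, norm_norm, inv_mul_eq_div, le_div_iff₀ hn] at this
      exact this

lemma dualNorm_bddAbove (hH : IsFinslerNorm H) (x : Rn n) :
    BddAbove (range fun ξ : {ξ : Rn n // ξ ≠ 0} => inner ℝ x (ξ : Rn n) / H (ξ : Rn n)) := by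
  obtain ⟨c, hc, hle⟩ := hH.exists_lower_bound
  refine ⟨‖x‖ / c, ?_⟩
  rintro _ ⟨ξ, rfl⟩
  rw [div_le_div_iff₀ (hH.pos ξ.2) hc]
  calc inner ℝ x (ξ : Rn n) * c ≤ ‖x‖ * ‖(ξ : Rn n)‖ * c := by
        gcongr; exact real_inner_le_norm _ _
    _ = ‖x‖ * (c * ‖(ξ : Rn n)‖) := by ring
    _ ≤ _ := by gcongr; exact hle _

lemma inner_le_dualNorm_mul (hH : IsFinslerNorm H) (x ξ : Rn n) :
    inner ℝ x ξ ≤ dualNorm H x * H ξ := by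
  rcases eq_or_ne ξ 0 with rfl | h
  · simp
  · have := le_ciSup (dualNorm_bddAbove hH x) ⟨ξ, h⟩
    rwa [div_le_iff₀ (hH.pos h)] at this

lemma dualNorm_smul (H : Seminorm ℝ (Rn n)) {r : ℝ} (hr : 0 ≤ r) (x : Rn n) :
    dualNorm H (r • x) = r * dualNorm H x := by
  unfold dualNorm
  rw [Real.mul_iSup_of_nonneg hr]
  refine iSup_congr fun ξ => ?_
  rw [inner_smul_left]; simp [mul_div_assoc]

lemma dualNorm_zero (H : Seminorm ℝ (Rn n)) : dualNorm H 0 = 0 := by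
  simpa using dualNorm_smul H le_rfl 0

lemma dualNorm_pos (hH : IsFinslerNorm H) {x : Rn n} (h : x ≠ 0) : 0 < dualNorm H x := by
  have h1 := inner_le_dualNorm_mul hH x x
  have h2 : 0 < inner ℝ x x := real_inner_self_pos.2 h
  exact pos_of_mul_pos_left (h2.trans_le h1) (apply_nonneg H x)

lemma dualNorm_nonneg (hH : IsFinslerNorm H) (x : Rn n) : 0 ≤ dualNorm H x := by
  rcases eq_or_ne x 0 with rfl | h
  · rw [dualNorm_zero]
  · exact (dualNorm_pos hH h).le

lemma dualNorm_le_of_forall (hn : 1 ≤ n) (hH : IsFinslerNorm H) {x : Rn n} {c : ℝ}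
    (h : ∀ ξ, inner ℝ x ξ ≤ c * H ξ) : dualNorm H x ≤ c := by
  have : Nontrivial (Rn n) := by
    have : Nonempty (Fin n) := ⟨⟨0, hn⟩⟩
    infer_instance
  have : Nonempty {ξ : Rn n // ξ ≠ 0} := nonempty_subtype.2 (exists_ne 0)
  exact ciSup_le fun ξ => (div_le_iff₀ (hH.pos ξ.2)).2 (h ξ)

lemma dualNorm_add_le (hn : 1 ≤ n) (hH : IsFinslerNorm H) (x y : Rn n) :
    dualNorm H (x + y) ≤ dualNorm H x + dualNorm H y :=
  dualNorm_le_of_forall hn hH fun ξ => by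
    rw [inner_add_left, add_mul]
    exact add_le_add (inner_le_dualNorm_mul hH x ξ) (inner_le_dualNorm_mul hH y ξ)

lemma exists_dualNorm_le (hn : 1 ≤ n) (hH : IsFinslerNorm H) :
    ∃ c : ℝ, 0 < c ∧ ∀ x : Rn n, dualNorm H x ≤ c * ‖x‖ := by
  obtain ⟨c, hc, hle⟩ := hH.exists_lower_bound
  refine ⟨c⁻¹, by positivity, fun x => dualNorm_le_of_forall hn hH fun ξ => ?_⟩
  calc inner ℝ x ξ ≤ ‖x‖ * ‖ξ‖ := real_inner_le_norm _ _
    _ = c⁻¹ * ‖x‖ * (c * ‖ξ‖) := by field_simp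
    _ ≤ _ := by gcongr; exact hle ξ

lemma continuous_dualNorm (hn : 1 ≤ n) (hH : IsFinslerNorm H) : Continuous (dualNorm H) := by
  obtain ⟨c, hc, hle⟩ := exists_dualNorm_le hn hH
  refine (LipschitzWith.of_le_add_mul ⟨c, hc.le⟩ fun x y => ?_).continuous
  calc dualNorm H x = dualNorm H (y + (x - y)) := by rw [add_sub_cancel]
    _ ≤ dualNorm H y + dualNorm H (x - y) := dualNorm_add_le hn hH _ _
    _ ≤ _ := by rw [dist_eq_norm]; gcongr; exact hle _

/-- The duality map: the vector with `H η = H₀ x` and `⟨x, η⟩ = H₀(x)²`. -/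
lemma exists_dual_vector (hn : 1 ≤ n) (hH : IsFinslerNorm H) (x : Rn n) :
    ∃ η : Rn n, H η = dualNorm H x ∧ inner ℝ x η = dualNorm H x ^ 2 := by
  have : Nontrivial (Rn n) := by
    have : Nonempty (Fin n) := ⟨⟨0, hn⟩⟩
    infer_instance
  obtain ⟨c, hc, hle⟩ := hH.exists_lower_bound
  have hcomp : IsCompact {ξ : Rn n | H ξ = 1} := by
    refine Metric.isCompact_of_isClosed_isBounded
      (isClosed_eq (continuous_seminorm H) continuous_const) ?_
    refine (Metric.isBounded_closedBall (x := (0 : Rn n)) (r := c⁻¹)).subset fun ξ hξ => ?_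
    rw [mem_closedBall_zero_iff, ← one_div, le_div_iff₀ hc]
    have := hle ξ
    rw [mem_ofPred_eq] at hξ
    linarith
  obtain ⟨ξ₁, h1⟩ := exists_ne (0 : Rn n)
  have hscale : ∀ ξ : Rn n, ξ ≠ 0 → H ((H ξ)⁻¹ • ξ) = 1 := fun ξ h => by
    rw [map_smul_eq_mul, norm_inv, Real.norm_of_nonneg (hH.pos h).le,
      inv_mul_cancel₀ (hH.pos h).ne']
  obtain ⟨ξ, hξ, hmax⟩ := hcomp.exists_isMaxOn ⟨_, hscale ξ₁ h1⟩
    (f := fun ξ : Rn n => inner ℝ x ξ) (by fun_prop)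
  rw [mem_ofPred_eq] at hξ
  have heq : dualNorm H x = inner ℝ x ξ := by
    refine le_antisymm (dualNorm_le_of_forall hn hH fun ζ => ?_) ?_
    · rcases eq_or_ne ζ 0 with rfl | h
      · simp
      · have := hmax (hscale ζ h)
        simp only [inner_smul_right, mem_ofPred_eq] at this
        rwa [inv_mul_le_iff₀ (hH.pos h), mul_comm] at this
    · simpa [hξ] using inner_le_dualNorm_mul hH x ξ
  refine ⟨dualNorm H x • ξ, ?_, ?_⟩
  · rw [map_smul_eq_mul, hξ, mul_one, Real.norm_of_nonneg (dualNorm_nonneg hH x)]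
  · rw [inner_smul_right, ← heq, sq]

/-- If two dual vectors were distinct, their midpoint would have H below H₀(x) by strict convexity
of H², and yet still pair with x to H₀(x)². This contradicts ⟨x, ξ⟩ ≤ H₀(x) H(ξ). -/
lemma dual_vector_unique (hH : IsFinslerNorm H) {x η η' : Rn n}
    (h1 : H η = dualNorm H x) (h2 : inner ℝ x η = dualNorm H x ^ 2)
    (h1' : H η' = dualNorm H x) (h2' : inner ℝ x η' = dualNorm H x ^ 2) : η = η' := by
  by_contra hne
  have hx : x ≠ 0 := by
    rintro rfl
    rw [dualNorm_zero] at h1 h1'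
    exact hne ((hH.eq_zero _ h1).trans (hH.eq_zero _ h1').symm)
  have hpos := dualNorm_pos hH hx
  obtain ⟨-, hsc⟩ := hH.strictConvexOn
  have hs := hsc (mem_univ η) (mem_univ η') hne (a := 1 / 2) (b := 1 / 2)
    (by norm_num) (by norm_num) (by norm_num)
  have hin := inner_le_dualNorm_mul hH x ((1 / 2 : ℝ) • η + (1 / 2 : ℝ) • η')
  rw [inner_add_right, inner_smul_right, inner_smul_right, h2, h2'] at hin
  simp only [smul_eq_mul, h1, h1'] at hs
  have hlow : dualNorm H x ≤ H ((1 / 2 : ℝ) • η + (1 / 2 : ℝ) • η') := by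
    refine le_of_mul_le_mul_left (a := dualNorm H x) ?_ hpos
    nlinarith
  have := mul_self_le_mul_self hpos.le hlow
  nlinarith

/-- Half the gradient of `H₀²`. -/
def dualVec (H : Seminorm ℝ (Rn n)) (x : Rn n) : Rn n :=
  Classical.epsilon fun η : Rn n => H η = dualNorm H x ∧ inner ℝ x η = dualNorm H x ^ 2

lemma dualVec_spec (hn : 1 ≤ n) (hH : IsFinslerNorm H) (x : Rn n) :
    H (dualVec H x) = dualNorm H x ∧ inner ℝ x (dualVec H x) = dualNorm H x ^ 2 :=
  Classical.epsilon_spec (exists_dual_vector hn hH x)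

/-- Dual vectors of points near x stay in a compact ball, and every cluster point is a dual vector
of x because both defining equations pass to the limit. By uniqueness there is only one. -/
lemma continuous_dualVec (hn : 1 ≤ n) (hH : IsFinslerNorm H) : Continuous (dualVec H) := by
  refine continuous_iff_continuousAt.2 fun x => ?_
  obtain ⟨c, hc, hle⟩ := hH.exists_lower_bound
  have hcont := continuous_dualNorm hn hH
  refine (isCompact_closedBall (0 : Rn n) ((dualNorm H x + 1) / c)).tendsto_nhds_of_unique_mapClusterPt
    ?_ fun η _ hη => ?_
  · filter_upwards [hcont.continuousAt.eventually_lt_const (lt_add_one (dualNorm H x))] with z hz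
    rw [mem_closedBall_zero_iff, le_div_iff₀ hc]
    have := hle (dualVec H z)
    rw [(dualVec_spec hn hH z).1] at this
    linarith
  · obtain ⟨U, hU, hUt⟩ := mapClusterPt_iff_ultrafilter.1 hη
    have hid : Tendsto (fun z : Rn n => z) U (𝓝 x) := hU
    have e1 : H η = dualNorm H x := by
      refine tendsto_nhds_unique (((continuous_seminorm H).tendsto η).comp hUt) ?_
      refine ((hcont.tendsto x).comp hid).congr fun z => ?_
      exact (dualVec_spec hn hH z).1.symm
    have e2 : inner ℝ x η = dualNorm H x ^ 2 := by
      refine tendsto_nhds_unique (hid.inner hUt) ?_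
      refine (((hcont.pow 2).tendsto x).comp hid).congr fun z => ?_
      exact (dualVec_spec hn hH z).2.symm
    exact dual_vector_unique hH e1 e2 (dualVec_spec hn hH x).1 (dualVec_spec hn hH x).2

lemma two_inner_le (hH : IsFinslerNorm H) (x ξ : Rn n) :
    2 * inner ℝ x ξ ≤ dualNorm H x ^ 2 + H ξ ^ 2 := by
  nlinarith [inner_le_dualNorm_mul hH x ξ, sq_nonneg (dualNorm H x - H ξ)]

/-- Let η be the duality map. The inequality 2⟨x, ξ⟩ ≤ H₀(x)² + H(ξ)² is an equality at ξ = η(x).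
Applied to the pairs (x+h, η(x)) and (x, η(x+h)), it traps the increment of H₀² between 2⟨h, η(x)⟩
and 2⟨h, η(x+h)⟩, and η is continuous. -/
lemma hasFDerivAt_dualNorm_sq (hn : 1 ≤ n) (hH : IsFinslerNorm H) (x : Rn n) :
    HasFDerivAt (fun x => dualNorm H x ^ 2) (innerSL ℝ ((2 : ℝ) • dualVec H x)) x := by
  rw [hasFDerivAt_iff_isLittleO_nhds_zero, Asymptotics.isLittleO_iff]
  intro ε hε
  have ht : Tendsto (fun h => dualVec H (x + h) - dualVec H x) (𝓝 0) (𝓝 0) := by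
    have : ContinuousAt (fun h => dualVec H (x + h) - dualVec H x) 0 := by
      have := continuous_dualVec hn hH
      fun_prop
    simpa [ContinuousAt] using this
  have hev := (ht.norm.eventually_lt_const (by simpa using half_pos hε : ‖(0 : Rn n)‖ < ε / 2))
  filter_upwards [hev] with h hh
  have s1 := dualVec_spec hn hH x
  have s2 := dualVec_spec hn hH (x + h)
  have i1 := two_inner_le hH (x + h) (dualVec H x)
  have i2 := two_inner_le hH x (dualVec H (x + h))
  rw [inner_add_left, s1.1, s1.2] at i1
  rw [s2.1] at i2
  have e2 := s2.2
  rw [inner_add_left] at e2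
  have hCS := (real_inner_le_norm h (dualVec H (x + h) - dualVec H x))
  rw [inner_sub_right] at hCS
  simp only [innerSL_apply_apply, inner_smul_left]
  rw [Real.norm_eq_abs, real_inner_comm]
  have hb : ‖h‖ * ‖dualVec H (x + h) - dualVec H x‖ ≤ ‖h‖ * (ε / 2) := by gcongr
  rw [abs_le]
  simp only [conj_trivial]
  constructor <;> nlinarith [norm_nonneg h]

lemma contDiff_dualNorm_sq (hn : 1 ≤ n) (hH : IsFinslerNorm H) :
    ContDiff ℝ 1 (fun x => dualNorm H x ^ 2) := by
  refine contDiff_one_iff_hasFDerivAt.2 ⟨_, ?_, hasFDerivAt_dualNorm_sq hn hH⟩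
  exact (innerSL ℝ).continuous.comp ((continuous_dualVec hn hH).const_smul (2 : ℝ) :
    Continuous fun x => (2 : ℝ) • dualVec H x)

/-! ### The norm `Φ₀` and the radius of the domain -/

lemma Phi0_sq (H : Seminorm ℝ (Rn n)) (z : Rn n × ℝ) :
    Phi0 H z ^ 2 = dualNorm H z.1 ^ 2 + z.2 ^ 2 := Real.sq_sqrt (by positivity)

lemma Phi_sq (H : Seminorm ℝ (Rn n)) (z : Rn n × ℝ) :
    Phi H z ^ 2 = H z.1 ^ 2 + z.2 ^ 2 := Real.sq_sqrt (by positivity)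

lemma Phi0_nonneg (H : Seminorm ℝ (Rn n)) (z : Rn n × ℝ) : 0 ≤ Phi0 H z := Real.sqrt_nonneg _

lemma continuous_Phi0 (hn : 1 ≤ n) (hH : IsFinslerNorm H) : Continuous (Phi0 H) := by
  have := continuous_dualNorm hn hH
  unfold Phi0; fun_prop

lemma continuous_Phi (H : Seminorm ℝ (Rn n)) : Continuous (Phi H) := by
  have := continuous_seminorm H
  unfold Phi; fun_prop

lemma Phi0_zero (H : Seminorm ℝ (Rn n)) : Phi0 H 0 = 0 := by
  simp [Phi0, dualNorm_zero]

lemma Phi0_pos (hH : IsFinslerNorm H) {z : Rn n × ℝ} (h : z ≠ 0) : 0 < Phi0 H z := by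
  refine Real.sqrt_pos.2 ?_
  rcases eq_or_ne z.1 0 with h1 | h1
  · have h2 : z.2 ≠ 0 := fun h2 => h (Prod.ext h1 h2)
    positivity
  · have := dualNorm_pos hH h1
    positivity

lemma isCompact_Phi0_le (hn : 1 ≤ n) (hH : IsFinslerNorm H) (δ : ℝ) :
    IsCompact {z : Rn n × ℝ | Phi0 H z ≤ δ} := by
  refine Metric.isCompact_of_isClosed_isBounded
    (isClosed_le (continuous_Phi0 hn hH) continuous_const) ?_
  have hS : IsCompact (Metric.sphere (0 : Rn n × ℝ) 1) := isCompact_sphere _ _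
  have hne : (Metric.sphere (0 : Rn n × ℝ) 1).Nonempty := NormedSpace.sphere_nonempty.2 zero_le_one
  obtain ⟨z₀, hz₀, hmin⟩ := hS.exists_isMinOn hne (continuous_Phi0 hn hH).continuousOn
  have hm : 0 < Phi0 H z₀ := Phi0_pos hH (by rintro rfl; simp at hz₀)
  refine (Metric.isBounded_closedBall (x := (0 : Rn n × ℝ)) (r := δ / Phi0 H z₀)).subset fun z hz => ?_
  rw [mem_closedBall_zero_iff, le_div_iff₀ hm]
  rcases eq_or_ne z 0 with rfl | h
  · simpa using (Phi0_nonneg H _).trans hz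
  · have hn0 : 0 < ‖z‖ := norm_pos_iff.2 h
    have hmem : ‖z‖⁻¹ • z ∈ Metric.sphere (0 : Rn n × ℝ) 1 := by
      rw [mem_sphere_zero_iff_norm, norm_smul, norm_inv, norm_norm, inv_mul_cancel₀ hn0.ne']
    have := hmin hmem
    have e : Phi0 H (‖z‖⁻¹ • z) = ‖z‖⁻¹ * Phi0 H z := by
      unfold Phi0
      rw [Prod.smul_fst, Prod.smul_snd, dualNorm_smul H (by positivity), smul_eq_mul, mul_pow,
        mul_pow, ← mul_add, Real.sqrt_mul (by positivity), Real.sqrt_sq (by positivity)]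
    rw [mem_ofPred_eq, e, inv_mul_eq_div, le_div_iff₀ hn0] at this
    rw [mem_ofPred_eq] at hz
    linarith

variable {U : Set (Rn n × ℝ)}

lemma bddAbove_Phi0 (hn : 1 ≤ n) (hH : IsFinslerNorm H) (hUb : Bornology.IsBounded U) :
    BddAbove (Phi0 H '' upperPart U) := by
  have hc := hUb.isCompact_closure
  refine (hc.bddAbove_image (continuous_Phi0 hn hH).continuousOn).mono ?_
  exact image_mono fun z hz => subset_closure hz.1

lemma Phi0_le_radius (hn : 1 ≤ n) (hH : IsFinslerNorm H) (hUb : Bornology.IsBounded U)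
    {z : Rn n × ℝ} (hz : z ∈ upperPart U) : Phi0 H z ≤ radius H U :=
  le_csSup (bddAbove_Phi0 hn hH hUb) ⟨z, hz, rfl⟩

lemma exists_ball_Phi0 (hn : 1 ≤ n) (hH : IsFinslerNorm H) (hUo : IsOpen U)
    (hUb : Bornology.IsBounded U) (hU0 : (0 : Rn n × ℝ) ∈ U) :
    ∃ δ : ℝ, 0 < δ ∧ δ ≤ radius H U ∧ ∀ z, Phi0 H z ≤ δ → z ∈ U := by
  have hδ : ∃ δ : ℝ, 0 < δ ∧ ∀ z, Phi0 H z ≤ δ → z ∈ U := by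
    rcases (({z : Rn n × ℝ | Phi0 H z ≤ 1}) \ U).eq_empty_or_nonempty with he | hne
    · exact ⟨1, one_pos, fun z hz => by_contra fun h => by
        have : z ∈ (({z : Rn n × ℝ | Phi0 H z ≤ 1}) \ U) := ⟨hz, h⟩
        rw [he] at this; exact this⟩
    · obtain ⟨z₀, hz₀, hmin⟩ := ((isCompact_Phi0_le hn hH 1).diff hUo).exists_isMinOn hne
        (continuous_Phi0 hn hH).continuousOn
      have h0 : 0 < Phi0 H z₀ := Phi0_pos hH (by rintro rfl; exact hz₀.2 hU0)
      refine ⟨Phi0 H z₀ / 2, by positivity, fun z hz => by_contra fun h => ?_⟩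
      have h1 : Phi0 H z₀ ≤ 1 := hz₀.1
      have := hmin (show z ∈ _ from ⟨show Phi0 H z ≤ 1 by linarith, h⟩)
      rw [mem_ofPred_eq] at this
      linarith
  obtain ⟨δ, h0, h⟩ := hδ
  refine ⟨δ, h0, ?_, h⟩
  -- The point (0, δ) of U⁺ witnesses δ ≤ D, and in particular D > 0.
  have e : Phi0 H ((0 : Rn n), δ) = δ := by
    simp [Phi0, dualNorm_zero, Real.sqrt_sq h0.le]
  have := Phi0_le_radius hn hH hUb (z := ((0 : Rn n), δ)) ⟨h _ e.le, h0⟩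
  rwa [e] at this

end Norm

/-! ### Polar coordinates -/

lemma setLIntegral_Ioi_comp_mul {c : ℝ} (hc : 0 < c) (g : ℝ → ENNReal) :
    ∫⁻ t in Ioi (0 : ℝ), g t = ∫⁻ r in Ioi (0 : ℝ), ENNReal.ofReal c * g (c * r) := by
  have h := lintegral_image_eq_lintegral_abs_deriv_mul (s := Ioi (0 : ℝ)) (f := fun r => c * r)
    (f' := fun _ => c) measurableSet_Ioi
    (fun x _ => by simpa using ((hasDerivAt_id x).const_mul c).hasDerivWithinAt)
    (fun x _ y _ hxy => mul_left_cancel₀ hc.ne' hxy) g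
  rw [image_mul_left_Ioi hc, mul_zero, abs_of_pos hc] at h
  exact h

lemma lintegral_quadrant_polar {G : ℝ × ℝ → ENNReal} (hG : Measurable G) :
    ∫⁻ r in Ioi (0 : ℝ), ∫⁻ y in Ioi (0 : ℝ), G (r, y) =
      ∫⁻ θ in Ioo 0 (Real.pi / 2), ∫⁻ ρ in Ioi (0 : ℝ),
        ENNReal.ofReal ρ * G (ρ * Real.cos θ, ρ * Real.sin θ) := by
  have hQ : MeasurableSet (Ioi (0 : ℝ) ×ˢ Ioi (0 : ℝ)) := measurableSet_Ioi.prod measurableSet_Ioi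
  have hpolar : Measurable fun p : ℝ × ℝ => (p.1 * Real.cos p.2, p.1 * Real.sin p.2) := by fun_prop
  have h1 : ∫⁻ p, (Ioi (0 : ℝ) ×ˢ Ioi (0 : ℝ)).indicator G p =
      ∫⁻ r in Ioi (0 : ℝ), ∫⁻ y in Ioi (0 : ℝ), G (r, y) := by
    rw [lintegral_indicator hQ, Measure.volume_eq_prod, ← Measure.prod_restrict,
      lintegral_prod _ hG.aemeasurable]
  rw [← h1, ← lintegral_comp_polarCoord_symm]
  have hsub : Ioi (0 : ℝ) ×ˢ Ioo 0 (Real.pi / 2) ⊆ polarCoord.target := by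
    refine prod_mono Subset.rfl fun θ hθ => ⟨?_, ?_⟩ <;> linarith [hθ.1, hθ.2, Real.pi_pos]
  have h2 : ∫⁻ p in polarCoord.target, ENNReal.ofReal p.1 •
        (Ioi (0 : ℝ) ×ˢ Ioi (0 : ℝ)).indicator G (polarCoord.symm p) =
      ∫⁻ p in Ioi (0 : ℝ) ×ˢ Ioo 0 (Real.pi / 2),
        ENNReal.ofReal p.1 * G (p.1 * Real.cos p.2, p.1 * Real.sin p.2) := by
    rw [← lintegral_indicator polarCoord.open_target.measurableSet,
      ← lintegral_indicator (measurableSet_Ioi.prod measurableSet_Ioo)]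
    refine lintegral_congr fun p => ?_
    by_cases hp : p ∈ Ioi (0 : ℝ) ×ˢ Ioo 0 (Real.pi / 2)
    · rw [indicator_of_mem (hsub hp), indicator_of_mem hp, polarCoord_symm_apply,
        indicator_of_mem, smul_eq_mul]
      exact ⟨mul_pos hp.1 (cos_pos_of_mem hp.2), mul_pos hp.1 (sin_pos_of_mem hp.2)⟩
    · rw [indicator_of_notMem hp]
      by_cases hp' : p ∈ polarCoord.target
      · rw [indicator_of_mem hp', polarCoord_symm_apply, indicator_of_notMem, smul_zero]
        rintro ⟨hc, hs⟩
        have hp1 : 0 < p.1 := hp'.1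
        have hc' : 0 < Real.cos p.2 := pos_of_mul_pos_right hc hp1.le
        have hs' : 0 < Real.sin p.2 := pos_of_mul_pos_right hs hp1.le
        refine hp ⟨hp1, ?_, ?_⟩
        · by_contra hle
          exact absurd hs' (not_lt.2 (Real.sin_nonpos_of_nonpos_of_neg_pi_le (not_lt.1 hle)
            hp'.2.1.le))
        · by_contra hle
          exact absurd hc' (not_lt.2 (Real.cos_nonpos_of_pi_div_two_le_of_le (not_lt.1 hle)
            (by linarith [hp'.2.2, Real.pi_pos])))
      · rw [indicator_of_notMem hp']
  rw [h2, Measure.volume_eq_prod, ← Measure.prod_restrict, lintegral_prod_symm]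
  exact ((ENNReal.measurable_ofReal.comp measurable_fst).mul (hG.comp hpolar)).aemeasurable

section Polar

variable {n : ℕ} {H : Seminorm ℝ (Rn n)}

/-- Polar coordinates adapted to the norm `H₀`. -/
lemma exists_polar_measure (hn : 1 ≤ n) (hH : IsFinslerNorm H) :
    ∃ ν : Measure (Rn n), IsFiniteMeasure ν ∧ ν ≠ 0 ∧ (∀ᵐ v ∂ν, dualNorm H v = 1) ∧
      ∀ f : Rn n → ENNReal, Measurable f →
        ∫⁻ x, f x = ∫⁻ v, (∫⁻ r in Ioi (0 : ℝ), ENNReal.ofReal (r ^ (n - 1)) * f (r • v)) ∂ν := by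
  have hne : Nontrivial (Rn n) := by
    have : Nonempty (Fin n) := ⟨⟨0, hn⟩⟩
    infer_instance
  have hdim : Module.finrank ℝ (Rn n) = n := by simp
  have hcont := continuous_dualNorm hn hH
  let μ : Measure (Rn n) := volume
  -- Each unit direction σ is rescaled to H₀-length one by T; the density H₀(σ)^(-n) is the Jacobian
  -- factor of the substitution t = r/H₀(σ) in t^(n-1) dt.
  let d : Metric.sphere (0 : Rn n) 1 → ENNReal := fun σ => ENNReal.ofReal ((dualNorm H σ)⁻¹ ^ n)
  let T : Metric.sphere (0 : Rn n) 1 → Rn n := fun σ => (dualNorm H σ)⁻¹ • (σ : Rn n)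
  have hσ : ∀ σ : Metric.sphere (0 : Rn n) 1, 0 < dualNorm H σ := fun σ =>
    dualNorm_pos hH (ne_zero_of_mem_unit_sphere σ)
  have hinv : Measurable fun σ : Metric.sphere (0 : Rn n) 1 => (dualNorm H σ)⁻¹ :=
    (hcont.measurable.comp measurable_subtype_coe).inv
  have hd : Measurable d := (hinv.pow_const n).ennreal_ofReal
  have hT : Measurable T := hinv.smul measurable_subtype_coe
  let ν : Measure (Rn n) := (μ.toSphere.withDensity d).map T
  have hform : ∀ f : Rn n → ENNReal, Measurable f →
      ∫⁻ x, f x = ∫⁻ v, (∫⁻ r in Ioi (0 : ℝ), ENNReal.ofReal (r ^ (n - 1)) * f (r • v)) ∂ν := by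
    intro f hf
    have hm : Measurable fun v : Rn n =>
        ∫⁻ r in Ioi (0 : ℝ), ENNReal.ofReal (r ^ (n - 1)) * f (r • v) := by
      refine Measurable.lintegral_prod_right' (f := fun p : Rn n × ℝ =>
        ENNReal.ofReal (p.2 ^ (n - 1)) * f (p.2 • p.1)) ?_
      exact (measurable_snd.pow_const _).ennreal_ofReal.mul
        (hf.comp (measurable_snd.smul measurable_fst))
    rw [lintegral_map hm hT, lintegral_withDensity_eq_lintegral_mul _ hd
      (show Measurable fun σ => ∫⁻ r in Ioi (0 : ℝ),
        ENNReal.ofReal (r ^ (n - 1)) * f (r • T σ) from hm.comp hT)]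
    have h1 : ∫⁻ x, f x = ∫⁻ x : ({(0)}ᶜ : Set (Rn n)), f x ∂(μ.comap (↑)) := by
      rw [lintegral_subtype_comap (measurableSet_singleton _).compl f, restrict_compl_singleton]
    have h2 : ∫⁻ x : ({(0)}ᶜ : Set (Rn n)), f x ∂(μ.comap (↑)) =
        ∫⁻ p, f ((p.2 : ℝ) • (p.1 : Rn n)) ∂μ.toSphere.prod (.volumeIoiPow (n - 1)) := by
      have := μ.measurePreserving_homeomorphUnitSphereProd.lintegral_comp_emb
        (Homeomorph.measurableEmbedding _)
        (fun p : Metric.sphere (0 : Rn n) 1 × Ioi (0 : ℝ) => f ((p.2 : ℝ) • (p.1 : Rn n)))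
      rw [hdim] at this
      rw [← this]
      refine lintegral_congr fun x => ?_
      have hx : ‖(x : Rn n)‖ ≠ 0 := norm_ne_zero_iff.2 x.2
      simp [smul_smul, mul_inv_cancel₀ hx]
    have hm3 : Measurable fun p : Metric.sphere (0 : Rn n) 1 × Ioi (0 : ℝ) =>
        f ((p.2 : ℝ) • (p.1 : Rn n)) :=
      hf.comp ((measurable_subtype_coe.comp measurable_snd).smul
        (measurable_subtype_coe.comp measurable_fst))
    rw [h1, h2, lintegral_prod _ hm3.aemeasurable]
    refine lintegral_congr fun σ => ?_
    have hm4 : Measurable fun t : ℝ => f (t • (σ : Rn n)) :=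
      hf.comp (measurable_id.smul measurable_const)
    have e1 : ∫⁻ t, f ((t : ℝ) • (σ : Rn n)) ∂(Measure.volumeIoiPow (n - 1)) =
        ∫⁻ t in Ioi (0 : ℝ), ENNReal.ofReal (t ^ (n - 1)) * f (t • (σ : Rn n)) := by
      unfold Measure.volumeIoiPow
      rw [lintegral_withDensity_eq_lintegral_mul _ (by fun_prop)
        (show Measurable fun t : Ioi (0 : ℝ) => f ((t : ℝ) • (σ : Rn n)) from
          hm4.comp measurable_subtype_coe)]
      exact lintegral_subtype_comap measurableSet_Ioi
        (fun t : ℝ => ENNReal.ofReal (t ^ (n - 1)) * f (t • (σ : Rn n)))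
    rw [e1, setLIntegral_Ioi_comp_mul (inv_pos.2 (hσ σ))]
    simp only [Pi.mul_apply, d, T]
    rw [← lintegral_const_mul' _ _ ENNReal.ofReal_ne_top]
    refine setLIntegral_congr_fun measurableSet_Ioi fun r hr => ?_
    have hr0 : 0 < r := hr
    have hi := (inv_pos.2 (hσ σ)).le
    rw [smul_smul, ← mul_assoc, ← mul_assoc, ← ENNReal.ofReal_mul hi,
      ← ENNReal.ofReal_mul (by positivity), mul_pow, mul_comm r]
    congr 2
    obtain ⟨m, rfl⟩ : ∃ m, n = m + 1 := ⟨n - 1, by omega⟩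
    rw [Nat.add_sub_cancel, pow_succ]; ring
  have hae : ∀ᵐ v ∂ν, dualNorm H v = 1 := by
    rw [ae_map_iff hT.aemeasurable (measurableSet_eq_fun hcont.measurable measurable_const)]
    refine Filter.Eventually.of_forall fun σ => ?_
    simp only [T]
    rw [dualNorm_smul H (inv_pos.2 (hσ σ)).le, inv_mul_cancel₀ (hσ σ).ne']
  refine ⟨ν, ⟨?_⟩, ?_, hae, hform⟩
  -- Finiteness comes from applying the formula to the indicator of the unit ball of H₀: its volume
  -- is finite and equals the mass of ν times a positive constant.
  · have hcomp : IsCompact {x : Rn n | dualNorm H x ≤ 1} := by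
      have := (isCompact_Phi0_le hn hH 1).image continuous_fst
      refine this.of_isClosed_subset (isClosed_le hcont continuous_const) fun x hx => ?_
      refine ⟨(x, 0), ?_, rfl⟩
      rw [mem_ofPred_eq] at hx ⊢
      simpa [Phi0, Real.sqrt_sq (dualNorm_nonneg hH x)] using hx
    have hms : MeasurableSet {x : Rn n | dualNorm H x ≤ 1} := hcomp.measurableSet
    have h1 := hform _ (measurable_one.indicator hms)
    have h2 : ∫⁻ v, (∫⁻ r in Ioi (0 : ℝ), ENNReal.ofReal (r ^ (n - 1)) *
        {x : Rn n | dualNorm H x ≤ 1}.indicator 1 (r • v)) ∂ν =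
        ∫⁻ v, (∫⁻ r in Ioc (0 : ℝ) 1, ENNReal.ofReal (r ^ (n - 1))) ∂ν := by
      refine lintegral_congr_ae ?_
      filter_upwards [hae] with v hv
      rw [← lintegral_indicator measurableSet_Ioi, ← lintegral_indicator measurableSet_Ioc]
      refine lintegral_congr fun r => ?_
      by_cases h0 : 0 < r
      · rw [indicator_of_mem (show r ∈ Ioi (0 : ℝ) from h0)]
        by_cases hr1 : r ≤ 1
        · rw [indicator_of_mem (show r ∈ Ioc (0 : ℝ) 1 from ⟨h0, hr1⟩), indicator_of_mem]
          · simp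
          · rw [mem_ofPred_eq, dualNorm_smul H h0.le, hv, mul_one]; exact hr1
        · rw [indicator_of_notMem (fun h : r ∈ Ioc (0 : ℝ) 1 => hr1 h.2), indicator_of_notMem,
            mul_zero]
          rw [mem_ofPred_eq, dualNorm_smul H h0.le, hv, mul_one]; exact hr1
      · rw [indicator_of_notMem (fun h : r ∈ Ioi (0 : ℝ) => h0 h),
          indicator_of_notMem (fun h : r ∈ Ioc (0 : ℝ) 1 => h0 h.1)]
    rw [h2, lintegral_const, lintegral_indicator_one hms] at h1
    have hc0 : ∫⁻ r in Ioc (0 : ℝ) 1, ENNReal.ofReal (r ^ (n - 1)) ≠ 0 := by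
      intro h0
      rw [setLIntegral_eq_zero_iff measurableSet_Ioc (by fun_prop)] at h0
      have h0' : ∀ᵐ x : ℝ, x ∉ Ioc (0 : ℝ) 1 := by
        filter_upwards [h0] with x hx hmem
        have := hx hmem
        rw [ENNReal.ofReal_eq_zero] at this
        have := pow_pos hmem.1 (n - 1)
        linarith
      have := measure_eq_zero_iff_ae_notMem.2 h0'
      simp at this
    have hfin : volume {x : Rn n | dualNorm H x ≤ 1} < ⊤ := hcomp.measure_lt_top
    by_contra hinf
    rw [not_lt, top_le_iff] at hinf
    rw [hinf, ENNReal.mul_top hc0] at h1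
    exact hfin.ne h1
  · intro h0
    have := hform (fun _ => 1) measurable_const
    rw [h0] at this
    simp at this

/-- Polar coordinates on the upper half-space. -/
lemma lintegral_upper_polar {ν : Measure (Rn n)}
    (hn : 1 ≤ n) (hν : ∀ f : Rn n → ENNReal, Measurable f →
        ∫⁻ x, f x = ∫⁻ v, (∫⁻ r in Ioi (0 : ℝ), ENNReal.ofReal (r ^ (n - 1)) * f (r • v)) ∂ν)
    {F : Rn n × ℝ → ENNReal} (hF : Measurable F) :
    ∫⁻ z in {z : Rn n × ℝ | 0 < z.2}, F z = ∫⁻ v, (∫⁻ θ in Ioo 0 (Real.pi / 2),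
      ∫⁻ ρ in Ioi (0 : ℝ), ENNReal.ofReal (ρ ^ n * Real.cos θ ^ (n - 1)) *
        F ((ρ * Real.cos θ) • v, ρ * Real.sin θ)) ∂ν := by
  have e : {z : Rn n × ℝ | 0 < z.2} = univ ×ˢ Ioi (0 : ℝ) := by ext z; simp
  rw [e, Measure.volume_eq_prod, ← Measure.prod_restrict, lintegral_prod _ hF.aemeasurable,
    Measure.restrict_univ, hν _ hF.lintegral_prod_right']
  refine lintegral_congr fun v => ?_
  have hG : Measurable fun p : ℝ × ℝ => ENNReal.ofReal (p.1 ^ (n - 1)) * F (p.1 • v, p.2) :=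
    (measurable_fst.pow_const _).ennreal_ofReal.mul
      (hF.comp ((measurable_fst.smul measurable_const).prodMk measurable_snd))
  simp_rw [← lintegral_const_mul' _ _ ENNReal.ofReal_ne_top]
  rw [lintegral_quadrant_polar hG]
  refine setLIntegral_congr_fun measurableSet_Ioo fun θ hθ => ?_
  refine setLIntegral_congr_fun measurableSet_Ioi fun ρ hρ => ?_
  have hρ0 : 0 < ρ := hρ
  simp only
  rw [← mul_assoc, ← ENNReal.ofReal_mul hρ0.le]
  congr 2
  obtain ⟨m, rfl⟩ : ∃ m, n = m + 1 := ⟨n - 1, by omega⟩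
  rw [Nat.add_sub_cancel, mul_pow, pow_succ]; ring

end Polar

/-! ### Radial and tangential derivatives -/

section Gradient

variable {n : ℕ} {H : Seminorm ℝ (Rn n)}

lemma inner_grad_fst {u : Rn n × ℝ → ℝ} {z : Rn n × ℝ} (hu : DifferentiableAt ℝ u z) (v : Rn n) :
    inner ℝ (grad u z).1 v = fderiv ℝ u z (v, 0) := by
  have h : HasFDerivAt (fun x : Rn n => u (x, z.2))
      ((fderiv ℝ u z).comp (ContinuousLinearMap.inl ℝ (Rn n) ℝ)) z.1 :=
    HasFDerivAt.comp (g := u) z.1 hu.hasFDerivAt (hasFDerivAt_prodMk_left z.1 z.2)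
  have h2 := h.hasGradientAt.gradient
  simp only [grad]
  rw [h2, InnerProductSpace.toDual_symm_apply]
  simp

lemma grad_fst_eq {u : Rn n × ℝ → ℝ} {z : Rn n × ℝ} (hu : DifferentiableAt ℝ u z) :
    (grad u z).1 = (InnerProductSpace.toDual ℝ (Rn n)).symm
      ((fderiv ℝ u z).comp (ContinuousLinearMap.inl ℝ (Rn n) ℝ)) := by
  refine ext_inner_right ℝ fun v => ?_
  rw [inner_grad_fst hu, InnerProductSpace.toDual_symm_apply]
  simp

lemma grad_snd_eq {u : Rn n × ℝ → ℝ} {z : Rn n × ℝ} (hu : DifferentiableAt ℝ u z) :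
    (grad u z).2 = fderiv ℝ u z (0, 1) := by
  have h : HasFDerivAt (fun y : ℝ => u (z.1, y))
      ((fderiv ℝ u z).comp (ContinuousLinearMap.inr ℝ (Rn n) ℝ)) z.2 :=
    HasFDerivAt.comp (g := u) z.2 hu.hasFDerivAt (hasFDerivAt_prodMk_right z.1 z.2)
  simp only [grad]
  rw [h.hasDerivAt.deriv]
  simp

lemma continuous_grad {u : Rn n × ℝ → ℝ} (hu : ContDiff ℝ 1 u) : Continuous (grad u) := by
  have hd : Differentiable ℝ u := hu.differentiable one_ne_zero
  have hc : Continuous (fderiv ℝ u) := hu.continuous_fderiv one_ne_zero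
  have e : grad u = fun z => ((InnerProductSpace.toDual ℝ (Rn n)).symm
      ((fderiv ℝ u z).comp (ContinuousLinearMap.inl ℝ (Rn n) ℝ)), fderiv ℝ u z (0, 1)) :=
    funext fun z => Prod.ext (grad_fst_eq (hd z)) (grad_snd_eq (hd z))
  rw [e]
  exact ((LinearIsometryEquiv.continuous _).comp (hc.clm_comp continuous_const)).prodMk
    (hc.clm_apply continuous_const)

lemma grad_eq_zero_of_notMem_tsupport {u : Rn n × ℝ → ℝ} (hu : ContDiff ℝ 1 u) {z : Rn n × ℝ}
    (hz : z ∉ tsupport u) : grad u z = 0 := by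
  have hd := hu.differentiable one_ne_zero z
  have h0 : fderiv ℝ u z = 0 := by
    by_contra h
    exact hz (support_fderiv_subset ℝ h)
  refine Prod.ext ?_ ?_
  · rw [grad_fst_eq hd, h0]; simp
  · rw [grad_snd_eq hd, h0]; simp

/-- The derivative of `u` in the direction of the rays. -/
def radDeriv (H : Seminorm ℝ (Rn n)) (u : Rn n × ℝ → ℝ) (z : Rn n × ℝ) : ℝ :=
  (fderiv ℝ u z (z.1, 0) + z.2 * fderiv ℝ u z (0, 1)) / Phi0 H z

/-- The derivative of `u` along the polar angle, divided by `Φ₀`. -/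
def tanDeriv (H : Seminorm ℝ (Rn n)) (u : Rn n × ℝ → ℝ) (z : Rn n × ℝ) : ℝ :=
  (-(z.2 / dualNorm H z.1) * fderiv ℝ u z (z.1, 0) + dualNorm H z.1 * fderiv ℝ u z (0, 1)) /
    Phi0 H z

lemma measurable_radDeriv (hn : 1 ≤ n) (hH : IsFinslerNorm H) {u : Rn n × ℝ → ℝ}
    (hu : ContDiff ℝ 1 u) : Measurable (radDeriv H u) := by
  have hc : Continuous (fderiv ℝ u) := hu.continuous_fderiv one_ne_zero
  have h1 : Continuous fun z : Rn n × ℝ => fderiv ℝ u z (z.1, 0) := hc.clm_apply (by fun_prop)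
  have h2 : Continuous fun z : Rn n × ℝ => fderiv ℝ u z (0, 1) := hc.clm_apply (by fun_prop)
  have h3 := continuous_Phi0 hn hH
  exact (h1.measurable.add (measurable_snd.mul h2.measurable)).div h3.measurable

lemma measurable_tanDeriv (hn : 1 ≤ n) (hH : IsFinslerNorm H) {u : Rn n × ℝ → ℝ}
    (hu : ContDiff ℝ 1 u) : Measurable (tanDeriv H u) := by
  have hc : Continuous (fderiv ℝ u) := hu.continuous_fderiv one_ne_zero
  have h1 : Continuous fun z : Rn n × ℝ => fderiv ℝ u z (z.1, 0) := hc.clm_apply (by fun_prop)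
  have h2 : Continuous fun z : Rn n × ℝ => fderiv ℝ u z (0, 1) := hc.clm_apply (by fun_prop)
  have h3 := continuous_Phi0 hn hH
  have h4 : Measurable fun z : Rn n × ℝ => dualNorm H z.1 :=
    ((continuous_dualNorm hn hH).comp continuous_fst).measurable
  exact (((measurable_snd.div h4).neg.mul h1.measurable).add (h4.mul h2.measurable)).div
    h3.measurable

lemma abs_inner_le (hH : IsFinslerNorm H) (x ξ : Rn n) :
    |inner ℝ x ξ| ≤ dualNorm H x * H ξ := by
  refine abs_le.2 ⟨?_, inner_le_dualNorm_mul hH x ξ⟩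
  have := inner_le_dualNorm_mul hH x (-ξ)
  rw [inner_neg_right, map_neg_eq_map] at this
  linarith

/-- Put p = ⟨x, ∇ₓu⟩, q = ∂u/∂y and r = H₀(x). The two derivatives are the vector (p/r, q) seen in a
rotated orthonormal frame, so their squares add up to p²/r² + q². The duality p² ≤ r² H(∇ₓu)² is the
only loss. -/
lemma radDeriv_sq_add_tanDeriv_sq_le (hH : IsFinslerNorm H) {u : Rn n × ℝ → ℝ} {z : Rn n × ℝ}
    (hu : DifferentiableAt ℝ u z) (hz : 0 < z.2) :
    radDeriv H u z ^ 2 + tanDeriv H u z ^ 2 ≤ Phi H (grad u z) ^ 2 := by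
  have hΦ : 0 < Phi0 H z := Phi0_pos hH (by rintro rfl; simp at hz)
  rw [Phi_sq, grad_snd_eq hu, radDeriv, tanDeriv, div_pow, div_pow, ← add_div,
    div_le_iff₀ (by positivity), Phi0_sq]
  rcases eq_or_ne z.1 0 with h0 | h0
  · rw [h0, dualNorm_zero]
    have : (fderiv ℝ u z) ((0 : Rn n), (0 : ℝ)) = 0 := map_zero _
    rw [this]
    have := sq_nonneg (H (grad u z).1 * z.2)
    nlinarith
  · have hr := dualNorm_pos hH h0
    have hp := abs_inner_le hH z.1 (grad u z).1
    rw [real_inner_comm, inner_grad_fst hu] at hp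
    set r := dualNorm H z.1
    set p := fderiv ℝ u z (z.1, 0)
    set q := fderiv ℝ u z (0, 1)
    have hp2 : p ^ 2 ≤ r ^ 2 * H (grad u z).1 ^ 2 := by
      rw [← mul_pow, ← sq_abs p]; gcongr
    have e : (p + z.2 * q) ^ 2 + (-(z.2 / r) * p + r * q) ^ 2 =
        (p ^ 2 / r ^ 2 + q ^ 2) * (r ^ 2 + z.2 ^ 2) := by
      field_simp; ring
    rw [e]
    gcongr
    rw [div_le_iff₀ (by positivity)]; linarith

/-- The point with polar coordinates `(ρ, θ, v)`. -/
def polarPt (v : Rn n) (θ ρ : ℝ) : Rn n × ℝ := ((ρ * Real.cos θ) • v, ρ * Real.sin θ)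

lemma dualNorm_polarPt {v : Rn n} (hv : dualNorm H v = 1) {θ ρ : ℝ}
    (hθ : θ ∈ Ioo 0 (Real.pi / 2)) (hρ : 0 < ρ) :
    dualNorm H (polarPt v θ ρ).1 = ρ * Real.cos θ := by
  have := cos_pos_of_mem hθ
  rw [polarPt, dualNorm_smul H (by positivity), hv, mul_one]

lemma Phi0_polarPt {v : Rn n} (hv : dualNorm H v = 1) {θ ρ : ℝ}
    (hθ : θ ∈ Ioo 0 (Real.pi / 2)) (hρ : 0 < ρ) : Phi0 H (polarPt v θ ρ) = ρ := by
  rw [Phi0, dualNorm_polarPt hv hθ hρ, polarPt, mul_pow, mul_pow, ← mul_add, add_comm,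
    Real.sin_sq_add_cos_sq, mul_one, Real.sqrt_sq hρ.le]

lemma radDeriv_polarPt {u : Rn n × ℝ → ℝ} {v : Rn n} (hv : dualNorm H v = 1) {θ ρ : ℝ}
    (hθ : θ ∈ Ioo 0 (Real.pi / 2)) (hρ : 0 < ρ) :
    radDeriv H u (polarPt v θ ρ) =
      fderiv ℝ u (polarPt v θ ρ) (Real.cos θ • v, Real.sin θ) := by
  rw [radDeriv, Phi0_polarPt hv hθ hρ]
  set L := fderiv ℝ u (polarPt v θ ρ)
  have e1 : ((polarPt v θ ρ).1, (0 : ℝ)) = ρ • (Real.cos θ • v, (0 : ℝ)) := by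
    simp [polarPt, smul_smul]
  have e2 : (Real.cos θ • v, Real.sin θ) = (Real.cos θ • v, (0 : ℝ)) + Real.sin θ • (0, 1) := by
    simp
  rw [e1, e2, map_add, map_smul, map_smul]
  simp only [polarPt, smul_eq_mul]
  field_simp

lemma tanDeriv_polarPt {u : Rn n × ℝ → ℝ} {v : Rn n} (hv : dualNorm H v = 1) {θ ρ : ℝ}
    (hθ : θ ∈ Ioo 0 (Real.pi / 2)) (hρ : 0 < ρ) :
    tanDeriv H u (polarPt v θ ρ) =
      fderiv ℝ u (polarPt v θ ρ) (-(ρ * Real.sin θ) • v, ρ * Real.cos θ) / ρ := by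
  have hc := cos_pos_of_mem hθ
  rw [tanDeriv, Phi0_polarPt hv hθ hρ, dualNorm_polarPt hv hθ hρ]
  set L := fderiv ℝ u (polarPt v θ ρ)
  have e1 : ((polarPt v θ ρ).1, (0 : ℝ)) = (ρ * Real.cos θ) • (v, (0 : ℝ)) := by
    simp [polarPt]
  have e2 : (-(ρ * Real.sin θ) • v, ρ * Real.cos θ) =
      (-(ρ * Real.sin θ)) • (v, (0 : ℝ)) + (ρ * Real.cos θ) • (0, 1) := by
    simp
  rw [e1, e2, map_add, map_smul, map_smul, map_smul]
  simp only [polarPt, smul_eq_mul]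
  field_simp

lemma hasDerivAt_polarPt_radius {u : Rn n × ℝ → ℝ} (hu : Differentiable ℝ u) (v : Rn n) (θ ρ : ℝ) :
    HasDerivAt (fun ρ => u (polarPt v θ ρ))
      (fderiv ℝ u (polarPt v θ ρ) (Real.cos θ • v, Real.sin θ)) ρ := by
  have h : HasDerivAt (fun ρ => polarPt v θ ρ) (Real.cos θ • v, Real.sin θ) ρ := by
    have h1 := ((hasDerivAt_id ρ).mul_const (Real.cos θ)).smul_const v
    have h2 := (hasDerivAt_id ρ).mul_const (Real.sin θ)
    simpa [polarPt] using! h1.prodMk h2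
  exact (hu _).hasFDerivAt.comp_hasDerivAt ρ h

lemma hasDerivAt_polarPt_angle {u : Rn n × ℝ → ℝ} (hu : Differentiable ℝ u) (v : Rn n) (θ ρ : ℝ) :
    HasDerivAt (fun θ => u (polarPt v θ ρ))
      (fderiv ℝ u (polarPt v θ ρ) (-(ρ * Real.sin θ) • v, ρ * Real.cos θ)) θ := by
  have h : HasDerivAt (fun θ => polarPt v θ ρ) (-(ρ * Real.sin θ) • v, ρ * Real.cos θ) θ := by
    have h1 := ((Real.hasDerivAt_cos θ).const_mul ρ).smul_const v
    have h2 := (Real.hasDerivAt_sin θ).const_mul ρ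
    simpa [polarPt] using! h1.prodMk h2
  exact (hu _).hasFDerivAt.comp_hasDerivAt θ h

end Gradient

/-! ### Weighted polar coordinates -/

section PolarWeighted

variable {n : ℕ} {H : Seminorm ℝ (Rn n)} {α : ℝ}

/-- The property of the measures provided by `exists_polar_measure`. -/
structure IsPolarMeasure (H : Seminorm ℝ (Rn n)) (ν : Measure (Rn n)) : Prop where
  finite : IsFiniteMeasure ν
  ne_zero : ν ≠ 0
  ae_eq_one : ∀ᵐ v ∂ν, dualNorm H v = 1
  lintegral_eq : ∀ f : Rn n → ENNReal, Measurable f →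
    ∫⁻ x, f x = ∫⁻ v, (∫⁻ r in Ioi (0 : ℝ), ENNReal.ofReal (r ^ (n - 1)) * f (r • v)) ∂ν

lemma lintegral_upper_weighted {ν : Measure (Rn n)} (hn : 1 ≤ n) (hν : IsPolarMeasure H ν)
    {G : Rn n × ℝ → ℝ} (hG : Measurable G) :
    ∫⁻ z in {z : Rn n × ℝ | 0 < z.2}, ENNReal.ofReal (z.2 ^ α * G z) =
      ∫⁻ v, (∫⁻ θ in Ioo 0 (Real.pi / 2), ENNReal.ofReal (angWeight n α θ) *
        ∫⁻ ρ in Ioi (0 : ℝ), ENNReal.ofReal (ρ ^ (n + α) * G (polarPt v θ ρ))) ∂ν := by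
  have hm : Measurable fun z : Rn n × ℝ => ENNReal.ofReal (z.2 ^ α * G z) :=
    ((measurable_snd.pow_const α).mul hG).ennreal_ofReal
  rw [lintegral_upper_polar hn hν.lintegral_eq hm]
  refine lintegral_congr fun v => ?_
  refine setLIntegral_congr_fun measurableSet_Ioo fun θ hθ => ?_
  simp only
  rw [← lintegral_const_mul' _ _ ENNReal.ofReal_ne_top]
  refine setLIntegral_congr_fun measurableSet_Ioi fun ρ hρ => ?_
  have hρ0 : 0 < ρ := hρ
  have hs := sin_pos_of_mem hθ
  have hc := cos_pos_of_mem hθ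
  have hw := angWeight_pos (n := n) (α := α) hθ
  rw [← ENNReal.ofReal_mul (by positivity), ← ENNReal.ofReal_mul hw.le]
  congr 1
  change ρ ^ n * Real.cos θ ^ (n - 1) * ((ρ * Real.sin θ) ^ α * G (polarPt v θ ρ)) = _
  rw [Real.mul_rpow hρ0.le hs.le, Real.rpow_add hρ0, Real.rpow_natCast, angWeight]
  ring

end PolarWeighted

/-! ### The radial and tangential inequalities on the half-space -/

section Global

variable {n : ℕ} {H : Seminorm ℝ (Rn n)} {α b : ℝ}

/-- The exponent `(n + α - 1) / 2` of the radial ground state. -/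
def radExp (n : ℕ) (α : ℝ) : ℝ := (n + α - 1) / 2

/-- The radial part of the inequality on the half-space. -/
lemma radial_global (hn : 1 ≤ n) (hH : IsFinslerNorm H) {ν : Measure (Rn n)}
    (hν : IsPolarMeasure H ν) (ha : 0 < radExp n α) {D : ℝ} (hD : 0 < D) (m : ℕ)
    {u : Rn n × ℝ → ℝ} (hu : ContDiff ℝ 1 u)
    (hsupp : ∀ z : Rn n × ℝ, 0 < z.2 → D < Phi0 H z → u z = 0) :
    ∫⁻ z in {z : Rn n × ℝ | 0 < z.2}, ENNReal.ofReal (z.2 ^ α *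
      ((radExp n α ^ 2 + sumSqP m (Phi0 H z / D) / 4) / Phi0 H z ^ 2 * u z ^ 2)) ≤
    ∫⁻ z in {z : Rn n × ℝ | 0 < z.2}, ENNReal.ofReal (z.2 ^ α * radDeriv H u z ^ 2) := by
  have hΦ := (continuous_Phi0 hn hH).measurable
  have hum := hu.continuous.measurable
  have hd := hu.differentiable one_ne_zero
  have hc : Continuous (fderiv ℝ u) := hu.continuous_fderiv one_ne_zero
  rw [lintegral_upper_weighted hn hν (by fun_prop),
    lintegral_upper_weighted hn hν ((measurable_radDeriv hn hH hu).pow_const 2)]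
  refine lintegral_mono_ae ?_
  filter_upwards [hν.ae_eq_one] with v hv
  refine setLIntegral_mono' measurableSet_Ioo fun θ hθ => ?_
  refine mul_le_mul_right ?_ _
  have hs := sin_pos_of_mem hθ
  have hγ : Continuous fun ρ => polarPt v θ ρ := by unfold polarPt; fun_prop
  -- The support hypothesis gives vanishing only for ρ > D; continuity adds ρ = D, where the radial
  -- boundary term is evaluated.
  have hw0 : ∀ ρ, D ≤ ρ → u (polarPt v θ ρ) = 0 := by
    have h1 : ∀ ρ ∈ Ioi D, u (polarPt v θ ρ) = 0 := fun ρ hρ => by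
      have hρ0 : 0 < ρ := hD.trans hρ
      refine hsupp _ (mul_pos hρ0 hs) ?_
      rw [Phi0_polarPt hv hθ hρ0]; exact hρ
    have hcl : IsClosed {ρ | u (polarPt v θ ρ) = 0} :=
      isClosed_eq (hu.continuous.comp hγ) continuous_const
    have := hcl.closure_subset_iff.2 h1
    rw [closure_Ioi] at this
    exact fun ρ hρ => this hρ
  have key := radial_ineq ha hD m (hasDerivAt_polarPt_radius hd v θ)
    ((hc.comp hγ).clm_apply continuous_const) hw0
  have e1 : 2 * radExp n α + 1 = n + α := by unfold radExp; ring
  rw [e1] at key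
  refine le_trans (le_of_eq ?_) (key.trans (le_of_eq ?_))
  · refine setLIntegral_congr_fun measurableSet_Ioi fun ρ hρ => ?_
    have hρ0 : 0 < ρ := hρ
    simp only [Phi0_polarPt hv hθ hρ0]
    congr 1
    have e2 : ρ ^ ((n : ℝ) + α) = ρ ^ (2 * radExp n α - 1) * ρ ^ 2 := by
      rw [← Real.rpow_natCast, ← Real.rpow_add hρ0]; congr 1; unfold radExp; push_cast; ring
    rw [e2]; field_simp
  · refine setLIntegral_congr_fun measurableSet_Ioi fun ρ hρ => ?_
    simp only [radDeriv_polarPt hv hθ hρ]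

/-- The tangential part of the inequality on the half-space. -/
lemma tangential_global (hα : α ∈ Ioo (-1 : ℝ) 1) (hb : 2 - α ≤ b) (hbn : b < n + 1)
    (hH : IsFinslerNorm H) {ν : Measure (Rn n)} (hν : IsPolarMeasure H ν)
    {u : Rn n × ℝ → ℝ} (hu : ContDiff ℝ 1 u) :
    ENNReal.ofReal (K n α b) * ∫⁻ x, ENNReal.ofReal (traceDensity α H u x) ≤
    ∫⁻ z in {z : Rn n × ℝ | 0 < z.2}, ENNReal.ofReal (z.2 ^ α *
      (tanDeriv H u z ^ 2 + angEigen n α b / Phi0 H z ^ 2 * u z ^ 2)) := by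
  have hn := one_le_dim hα hb hbn
  have hK := (K_pos hα hb hbn).le
  have hΦ := (continuous_Phi0 hn hH).measurable
  have hum := hu.continuous.measurable
  have hd := hu.differentiable one_ne_zero
  have hc : Continuous (fderiv ℝ u) := hu.continuous_fderiv one_ne_zero
  have hG : Measurable fun z : Rn n × ℝ =>
      tanDeriv H u z ^ 2 + angEigen n α b / Phi0 H z ^ 2 * u z ^ 2 :=
    ((measurable_tanDeriv hn hH hu).pow_const 2).add (by fun_prop)
  have htr : Measurable fun x : Rn n => ENNReal.ofReal (traceDensity α H u x) := by
    have h1 : Measurable fun x : Rn n => u (x, 0) :=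
      (hu.continuous.comp (by fun_prop : Continuous fun x : Rn n => (x, (0 : ℝ)))).measurable
    have h2 := (continuous_dualNorm hn hH).measurable
    unfold traceDensity
    fun_prop
  rw [lintegral_upper_weighted hn hν hG, hν.lintegral_eq _ htr,
    ← lintegral_const_mul' _ _ ENNReal.ofReal_ne_top]
  refine lintegral_mono_ae ?_
  filter_upwards [hν.ae_eq_one] with v hv
  have hγ : Continuous fun p : ℝ × ℝ => polarPt v p.1 p.2 := by unfold polarPt; fun_prop
  simp_rw [← lintegral_const_mul' _ _ ENNReal.ofReal_ne_top]
  -- Tonelli puts the angular integral inside, so that the angular inequality applies on each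
  -- quarter circle of fixed radius ρ.
  rw [lintegral_lintegral_swap]
  · refine setLIntegral_mono' measurableSet_Ioi fun ρ hρ => ?_
    have hρ0 : 0 < ρ := hρ
    have hγ' : Continuous fun θ => polarPt v θ ρ := by unfold polarPt; fun_prop
    have key := angular_ineq hα hb hbn (fun θ => hasDerivAt_polarPt_angle hd v θ ρ)
      ((hc.comp hγ').clm_apply (by fun_prop))
    have e0 : polarPt v 0 ρ = (ρ • v, 0) := by simp [polarPt]
    have ep : ρ ^ ((n : ℝ) + α) = ρ ^ ((n : ℝ) + α - 2) * ρ ^ 2 := by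
      rw [← Real.rpow_natCast, ← Real.rpow_add hρ0]; congr 1; push_cast; ring
    have hp0 : 0 ≤ ρ ^ ((n : ℝ) + α - 2) := Real.rpow_nonneg hρ0.le _
    calc _ = ENNReal.ofReal (ρ ^ ((n : ℝ) + α - 2)) *
          ENNReal.ofReal (K n α b * u (polarPt v 0 ρ) ^ 2) := by
          rw [← ENNReal.ofReal_mul (by positivity), ← ENNReal.ofReal_mul hK,
            ← ENNReal.ofReal_mul hp0, traceDensity, dualNorm_smul H hρ0.le, hv, mul_one, e0]
          congr 1
          have e3 : ρ ^ ((n : ℝ) + α - 2) = ρ ^ (n - 1) / ρ ^ (1 - α) := by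
            rw [← Real.rpow_natCast, ← Real.rpow_sub hρ0]
            congr 1; push_cast [hn]; ring
          rw [e3]; ring
      _ ≤ ENNReal.ofReal (ρ ^ ((n : ℝ) + α - 2)) * _ := mul_le_mul_right key _
      _ = _ := by
          rw [← lintegral_const_mul' _ _ ENNReal.ofReal_ne_top]
          refine setLIntegral_congr_fun measurableSet_Ioo fun θ hθ => ?_
          have hw := (angWeight_pos (n := n) (α := α) hθ).le
          rw [← ENNReal.ofReal_mul hp0, ← ENNReal.ofReal_mul hw, tanDeriv_polarPt hv hθ hρ0,
            Phi0_polarPt hv hθ hρ0, ep]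
          congr 1
          field_simp
  · have h1 : Measurable fun p : ℝ × ℝ => ENNReal.ofReal (angWeight n α p.1) *
        ENNReal.ofReal (p.2 ^ ((n : ℝ) + α) *
          (tanDeriv H u (polarPt v p.1 p.2) ^ 2 +
            angEigen n α b / Phi0 H (polarPt v p.1 p.2) ^ 2 * u (polarPt v p.1 p.2) ^ 2)) :=
      (measurable_angWeight.comp measurable_fst).ennreal_ofReal.mul
        ((measurable_snd.pow_const _).mul (hG.comp hγ.measurable)).ennreal_ofReal
    exact h1.aemeasurable

end Global

/-! ### From lower integrals to integrals, and integrability of y^α on bounded sets -/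

section Transfer

/-- The finiteness of the singular trace, Hardy and logarithmic integrals is derived from the
integrability of the energy in this way. -/
lemma integrable_and_integral_le {X Y : Type*} [MeasurableSpace X] [MeasurableSpace Y]
    {μ : Measure X} {ν : Measure Y} {f : X → ℝ} {g : Y → ℝ} (hf : AEStronglyMeasurable f μ)
    (hf0 : 0 ≤ᵐ[μ] f) (hg : Integrable g ν) (hg0 : 0 ≤ᵐ[ν] g)
    (h : ∫⁻ x, ENNReal.ofReal (f x) ∂μ ≤ ∫⁻ y, ENNReal.ofReal (g y) ∂ν) :
    Integrable f μ ∧ ∫ x, f x ∂μ ≤ ∫ y, g y ∂ν := by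
  have hgt : ∫⁻ y, ENNReal.ofReal (g y) ∂ν ≠ ⊤ :=
    (lintegral_ofReal_ne_top_iff_integrable hg.1 hg0).2 hg
  refine ⟨(lintegral_ofReal_ne_top_iff_integrable hf hf0).1 (ne_top_of_le_ne_top hgt h), ?_⟩
  rw [integral_eq_lintegral_of_nonneg_ae hf0 hf, integral_eq_lintegral_of_nonneg_ae hg0 hg.1]
  exact ENNReal.toReal_mono hgt h

variable {n : ℕ} {α : ℝ}

/-- The open upper half-space. -/
def upperHalf (n : ℕ) : Set (Rn n × ℝ) := {z | 0 < z.2}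

lemma measurableSet_upperHalf : MeasurableSet (upperHalf n) :=
  measurableSet_lt measurable_const measurable_snd

lemma integrableOn_rpow_snd (hα : -1 < α) (R : ℝ) :
    IntegrableOn (fun z : Rn n × ℝ => z.2 ^ α) (upperHalf n ∩ Metric.closedBall 0 R) := by
  have hsub : upperHalf n ∩ Metric.closedBall 0 R ⊆
      Metric.closedBall (0 : Rn n) R ×ˢ Ioc (0 : ℝ) R := by
    rintro z ⟨hz, hzR⟩
    have hz : 0 < z.2 := hz
    rw [mem_closedBall_zero_iff] at hzR
    refine ⟨mem_closedBall_zero_iff.2 ((norm_fst_le z).trans hzR), hz, ?_⟩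
    exact (le_abs_self _).trans ((norm_snd_le z).trans hzR)
  refine IntegrableOn.mono_set ?_ hsub
  rw [IntegrableOn, Measure.volume_eq_prod, ← Measure.prod_restrict]
  have h1 : IntegrableOn (fun _ : Rn n => (1 : ℝ)) (Metric.closedBall 0 R) :=
    integrableOn_const measure_closedBall_lt_top.ne
  have h2 : IntegrableOn (fun y : ℝ => y ^ α) (Ioc 0 R) := by
    rcases le_total 0 R with hR | hR
    · exact (intervalIntegrable_iff_integrableOn_Ioc_of_le hR).1
        (intervalIntegral.intervalIntegrable_rpow' hα)
    · rw [Ioc_eq_empty (not_lt.2 hR)]; exact integrableOn_empty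
  simpa using h1.mul_prod h2

/-- The function `C y^α` on a ball, which dominates the integrands below. -/
lemma integrableOn_dominating (hα : -1 < α) (R C : ℝ) :
    IntegrableOn ((Metric.closedBall 0 R).indicator fun z : Rn n × ℝ => C * z.2 ^ α)
      (upperHalf n) := by
  rw [integrableOn_indicator_iff Metric.isClosed_closedBall.measurableSet, inter_comm]
  exact (integrableOn_rpow_snd hα R).const_mul C

lemma norm_le_dominating {f : Rn n × ℝ → ℝ} {R C : ℝ}
    (h0 : ∀ z, R < ‖z‖ → f z = 0) (hb : ∀ z, 0 < z.2 → |f z| ≤ C * z.2 ^ α) {z : Rn n × ℝ}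
    (hz : z ∈ upperHalf n) :
    ‖f z‖ ≤ (Metric.closedBall 0 R).indicator (fun z : Rn n × ℝ => C * z.2 ^ α) z := by
  by_cases h : z ∈ Metric.closedBall (0 : Rn n × ℝ) R
  · rw [indicator_of_mem h]; exact hb z hz
  · rw [indicator_of_notMem h, h0 z (by simpa using h), norm_zero]

lemma integrableOn_upperHalf_of_bound (hα : -1 < α) {f : Rn n × ℝ → ℝ} (hf : Measurable f)
    {R C : ℝ} (h0 : ∀ z, R < ‖z‖ → f z = 0) (hb : ∀ z, 0 < z.2 → |f z| ≤ C * z.2 ^ α) :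
    IntegrableOn f (upperHalf n) := by
  refine (integrableOn_dominating hα R C).mono' hf.aestronglyMeasurable ?_
  exact (ae_restrict_iff' measurableSet_upperHalf).2 (ae_of_all _ fun z hz =>
    norm_le_dominating h0 hb hz)

variable {U : Set (Rn n × ℝ)}

lemma setIntegral_upperPart {f : Rn n × ℝ → ℝ} (h : ∀ z, z ∉ U → f z = 0) :
    ∫ z in upperPart U, f z = ∫ z in upperHalf n, f z := by
  have hsub : upperPart U ⊆ upperHalf n := fun _ hz => hz.2
  exact (setIntegral_eq_of_subset_of_forall_sdiff_eq_zero measurableSet_upperHalf hsub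
    fun z hz => h z fun hU => hz.2 ⟨hU, hz.1⟩).symm

lemma integrableOn_upperPart {f : Rn n × ℝ → ℝ} (h : IntegrableOn f (upperHalf n)) :
    IntegrableOn f (upperPart U) := h.mono_set fun _ hz => hz.2

end Transfer

/-! ### The Hardy-trace inequality -/

section Inequality

variable {n : ℕ} {H : Seminorm ℝ (Rn n)} {α b : ℝ} {U : Set (Rn n × ℝ)}

lemma measurable_energyDensity {u : Rn n × ℝ → ℝ} (hu : ContDiff ℝ 1 u) :
    Measurable (energyDensity α H u) := by
  have h1 := ((continuous_Phi H).comp (continuous_grad hu)).measurable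
  exact (measurable_snd.pow_const α).mul (h1.pow_const 2)

lemma measurable_hardyDensity (hn : 1 ≤ n) (hH : IsFinslerNorm H) {u : Rn n × ℝ → ℝ}
    (hu : Continuous u) : Measurable (hardyDensity α H u) := by
  have h1 := (continuous_Phi0 hn hH).measurable
  have h2 := hu.measurable
  unfold hardyDensity; fun_prop

lemma measurable_logDensity (hn : 1 ≤ n) (hH : IsFinslerNorm H) (i : ℕ) {u : Rn n × ℝ → ℝ}
    (hu : Continuous u) : Measurable (logDensity α H U i u) := by
  have h1 := (continuous_Phi0 hn hH).measurable
  have h2 := hu.measurable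
  have h3 := measurable_P i
  unfold logDensity; fun_prop

lemma measurable_traceDensity (hn : 1 ≤ n) (hH : IsFinslerNorm H) {u : Rn n × ℝ → ℝ}
    (hu : Continuous u) : Measurable (traceDensity α H u) := by
  have h1 : Measurable fun x : Rn n => u (x, 0) :=
    (hu.comp (by fun_prop : Continuous fun x : Rn n => (x, (0 : ℝ)))).measurable
  have h2 := (continuous_dualNorm hn hH).measurable
  unfold traceDensity
  fun_prop

lemma traceDensity_nonneg (hH : IsFinslerNorm H) (u : Rn n × ℝ → ℝ) (x : Rn n) :
    0 ≤ traceDensity α H u x :=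
  div_nonneg (sq_nonneg _) (Real.rpow_nonneg (dualNorm_nonneg hH x) _)

lemma grad_eq_zero_of_notMem {u : Rn n × ℝ → ℝ} (hu : ContDiff ℝ 1 u) (hsub : tsupport u ⊆ U)
    {z : Rn n × ℝ} (hz : z ∉ U) : grad u z = 0 :=
  grad_eq_zero_of_notMem_tsupport hu fun h => hz (hsub h)

lemma integrableOn_energyDensity (hα : -1 < α) {u : Rn n × ℝ → ℝ} (hu : ContDiff ℝ 1 u)
    (huc : HasCompactSupport u) : IntegrableOn (energyDensity α H u) (upperHalf n) := by
  obtain ⟨R, hR⟩ := huc.isCompact.isBounded.subset_closedBall 0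
  have h0 : ∀ z, R < ‖z‖ → grad u z = 0 := fun z hz =>
    grad_eq_zero_of_notMem_tsupport hu fun h => by
      have := hR h
      rw [mem_closedBall_zero_iff] at this
      linarith
  have hc : Continuous fun z => Phi H (grad u z) ^ 2 :=
    ((continuous_Phi H).comp (continuous_grad hu)).pow 2
  obtain ⟨C, hC⟩ := (isCompact_closedBall (0 : Rn n × ℝ) R).exists_bound_of_continuousOn
    hc.continuousOn
  have hPhi0 : Phi H (0 : Rn n × ℝ) = 0 := by simp [Phi]
  refine integrableOn_upperHalf_of_bound hα (measurable_energyDensity hu) (R := R)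
    (C := max C 0) (fun z hz => ?_) fun z hz => ?_
  · rw [energyDensity, h0 z hz, hPhi0]; simp
  · have hy := Real.rpow_nonneg hz.le α
    rw [energyDensity, abs_mul, abs_of_nonneg hy, mul_comm]
    refine mul_le_mul_of_nonneg_right ?_ hy
    by_cases h : z ∈ Metric.closedBall (0 : Rn n × ℝ) R
    · exact (hC z h).trans (le_max_left _ _)
    · rw [h0 z (by simpa using h), hPhi0]; simp

/-- The inequality with finitely many remainder terms, for `C¹` functions. -/
theorem hardy_trace_finite (hα : α ∈ Ioo (-1 : ℝ) 1) (hb : 2 - α ≤ b) (hbn : b < n + 1)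
    (hH : IsFinslerNorm H) (hUo : IsOpen U) (hUb : Bornology.IsBounded U)
    (hU0 : (0 : Rn n × ℝ) ∈ U) {u : Rn n × ℝ → ℝ} (hu : ContDiff ℝ 1 u)
    (huc : HasCompactSupport u) (hsub : tsupport u ⊆ U) (m : ℕ) :
    IntegrableOn (energyDensity α H u) (upperHalf n) ∧
    Integrable (traceDensity α H u) ∧
    IntegrableOn (hardyDensity α H u) (upperHalf n) ∧
    (∀ i ∈ Finset.Icc 1 m, IntegrableOn (logDensity α H U i u) (upperHalf n)) ∧
    K n α b * (∫ x, traceDensity α H u x) +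
      (α + b - 2) ^ 2 / 4 * (∫ z in upperHalf n, hardyDensity α H u z) +
      1 / 4 * (∑ i ∈ Finset.Icc 1 m, ∫ z in upperHalf n, logDensity α H U i u z) ≤
    ∫ z in upperHalf n, energyDensity α H u z := by
  have hn := one_le_dim hα hb hbn
  have ha : 0 < radExp n α := by
    have := dim_cast_add_pos hb hbn
    unfold radExp; linarith
  obtain ⟨ν, hν1, hν2, hν3, hν4⟩ := exists_polar_measure hn hH
  have hν : IsPolarMeasure H ν := ⟨hν1, hν2, hν3, hν4⟩
  obtain ⟨δ, hδ, hδr, -⟩ := exists_ball_Phi0 hn hH hUo hUb hU0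
  have hD : 0 < radius H U := hδ.trans_le hδr
  have hout : ∀ z, z ∉ U → u z = 0 := fun z hz =>
    image_eq_zero_of_notMem_tsupport fun h => hz (hsub h)
  have hsupp : ∀ z : Rn n × ℝ, 0 < z.2 → radius H U < Phi0 H z → u z = 0 := fun z hz hlt =>
    hout z fun hzU => absurd (Phi0_le_radius hn hH hUb ⟨hzU, hz⟩) (not_le.2 hlt)
  have hd := hu.differentiable one_ne_zero
  have hS := measurableSet_upperHalf (n := n)
  have nn : ∀ f : Rn n × ℝ → ℝ, (∀ z, 0 < z.2 → 0 ≤ f z) →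
      0 ≤ᵐ[volume.restrict (upperHalf n)] f := fun f hf =>
    (ae_restrict_iff' hS).2 (ae_of_all _ fun z hz => hf z hz)
  have hE := integrableOn_energyDensity (H := H) hα.1 hu huc
  have hE0 := nn (energyDensity α H u) fun z hz =>
    mul_nonneg (Real.rpow_nonneg hz.le α) (sq_nonneg _)
  have hrm : Measurable fun z : Rn n × ℝ => z.2 ^ α * radDeriv H u z ^ 2 :=
    (measurable_snd.pow_const α).mul ((measurable_radDeriv hn hH hu).pow_const 2)
  have htm : Measurable fun z : Rn n × ℝ => z.2 ^ α * tanDeriv H u z ^ 2 :=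
    (measurable_snd.pow_const α).mul ((measurable_tanDeriv hn hH hu).pow_const 2)
  have hr0 := nn (fun z => z.2 ^ α * radDeriv H u z ^ 2) fun z hz =>
    mul_nonneg (Real.rpow_nonneg hz.le α) (sq_nonneg _)
  have ht0 := nn (fun z => z.2 ^ α * tanDeriv H u z ^ 2) fun z hz =>
    mul_nonneg (Real.rpow_nonneg hz.le α) (sq_nonneg _)
  have hle : ∀ z : Rn n × ℝ, 0 < z.2 →
      z.2 ^ α * radDeriv H u z ^ 2 + z.2 ^ α * tanDeriv H u z ^ 2 ≤ energyDensity α H u z :=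
    fun z hz => by
      rw [← mul_add]
      exact mul_le_mul_of_nonneg_left (radDeriv_sq_add_tanDeriv_sq_le hH (hd z) hz)
        (Real.rpow_nonneg hz.le α)
  have hri : IntegrableOn (fun z : Rn n × ℝ => z.2 ^ α * radDeriv H u z ^ 2) (upperHalf n) := by
    refine hE.mono' hrm.aestronglyMeasurable ((ae_restrict_iff' hS).2 (ae_of_all _ fun z hz => ?_))
    have hy := Real.rpow_nonneg (le_of_lt (show 0 < z.2 from hz)) α
    rw [Real.norm_of_nonneg (by positivity)]
    linarith [hle z hz, mul_nonneg hy (sq_nonneg (tanDeriv H u z))]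
  have hti : IntegrableOn (fun z : Rn n × ℝ => z.2 ^ α * tanDeriv H u z ^ 2) (upperHalf n) := by
    refine hE.mono' htm.aestronglyMeasurable ((ae_restrict_iff' hS).2 (ae_of_all _ fun z hz => ?_))
    have hy := Real.rpow_nonneg (le_of_lt (show 0 < z.2 from hz)) α
    rw [Real.norm_of_nonneg (by positivity)]
    linarith [hle z hz, mul_nonneg hy (sq_nonneg (radDeriv H u z))]
  have hsum : (∫ z in upperHalf n, z.2 ^ α * radDeriv H u z ^ 2) +
      (∫ z in upperHalf n, z.2 ^ α * tanDeriv H u z ^ 2) ≤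
      ∫ z in upperHalf n, energyDensity α H u z := by
    rw [← integral_add hri hti]
    exact setIntegral_mono_on (hri.add hti) hE hS fun z hz => hle z hz
  have hΦm := (continuous_Phi0 hn hH).measurable
  have hum := hu.continuous.measurable
  have hSm := measurable_sumSqP m
  have rad : IntegrableOn (fun z : Rn n × ℝ => z.2 ^ α * ((radExp n α ^ 2 +
      sumSqP m (Phi0 H z / radius H U) / 4) / Phi0 H z ^ 2 * u z ^ 2)) (upperHalf n) ∧ _ :=
    integrable_and_integral_le (Measurable.aestronglyMeasurable (by fun_prop))
      (nn _ fun z hz => by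
        have := Real.rpow_nonneg hz.le α
        have := sumSqP_nonneg m (Phi0 H z / radius H U)
        positivity) hri hr0
      (radial_global hn hH hν ha hD m hu hsupp)
  obtain ⟨hAi, hA⟩ := rad
  have hlog0 : ∀ i, ∀ z : Rn n × ℝ, 0 < z.2 → 0 ≤ logDensity α H U i u z := fun i z hz => by
    have := Real.rpow_nonneg hz.le α
    unfold logDensity; positivity
  have hhd0 : ∀ z : Rn n × ℝ, 0 < z.2 → 0 ≤ hardyDensity α H u z := fun z hz => by
    have := Real.rpow_nonneg hz.le α
    unfold hardyDensity; positivity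
  have heq : ∀ z : Rn n × ℝ, z.2 ^ α * ((radExp n α ^ 2 +
      sumSqP m (Phi0 H z / radius H U) / 4) / Phi0 H z ^ 2 * u z ^ 2) =
      radExp n α ^ 2 * hardyDensity α H u z +
        1 / 4 * ∑ i ∈ Finset.Icc 1 m, logDensity α H U i u z := fun z => by
    simp only [hardyDensity, logDensity, sumSqP]
    rw [← Finset.sum_mul, ← Finset.sum_div, ← Finset.mul_sum]
    ring
  -- Since a > 0, the Hardy density is at most a^(-2) times the radial integrand already known to be
  -- integrable.
  have hHd : IntegrableOn (hardyDensity α H u) (upperHalf n) := by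
    refine (hAi.const_mul (radExp n α ^ 2)⁻¹).mono'
      (measurable_hardyDensity hn hH hu.continuous).aestronglyMeasurable
      ((ae_restrict_iff' hS).2 (ae_of_all _ fun z hz => ?_))
    rw [heq, Real.norm_of_nonneg (hhd0 z hz), mul_add, inv_mul_cancel_left₀ (by positivity)]
    have : 0 ≤ ∑ i ∈ Finset.Icc 1 m, logDensity α H U i u z :=
      Finset.sum_nonneg fun i _ => hlog0 i z hz
    have : 0 ≤ (radExp n α ^ 2)⁻¹ * (1 / 4 * ∑ i ∈ Finset.Icc 1 m, logDensity α H U i u z) := by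
      positivity
    linarith
  have hL : ∀ i ∈ Finset.Icc 1 m, IntegrableOn (logDensity α H U i u) (upperHalf n) := by
    intro i hi
    refine (hAi.const_mul 4).mono'
      (measurable_logDensity hn hH i hu.continuous).aestronglyMeasurable
      ((ae_restrict_iff' hS).2 (ae_of_all _ fun z hz => ?_))
    rw [heq, Real.norm_of_nonneg (hlog0 i z hz)]
    have h1 := Finset.single_le_sum (f := fun i => logDensity α H U i u z)
      (fun j _ => hlog0 j z hz) hi
    have h2 := mul_nonneg (sq_nonneg (radExp n α)) (hhd0 z hz)
    linarith
  have hA' : radExp n α ^ 2 * (∫ z in upperHalf n, hardyDensity α H u z) +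
      1 / 4 * (∑ i ∈ Finset.Icc 1 m, ∫ z in upperHalf n, logDensity α H U i u z) ≤
      ∫ z in upperHalf n, z.2 ^ α * radDeriv H u z ^ 2 := by
    refine le_trans (le_of_eq ?_) hA
    rw [integral_congr_ae (ae_of_all _ heq), integral_add (hHd.const_mul _)
      ((integrable_finsetSum _ hL).const_mul _), integral_const_mul, integral_const_mul,
      integral_finsetSum _ hL]
  have hM := (angEigen_pos (n := n) hb hbn).le
  have hTi : IntegrableOn (fun z : Rn n × ℝ => z.2 ^ α * tanDeriv H u z ^ 2 +
      angEigen n α b * hardyDensity α H u z) (upperHalf n) := hti.add (hHd.const_mul _)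
  have hT : ∀ z : Rn n × ℝ, z.2 ^ α * (tanDeriv H u z ^ 2 +
      angEigen n α b / Phi0 H z ^ 2 * u z ^ 2) = z.2 ^ α * tanDeriv H u z ^ 2 +
      angEigen n α b * hardyDensity α H u z := fun z => by
    unfold hardyDensity; ring
  have hK := K_pos hα hb hbn
  have tan : Integrable (fun x => K n α b * traceDensity α H u x) ∧ _ :=
    integrable_and_integral_le
      ((measurable_traceDensity hn hH hu.continuous).const_mul _).aestronglyMeasurable
      (ae_of_all _ fun x => mul_nonneg hK.le (traceDensity_nonneg hH u x)) hTi
      (nn _ fun z hz => add_nonneg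
        (mul_nonneg (Real.rpow_nonneg hz.le α) (sq_nonneg _)) (mul_nonneg hM (hhd0 z hz)))
      (by
        have := tangential_global hα hb hbn hH hν hu
        simp_rw [hT] at this
        rw [← lintegral_const_mul' _ _ ENNReal.ofReal_ne_top] at this
        simpa only [ENNReal.ofReal_mul hK.le] using! this)
  obtain ⟨hTri, hTr⟩ := tan
  rw [integral_const_mul, integral_add hti (hHd.const_mul _), integral_const_mul] at hTr
  refine ⟨hE, ?_, hHd, hL, ?_⟩
  · simpa [hK.ne'] using hTri.const_mul (K n α b)⁻¹
  -- The radial part supplies a² of the Hardy term and the tangential part consumes `angEigen`; the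
  -- difference is the coefficient claimed.
  · have hrel : radExp n α ^ 2 - angEigen n α b = (α + b - 2) ^ 2 / 4 := by
      unfold radExp angEigen; ring
    rw [← hrel]
    linarith

variable {u : Rn n × ℝ → ℝ}

lemma setIntegral_hardyDensity (hout : ∀ z, z ∉ U → u z = 0) :
    ∫ z in upperPart U, hardyDensity α H u z = ∫ z in upperHalf n, hardyDensity α H u z :=
  setIntegral_upperPart fun z hz => by simp [hardyDensity, hout z hz]

lemma setIntegral_logDensity (hout : ∀ z, z ∉ U → u z = 0) (i : ℕ) :
    ∫ z in upperPart U, logDensity α H U i u z = ∫ z in upperHalf n, logDensity α H U i u z :=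
  setIntegral_upperPart fun z hz => by simp [logDensity, hout z hz]

lemma setIntegral_energyDensity (hu : ContDiff ℝ 1 u) (hsub : tsupport u ⊆ U) :
    ∫ z in upperPart U, energyDensity α H u z = ∫ z in upperHalf n, energyDensity α H u z :=
  setIntegral_upperPart fun z hz => by
    simp [energyDensity, grad_eq_zero_of_notMem hu hsub hz, Phi]

lemma setIntegral_traceDensity (hout : ∀ z, z ∉ U → u z = 0) :
    ∫ x in bottomPart U, traceDensity α H u x = ∫ x, traceDensity α H u x :=
  setIntegral_eq_integral_of_forall_compl_eq_zero fun x hx => by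
    simp [traceDensity, hout (x, 0) hx]

/-- The inequality with the infinite series. -/
theorem hardy_trace_series (hα : α ∈ Ioo (-1 : ℝ) 1) (hb : 2 - α ≤ b) (hbn : b < n + 1)
    (hH : IsFinslerNorm H) (hUo : IsOpen U) (hUb : Bornology.IsBounded U)
    (hU0 : (0 : Rn n × ℝ) ∈ U) (hu : IsTestFunction U u) :
    IntegrableOn (energyDensity α H u) (upperPart U) ∧
      IntegrableOn (traceDensity α H u) (bottomPart U) ∧
      IntegrableOn (hardyDensity α H u) (upperPart U) ∧
      (∀ i : ℕ, 1 ≤ i → IntegrableOn (logDensity α H U i u) (upperPart U)) ∧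
      Summable (fun i : ℕ => ∫ z in upperPart U, logDensity α H U (i + 1) u z) ∧
      K n α b * (∫ x in bottomPart U, traceDensity α H u x)
          + (α + b - 2) ^ 2 / 4 * (∫ z in upperPart U, hardyDensity α H u z)
          + 1 / 4 * (∑' i : ℕ, ∫ z in upperPart U, logDensity α H U (i + 1) u z)
        ≤ ∫ z in upperPart U, energyDensity α H u z := by
  have hu1 : ContDiff ℝ 1 u := hu.contDiff.of_le (by norm_cast)
  have hout : ∀ z, z ∉ U → u z = 0 := fun z hz =>
    image_eq_zero_of_notMem_tsupport fun h => hz (hu.tsupport_subset h)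
  have key := hardy_trace_finite hα hb hbn hH hUo hUb hU0 hu1 hu.hasCompactSupport
    hu.tsupport_subset
  simp_rw [setIntegral_hardyDensity hout, setIntegral_logDensity hout,
    setIntegral_energyDensity hu1 hu.tsupport_subset, setIntegral_traceDensity hout]
  have hl0 : ∀ i, 0 ≤ ∫ z in upperHalf n, logDensity α H U i u z := fun i =>
    setIntegral_nonneg measurableSet_upperHalf fun z hz => by
      have := Real.rpow_nonneg (le_of_lt (show 0 < z.2 from hz)) α
      unfold logDensity; positivity
  -- The bound does not depend on m and the terms are nonnegative, so the series converges and obeys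
  -- the same bound.
  have hbound : ∀ m, 1 / 4 * ∑ i ∈ Finset.range m, ∫ z in upperHalf n,
      logDensity α H U (i + 1) u z ≤ (∫ z in upperHalf n, energyDensity α H u z) -
        K n α b * (∫ x, traceDensity α H u x) -
        (α + b - 2) ^ 2 / 4 * (∫ z in upperHalf n, hardyDensity α H u z) := fun m => by
    have h1 := (key m).2.2.2.2
    have h2 : ∑ i ∈ Finset.range m, ∫ z in upperHalf n, logDensity α H U (i + 1) u z =
        ∑ i ∈ Finset.Icc 1 m, ∫ z in upperHalf n, logDensity α H U i u z := by
      rw [Finset.range_eq_Ico, Finset.sum_Ico_add' (fun i => ∫ z in upperHalf n,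
        logDensity α H U i u z) 0 m 1]
      rfl
    rw [h2]; linarith
  have hs : Summable fun i : ℕ => ∫ z in upperHalf n, logDensity α H U (i + 1) u z :=
    summable_of_sum_range_le (fun i => hl0 _) fun m => (le_div_iff₀' (by norm_num)).2 (hbound m)
  refine ⟨integrableOn_upperPart (key 0).1, (key 0).2.1.integrableOn,
    integrableOn_upperPart (key 0).2.2.1, fun i hi => integrableOn_upperPart
      ((key i).2.2.2.1 i (Finset.mem_Icc.2 ⟨hi, le_rfl⟩)), hs, ?_⟩
  have := (le_div_iff₀' (by norm_num)).1 (Real.tsum_le_of_sum_range_le (fun i => hl0 _)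
    fun m => (le_div_iff₀' (by norm_num : (0 : ℝ) < 1 / 4)).2 (hbound m))
  linarith

/-- `I_k[u]` is at least a quarter of the `k`-th remainder term. -/
lemma quarter_mul_le_deficit (hα : α ∈ Ioo (-1 : ℝ) 1) (hb : 2 - α ≤ b) (hbn : b < n + 1)
    (hH : IsFinslerNorm H) (hUo : IsOpen U) (hUb : Bornology.IsBounded U)
    (hU0 : (0 : Rn n × ℝ) ∈ U) (hu : IsTestFunction U u) {k : ℕ} (hk : 1 ≤ k) :
    1 / 4 * ∫ z in upperPart U, logDensity α H U k u z ≤ deficit α b H U k u := by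
  have hu1 : ContDiff ℝ 1 u := hu.contDiff.of_le (by norm_cast)
  have hout : ∀ z, z ∉ U → u z = 0 := fun z hz =>
    image_eq_zero_of_notMem_tsupport fun h => hz (hu.tsupport_subset h)
  have key := (hardy_trace_finite hα hb hbn hH hUo hUb hU0 hu1 hu.hasCompactSupport
    hu.tsupport_subset k).2.2.2.2
  obtain ⟨j, rfl⟩ : ∃ j, k = j + 1 := ⟨k - 1, by omega⟩
  simp only [deficit, setIntegral_hardyDensity hout, setIntegral_logDensity hout,
    setIntegral_energyDensity hu1 hu.tsupport_subset, setIntegral_traceDensity hout]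
  rw [Finset.sum_Icc_succ_top (by omega)] at key
  simp only [Nat.add_sub_cancel]
  linarith

end Inequality

/-! ### Mollification of C¹ functions -/

section Mollify

variable {E : Type*} [NormedAddCommGroup E] [NormedSpace ℝ E] [FiniteDimensional ℝ E]
  [MeasurableSpace E] [BorelSpace E]

open Convolution in
-- The average is within 2c of g(z), since any two values of g differ by at most 2c. The factor 3 is
-- crude, but only a bound uniform in the bump matters.
lemma norm_normed_convolution_le {F : Type*} [NormedAddCommGroup F] [NormedSpace ℝ F]
    [CompleteSpace F] {μ : Measure E} [μ.IsAddHaarMeasure] (φ : ContDiffBump (0 : E)) {g : E → F}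
    {c : ℝ} (hg : Continuous g) (hc : ∀ z, ‖g z‖ ≤ c) (z : E) :
    ‖(φ.normed μ ⋆[ContinuousLinearMap.lsmul ℝ ℝ, μ] g) z‖ ≤ 3 * c := by
  have h1 := φ.dist_normed_convolution_le (μ := μ) (x₀ := z) (ε := 2 * c)
    hg.aestronglyMeasurable fun x _ => by
      rw [dist_eq_norm]
      linarith [norm_sub_le (g x) (g z), hc x, hc z]
  rw [dist_eq_norm] at h1
  linarith [hc z, norm_sub_norm_le ((φ.normed μ ⋆[ContinuousLinearMap.lsmul ℝ ℝ, μ] g) z) (g z)]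

open Convolution in
/-- A compactly supported `C¹` function is a limit of smooth functions, pointwise together with the
gradients and boundedly. -/
lemma exists_smooth_approximation {u : E → ℝ} (hu : ContDiff ℝ 1 u) {A O : Set E}
    (hA : IsCompact A) (hO : IsOpen O) (hAO : A ⊆ O) (hsupp : ∀ z, z ∉ A → u z = 0) :
    ∃ (v : ℕ → E → ℝ) (B : Set E) (C : ℝ), IsCompact B ∧ B ⊆ O ∧
      (∀ j, ContDiff ℝ ∞ (v j)) ∧ (∀ j, tsupport (v j) ⊆ B) ∧
      (∀ j z, |v j z| ≤ C) ∧ (∀ j z, ‖fderiv ℝ (v j) z‖ ≤ C) ∧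
      (∀ z, Tendsto (fun j => v j z) atTop (𝓝 (u z))) ∧
      (∀ z, Tendsto (fun j => fderiv ℝ (v j) z) atTop (𝓝 (fderiv ℝ u z))) := by
  let μ : Measure E := Measure.addHaar
  obtain ⟨ε, hε, hεO⟩ := hA.exists_cthickening_subset_open hO hAO
  have hcu : HasCompactSupport u := HasCompactSupport.intro hA hsupp
  have hcd : HasCompactSupport (fderiv ℝ u) := hcu.fderiv ℝ
  have hfd : Continuous (fderiv ℝ u) := hu.continuous_fderiv one_ne_zero
  obtain ⟨C₁, hC₁⟩ := hcu.exists_bound_of_continuous hu.continuous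
  obtain ⟨C₂, hC₂⟩ := hcd.exists_bound_of_continuous hfd
  let φ : ℕ → ContDiffBump (0 : E) := fun j =>
    ⟨ε / (j + 1) / 2, ε / (j + 1), by positivity, half_lt_self (by positivity)⟩
  have hφ : Tendsto (fun j => (φ j).rOut) atTop (𝓝 0) := by
    have := tendsto_one_div_add_atTop_nhds_zero_nat (𝕜 := ℝ).const_mul ε
    simpa [φ, div_eq_mul_inv] using this
  have hli : ∀ j, LocallyIntegrable ((φ j).normed μ) μ := fun j =>
    (φ j).continuous_normed.locallyIntegrable
  have hD : ∀ j z, fderiv ℝ ((φ j).normed μ ⋆[ContinuousLinearMap.lsmul ℝ ℝ, μ] u) z =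
      ((φ j).normed μ ⋆[ContinuousLinearMap.lsmul ℝ ℝ, μ] fderiv ℝ u) z := fun j z => by
    rw [(hcu.hasFDerivAt_convolution_right _ (hli j) hu z).fderiv]
    rfl
  refine ⟨fun j => (φ j).normed μ ⋆[ContinuousLinearMap.lsmul ℝ ℝ, μ] u,
    Metric.cthickening ε A, max (3 * C₁) (3 * C₂), hA.cthickening, hεO, fun j => ?_, fun j => ?_,
    fun j z => (norm_normed_convolution_le (φ j) hu.continuous hC₁ z).trans (le_max_left _ _), fun j z => ?_,
    fun z => ContDiffBump.convolution_tendsto_right_of_continuous hφ hu.continuous z, fun z => ?_⟩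
  · exact HasCompactSupport.contDiff_convolution_left _ (φ j).hasCompactSupport_normed
      (φ j).contDiff_normed hu.continuous.locallyIntegrable
  · refine closure_minimal ?_ Metric.isClosed_cthickening
    refine (support_convolution_subset _).trans ?_
    rintro _ ⟨x, hx, y, hy, rfl⟩
    rw [(φ j).support_normed_eq, mem_ball_zero_iff] at hx
    have hyA : y ∈ A := by_contra fun h => hy (hsupp y h)
    refine Metric.mem_cthickening_of_dist_le _ y _ _ hyA ?_
    rw [dist_eq_norm, add_sub_cancel_right]
    refine hx.le.trans ?_
    exact div_le_self hε.le (by linarith [(Nat.cast_nonneg j : (0 : ℝ) ≤ j)])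
  · rw [hD]
    exact (norm_normed_convolution_le (φ j) hfd hC₂ z).trans (le_max_right _ _)
  · simp_rw [hD]
    exact ContDiffBump.convolution_tendsto_right_of_continuous hφ hfd z

end Mollify

/-! ### Convergence of the functionals under bounded C¹ approximation -/

section Convergence

variable {n : ℕ} {H : Seminorm ℝ (Rn n)} {α b : ℝ} {U : Set (Rn n × ℝ)}

/-- The gradient as a function of the derivative. -/
lemma exists_gradient_map (n : ℕ) : ∃ g : (Rn n × ℝ →L[ℝ] ℝ) → Rn n × ℝ, Continuous g ∧
    ∀ (u : Rn n × ℝ → ℝ) (z : Rn n × ℝ), DifferentiableAt ℝ u z →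
      grad u z = g (fderiv ℝ u z) := by
  refine ⟨fun T => ((InnerProductSpace.toDual ℝ (Rn n)).symm
      (T.comp (ContinuousLinearMap.inl ℝ (Rn n) ℝ)), T (0, 1)), ?_, fun u z hu =>
      Prod.ext (grad_fst_eq hu) (grad_snd_eq hu)⟩
  refine Continuous.prodMk ?_ (by fun_prop)
  exact (InnerProductSpace.toDual ℝ (Rn n)).symm.continuous.comp (by fun_prop)

variable {u : Rn n × ℝ → ℝ} {v : ℕ → Rn n × ℝ → ℝ} {C R : ℝ}

lemma tendsto_energy (hα : -1 < α) (hu : ContDiff ℝ 1 u) (hv : ∀ j, ContDiff ℝ 1 (v j))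
    (hR : ∀ j, tsupport (v j) ⊆ Metric.closedBall 0 R) (hC : ∀ j z, ‖fderiv ℝ (v j) z‖ ≤ C)
    (hlim : ∀ z, Tendsto (fun j => fderiv ℝ (v j) z) atTop (𝓝 (fderiv ℝ u z))) :
    Tendsto (fun j => ∫ z in upperHalf n, energyDensity α H (v j) z) atTop
      (𝓝 (∫ z in upperHalf n, energyDensity α H u z)) := by
  obtain ⟨g, hg, hgrad⟩ := exists_gradient_map n
  have hc : Continuous fun T => Phi H (g T) ^ 2 := ((continuous_Phi H).comp hg).pow 2
  obtain ⟨M, hM⟩ := (isCompact_closedBall (0 : Rn n × ℝ →L[ℝ] ℝ) C).exists_bound_of_continuousOn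
    hc.continuousOn
  have hvd : ∀ j z, DifferentiableAt ℝ (v j) z := fun j => (hv j).differentiable one_ne_zero
  refine tendsto_integral_of_dominated_convergence
    ((Metric.closedBall 0 R).indicator fun z : Rn n × ℝ => M * z.2 ^ α)
    (fun j => (measurable_energyDensity (hv j)).aestronglyMeasurable)
    (integrableOn_dominating hα R M) (fun j => ?_) (ae_of_all _ fun z => ?_)
  · refine (ae_restrict_iff' measurableSet_upperHalf).2 (ae_of_all _ fun z hz =>
      norm_le_dominating (fun z hz => ?_) (fun z hz => ?_) hz)
    · have : grad (v j) z = 0 := grad_eq_zero_of_notMem (hv j) (hR j) (by simpa using hz)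
      simp [energyDensity, this, Phi]
    · have hy := Real.rpow_nonneg hz.le α
      rw [energyDensity, abs_mul, abs_of_nonneg hy, mul_comm, hgrad _ _ (hvd j z)]
      exact mul_le_mul_of_nonneg_right (hM _ (mem_closedBall_zero_iff.2 (hC j z))) hy
  · simp only [energyDensity, hgrad _ _ (hvd _ _),
      hgrad _ _ (hu.differentiable one_ne_zero z)]
    exact ((hc.tendsto _).comp (hlim z)).const_mul _

/-- Dominated convergence. The weight G, singular at the origin in the applications, needs a bound
only where the approximants are nonzero, and these vanish near the origin. -/
lemma tendsto_weighted (hα : -1 < α) (hv : ∀ j, Continuous (v j))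
    (hR : ∀ j, tsupport (v j) ⊆ Metric.closedBall 0 R) (hC : ∀ j z, |v j z| ≤ C)
    (hlim : ∀ z, Tendsto (fun j => v j z) atTop (𝓝 (u z))) {G : Rn n × ℝ → ℝ} (hG : Measurable G)
    {M : ℝ} (hM : ∀ j z, 0 < z.2 → v j z ≠ 0 → |G z| ≤ M) :
    Tendsto (fun j => ∫ z in upperHalf n, z.2 ^ α * G z * v j z ^ 2) atTop
      (𝓝 (∫ z in upperHalf n, z.2 ^ α * G z * u z ^ 2)) := by
  have hm : ∀ j, Measurable fun z => z.2 ^ α * G z * v j z ^ 2 := fun j => by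
    have := (hv j).measurable
    fun_prop
  refine tendsto_integral_of_dominated_convergence
    ((Metric.closedBall 0 R).indicator fun z : Rn n × ℝ => (max M 0 * C ^ 2) * z.2 ^ α)
    (fun j => (hm j).aestronglyMeasurable)
    (integrableOn_dominating hα R _) (fun j => ?_) (ae_of_all _ fun z => ?_)
  · refine (ae_restrict_iff' measurableSet_upperHalf).2 (ae_of_all _ fun z hz =>
      norm_le_dominating (f := fun z => z.2 ^ α * G z * v j z ^ 2) (C := max M 0 * C ^ 2)
        (fun z hz => ?_) (fun z hz => ?_) hz)
    · have : v j z = 0 := image_eq_zero_of_notMem_tsupport fun h =>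
        absurd (mem_closedBall_zero_iff.1 (hR j h)) (not_le.2 hz)
      simp [this]
    · have hy := Real.rpow_nonneg hz.le α
      rcases eq_or_ne (v j z) 0 with h | h
      · simp only [h, ne_eq, OfNat.ofNat_ne_zero, not_false_eq_true, zero_pow, mul_zero, abs_zero]
        positivity
      · rw [mul_assoc, abs_mul, abs_of_nonneg hy, mul_comm, abs_mul, abs_of_nonneg (sq_nonneg (v j z))]
        refine mul_le_mul_of_nonneg_right (mul_le_mul ((hM j z hz h).trans (le_max_left _ _))
          (sq_le_sq' ?_ ?_) (sq_nonneg _) (le_max_right _ _)) hy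
        · linarith [neg_abs_le (v j z), hC j z]
        · linarith [le_abs_self (v j z), hC j z]
  · exact ((hlim z).pow 2).const_mul _

lemma tendsto_trace (hn : 1 ≤ n) (hH : IsFinslerNorm H) (hα : α < 1) (hv : ∀ j, Continuous (v j))
    (hR : ∀ j, tsupport (v j) ⊆ Metric.closedBall 0 R) (hC : ∀ j z, |v j z| ≤ C)
    (hlim : ∀ z, Tendsto (fun j => v j z) atTop (𝓝 (u z))) {r : ℝ} (hr : 0 < r)
    (hvr : ∀ j z, v j z ≠ 0 → r ≤ Phi0 H z) :
    Tendsto (fun j => ∫ x, traceDensity α H (v j) x) atTop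
      (𝓝 (∫ x, traceDensity α H u x)) := by
  have hr' : 0 < r ^ (1 - α) := Real.rpow_pos_of_pos hr _
  refine tendsto_integral_of_dominated_convergence
    ((Metric.closedBall 0 R).indicator fun _ : Rn n => C ^ 2 / r ^ (1 - α))
    (fun j => (measurable_traceDensity hn hH (hv j)).aestronglyMeasurable)
    ((integrable_indicator_iff Metric.isClosed_closedBall.measurableSet).2
      (integrableOn_const measure_closedBall_lt_top.ne))
    (fun j => ae_of_all _ fun x => ?_) (ae_of_all _ fun x => ?_)
  · rw [Real.norm_of_nonneg (traceDensity_nonneg hH _ x)]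
    have hind : 0 ≤ (Metric.closedBall 0 R).indicator (fun _ : Rn n => C ^ 2 / r ^ (1 - α)) x :=
      indicator_nonneg (fun _ _ => by positivity) x
    rcases eq_or_ne (v j (x, 0)) 0 with h | h
    · simpa [traceDensity, h] using hind
    · have hx : x ∈ Metric.closedBall (0 : Rn n) R := by
        have := hR j (subset_tsupport _ h)
        rw [mem_closedBall_zero_iff] at this ⊢
        exact (norm_fst_le (x, (0 : ℝ))).trans this
      have hd : r ≤ dualNorm H x := by
        have := hvr j _ h
        rwa [Phi0, show (0 : ℝ) ^ 2 = 0 by norm_num, add_zero,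
          Real.sqrt_sq (dualNorm_nonneg hH x)] at this
      rw [indicator_of_mem hx, traceDensity]
      refine div_le_div₀ (sq_nonneg _) (sq_le_sq' ?_ ?_) hr'
        (Real.rpow_le_rpow hr.le hd (by linarith))
      · linarith [neg_abs_le (v j (x, 0)), hC j (x, 0)]
      · linarith [le_abs_self (v j (x, 0)), hC j (x, 0)]
  · exact ((hlim _).pow 2).div_const _

end Convergence

/-! ### Passing from C¹ functions to test functions -/

section Smoothing

variable {n : ℕ} {H : Seminorm ℝ (Rn n)} {α b : ℝ} {U : Set (Rn n × ℝ)}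

lemma deficit_eq {u : Rn n × ℝ → ℝ} (hu : ContDiff ℝ 1 u) (hsub : tsupport u ⊆ U) (k : ℕ) :
    deficit α b H U k u = (∫ z in upperHalf n, energyDensity α H u z)
      - K n α b * (∫ x, traceDensity α H u x)
      - (α + b - 2) ^ 2 / 4 * (∫ z in upperHalf n, hardyDensity α H u z)
      - 1 / 4 * ∑ i ∈ Finset.Icc 1 (k - 1), ∫ z in upperHalf n, logDensity α H U i u z := by
  have hout : ∀ z, z ∉ U → u z = 0 := fun z hz =>
    image_eq_zero_of_notMem_tsupport fun h => hz (hsub h)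
  simp only [deficit, setIntegral_hardyDensity hout, setIntegral_logDensity hout,
    setIntegral_energyDensity hu hsub, setIntegral_traceDensity hout]

/-- The gap between the deficit and the remainder term of a `C¹` function supported away from the
origin is inherited by a test function. -/
lemma exists_test_of_contDiff_one (hn : 1 ≤ n) (hα : α ∈ Ioo (-1 : ℝ) 1) (hH : IsFinslerNorm H)
    {u : Rn n × ℝ → ℝ} (hu : ContDiff ℝ 1 u) {r δ δ' : ℝ} (hr : 0 < r) (hδ : δ < δ')
    (hδD : δ' ≤ radius H U) (hδU : ∀ z, Phi0 H z ≤ δ' → z ∈ U)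
    (hsupp : ∀ z, u z ≠ 0 → r ≤ Phi0 H z ∧ Phi0 H z ≤ δ) {k : ℕ} {c : ℝ}
    (hpos : 0 < ∫ z in upperPart U, logDensity α H U k u z)
    (hlt : deficit α b H U k u < c * ∫ z in upperPart U, logDensity α H U k u z) :
    ∃ v : Rn n × ℝ → ℝ, IsTestFunction U v ∧
      (∀ z, v z ≠ 0 → r / 2 < Phi0 H z ∧ Phi0 H z < δ') ∧
      0 < (∫ z in upperPart U, logDensity α H U k v z) ∧
      deficit α b H U k v < c * ∫ z in upperPart U, logDensity α H U k v z := by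
  have hΦ := continuous_Phi0 hn hH
  set A : Set (Rn n × ℝ) := {z | r ≤ Phi0 H z ∧ Phi0 H z ≤ δ} with hAdef
  set O : Set (Rn n × ℝ) := {z | r / 2 < Phi0 H z ∧ Phi0 H z < δ'} with hOdef
  have hA : IsCompact A := (isCompact_Phi0_le hn hH δ).of_isClosed_subset
    ((isClosed_le continuous_const hΦ).inter (isClosed_le hΦ continuous_const)) fun z hz => hz.2
  have hO : IsOpen O := (isOpen_lt continuous_const hΦ).inter (isOpen_lt hΦ continuous_const)
  have hAO : A ⊆ O := fun z hz => ⟨by linarith [hz.1], hz.2.trans_lt hδ⟩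
  have hOU : O ⊆ U := fun z hz => hδU z hz.2.le
  have hA0 : ∀ z, z ∉ A → u z = 0 := fun z hz => by_contra fun h => hz (hsupp z h)
  obtain ⟨v, B, C, hB, hBO, hv, hvB, hC, hC', hlim, hlim'⟩ :=
    exists_smooth_approximation hu hA hO hAO hA0
  obtain ⟨R, hR⟩ := hB.isBounded.subset_closedBall 0
  have hvR : ∀ j, tsupport (v j) ⊆ Metric.closedBall 0 R := fun j => (hvB j).trans hR
  have hv1 : ∀ j, ContDiff ℝ 1 (v j) := fun j => (hv j).of_le (by norm_cast)
  have hvc : ∀ j, Continuous (v j) := fun j => (hv j).continuous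
  have hvO : ∀ j z, v j z ≠ 0 → z ∈ O := fun j z h => hBO (hvB j (subset_tsupport _ h))
  have hvU : ∀ j, tsupport (v j) ⊆ U := fun j => ((hvB j).trans hBO).trans hOU
  have huU : tsupport u ⊆ U := by
    have : tsupport u ⊆ A := closure_minimal (fun z hz => by_contra fun h => hz (hA0 z h))
      hA.isClosed
    exact (this.trans hAO).trans hOU
  have out : ∀ {f : Rn n × ℝ → ℝ}, tsupport f ⊆ U → ∀ z, z ∉ U → f z = 0 := fun hf z hz =>
    image_eq_zero_of_notMem_tsupport fun h => hz (hf h)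
  have hE := tendsto_energy (H := H) hα.1 hu hv1 hvR hC' hlim'
  have hT := tendsto_trace hn hH hα.2 hvc hvR hC hlim (half_pos hr)
    fun j z h => (hvO j z h).1.le
  have hinv : ∀ j z, v j z ≠ 0 → 1 / Phi0 H z ^ 2 ≤ 1 / (r / 2) ^ 2 := fun j z h =>
    one_div_le_one_div_of_le (by positivity)
      (pow_le_pow_left₀ (by positivity) (hvO j z h).1.le 2)
  have hHd : Tendsto (fun j => ∫ z in upperHalf n, hardyDensity α H (v j) z) atTop
      (𝓝 (∫ z in upperHalf n, hardyDensity α H u z)) := by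
    have hm := hΦ.measurable
    have e : ∀ f : Rn n × ℝ → ℝ, hardyDensity α H f =
        fun z => z.2 ^ α * (1 / Phi0 H z ^ 2) * f z ^ 2 := fun f => by
      funext z; unfold hardyDensity; ring
    simp only [e]
    refine tendsto_weighted hα.1 hvc hvR hC hlim (by fun_prop) (M := 1 / (r / 2) ^ 2)
      fun j z _ h => ?_
    rw [abs_of_nonneg (by positivity)]
    exact hinv j z h
  have hL : ∀ i, Tendsto (fun j => ∫ z in upperHalf n, logDensity α H U i (v j) z) atTop
      (𝓝 (∫ z in upperHalf n, logDensity α H U i u z)) := fun i => by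
    have hm := hΦ.measurable
    have hP := measurable_P i
    have e : ∀ f : Rn n × ℝ → ℝ, logDensity α H U i f =
        fun z => z.2 ^ α * (P i (Phi0 H z / radius H U) ^ 2 * (1 / Phi0 H z ^ 2)) * f z ^ 2 :=
      fun f => by funext z; unfold logDensity; ring
    simp only [e]
    refine tendsto_weighted hα.1 hvc hvR hC hlim (by fun_prop) (M := 1 * (1 / (r / 2) ^ 2))
      fun j z _ h => ?_
    have hz := hvO j z h
    have h0 : 0 < Phi0 H z := (half_pos hr).trans hz.1
    have hD : 0 < radius H U := h0.trans (hz.2.trans_le hδD)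
    have hp := P_mem (div_pos h0 hD) ((div_le_one hD).2 (hz.2.le.trans hδD)) i
    rw [abs_of_nonneg (by positivity)]
    exact mul_le_mul (pow_le_one₀ hp.1.le hp.2) (hinv j z h) (by positivity) zero_le_one
  have hdef : Tendsto (fun j => deficit α b H U k (v j)) atTop (𝓝 (deficit α b H U k u)) := by
    simp only [deficit_eq (hv1 _) (hvU _), deficit_eq hu huU]
    exact ((hE.sub (hT.const_mul _)).sub (hHd.const_mul _)).sub
      ((tendsto_finsetSum _ fun i _ => hL i).const_mul _)
  have hlog : Tendsto (fun j => ∫ z in upperPart U, logDensity α H U k (v j) z) atTop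
      (𝓝 (∫ z in upperPart U, logDensity α H U k u z)) := by
    simp only [setIntegral_logDensity (out (hvU _)), setIntegral_logDensity (out huU)]
    exact hL k
  obtain ⟨j, hj1, hj2⟩ := ((hlog.eventually_const_lt hpos).and
    (hdef.eventually_lt (hlog.const_mul c) hlt)).exists
  exact ⟨v j, ⟨hv j, hB.of_isClosed_subset (isClosed_tsupport _) (hvB j), hvU j⟩, hvO j, hj1, hj2⟩

end Smoothing

/-! ### Functions separated in polar coordinates -/

section Separable

variable {n : ℕ} {H : Seminorm ℝ (Rn n)} {α b : ℝ}

/-- The function `w(Φ₀) q(H₀² / Φ₀²)`, separated in polar coordinates. -/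
def sepFun (H : Seminorm ℝ (Rn n)) (w : ℝ → ℝ) (q : Polynomial ℝ) (z : Rn n × ℝ) : ℝ :=
  w (Phi0 H z) * q.eval (dualNorm H z.1 ^ 2 / Phi0 H z ^ 2)

lemma contDiff_Phi0_sq (hn : 1 ≤ n) (hH : IsFinslerNorm H) :
    ContDiff ℝ 1 (fun z : Rn n × ℝ => Phi0 H z ^ 2) := by
  simp only [Phi0_sq]
  exact ((contDiff_dualNorm_sq hn hH).comp contDiff_fst).add (contDiff_snd.pow 2)

lemma contDiffAt_Phi0 (hn : 1 ≤ n) (hH : IsFinslerNorm H) {z : Rn n × ℝ} (hz : z ≠ 0) :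
    ContDiffAt ℝ 1 (Phi0 H) z := by
  have e : Phi0 H = fun z => Real.sqrt (Phi0 H z ^ 2) := by
    funext z; rw [Real.sqrt_sq (Phi0_nonneg H z)]
  have := Phi0_pos hH hz
  rw [e]
  exact (contDiff_Phi0_sq hn hH).contDiffAt.sqrt (by positivity)

lemma contDiffAt_sepFun (hn : 1 ≤ n) (hH : IsFinslerNorm H) {w : ℝ → ℝ} (hw : ContDiff ℝ 1 w)
    (q : Polynomial ℝ) {z : Rn n × ℝ} (hz : z ≠ 0) : ContDiffAt ℝ 1 (sepFun H w q) z := by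
  have hΦ := Phi0_pos hH hz
  have h1 : ContDiffAt ℝ 1 (fun z : Rn n × ℝ => dualNorm H z.1 ^ 2) z :=
    ((contDiff_dualNorm_sq hn hH).comp contDiff_fst).contDiffAt
  have h2 : ContDiff ℝ 1 fun s => q.eval s := by
    simpa only [Polynomial.coe_aeval_eq_eval] using! Polynomial.contDiff_aeval q 1
  exact (hw.contDiffAt.comp z (contDiffAt_Phi0 hn hH hz)).mul
    (h2.contDiffAt.comp z (h1.div (contDiff_Phi0_sq hn hH).contDiffAt (by positivity)))

lemma contDiff_sepFun (hn : 1 ≤ n) (hH : IsFinslerNorm H) {w : ℝ → ℝ} (hw : ContDiff ℝ 1 w)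
    (q : Polynomial ℝ) {r : ℝ} (hr : 0 < r) (hwr : ∀ ρ < r, w ρ = 0) :
    ContDiff ℝ 1 (sepFun H w q) := by
  refine contDiff_iff_contDiffAt.2 fun z => ?_
  rcases eq_or_ne z 0 with rfl | hz
  · have h0 : ∀ᶠ z in 𝓝 (0 : Rn n × ℝ), sepFun H w q z = 0 := by
      have := (continuous_Phi0 hn hH).tendsto (0 : Rn n × ℝ)
      rw [Phi0_zero] at this
      filter_upwards [this.eventually_lt_const hr] with z hz
      rw [sepFun, hwr _ hz, zero_mul]
    exact contDiffAt_const.congr_of_eventuallyEq h0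
  · exact contDiffAt_sepFun hn hH hw q hz

/-- The horizontal gradient of a separated function is parallel to the dual vector. -/
lemma exists_grad_fst_sepFun (hn : 1 ≤ n) (hH : IsFinslerNorm H) {w : ℝ → ℝ} (hw : ContDiff ℝ 1 w)
    (q : Polynomial ℝ) {z : Rn n × ℝ} (hz : z ≠ 0) :
    ∃ c : ℝ, (grad (sepFun H w q) z).1 = c • dualVec H z.1 := by
  have hΦ := Phi0_pos hH hz
  set F : ℝ × ℝ → ℝ := fun p => w (Real.sqrt (p.1 + p.2)) * q.eval (p.1 / (p.1 + p.2)) with hF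
  have e : sepFun H w q = fun z => F (dualNorm H z.1 ^ 2, z.2 ^ 2) := rfl |>.trans (by
    funext z; simp only [hF, sepFun, ← Phi0_sq, Real.sqrt_sq (Phi0_nonneg H z)])
  have hS : 0 < dualNorm H z.1 ^ 2 + z.2 ^ 2 := by rw [← Phi0_sq]; positivity
  have hFd : DifferentiableAt ℝ F (dualNorm H z.1 ^ 2, z.2 ^ 2) := by
    have h1 : DifferentiableAt ℝ (fun p : ℝ × ℝ => p.1 + p.2) (dualNorm H z.1 ^ 2, z.2 ^ 2) := by
      fun_prop
    have h2 : DifferentiableAt ℝ (fun p : ℝ × ℝ => p.1 / (p.1 + p.2))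
      (dualNorm H z.1 ^ 2, z.2 ^ 2) := by
      simp only [div_eq_mul_inv]
      exact differentiableAt_fst.fun_mul (h1.fun_inv hS.ne')
    refine DifferentiableAt.mul ?_ ?_
    · exact DifferentiableAt.comp (g := w) _ (hw.differentiable one_ne_zero _) (h1.sqrt hS.ne')
    · exact DifferentiableAt.comp (g := fun s => q.eval s) _ (q.differentiable _) h2
  have hin : HasFDerivAt (fun x : Rn n => (dualNorm H x ^ 2, z.2 ^ 2))
      ((innerSL ℝ ((2 : ℝ) • dualVec H z.1)).prod (0 : Rn n →L[ℝ] ℝ)) z.1 :=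
    (hasFDerivAt_dualNorm_sq hn hH z.1).prodMk (hasFDerivAt_const _ _)
  have hcomp : HasFDerivAt (fun x : Rn n => sepFun H w q (x, z.2))
      ((fderiv ℝ F (dualNorm H z.1 ^ 2, z.2 ^ 2)).comp
        ((innerSL ℝ ((2 : ℝ) • dualVec H z.1)).prod (0 : Rn n →L[ℝ] ℝ))) z.1 := by
    rw [e]
    exact HasFDerivAt.comp (g := F) z.1 hFd.hasFDerivAt hin
  refine ⟨2 * fderiv ℝ F (dualNorm H z.1 ^ 2, z.2 ^ 2) (1, 0), ?_⟩
  have hg := hcomp.hasGradientAt.gradient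
  simp only [grad]
  rw [hg]
  refine ext_inner_right ℝ fun v => ?_
  rw [InnerProductSpace.toDual_symm_apply]
  set T := fderiv ℝ F (dualNorm H z.1 ^ 2, z.2 ^ 2)
  have : T (inner ℝ ((2 : ℝ) • dualVec H z.1) v, 0) =
      inner ℝ ((2 : ℝ) • dualVec H z.1) v * T (1, 0) := by
    rw [← smul_eq_mul, ← map_smul]; simp
  simp only [ContinuousLinearMap.comp_apply, ContinuousLinearMap.prod_apply, innerSL_apply_apply,
    _root_.zero_apply]
  rw [this, inner_smul_left, inner_smul_left]
  simp
  ring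

/-- The equality case of `radDeriv_sq_add_tanDeriv_sq_le`: the dual vector η of x satisfies ⟨x, η⟩ =
H₀(x) H(η), so nothing is lost when the horizontal gradient is a multiple of η. -/
lemma Phi_grad_sq_eq (hn : 1 ≤ n) (hH : IsFinslerNorm H) {u : Rn n × ℝ → ℝ} {z : Rn n × ℝ}
    (hu : DifferentiableAt ℝ u z) (hz : 0 < z.2) {c : ℝ} (hc : (grad u z).1 = c • dualVec H z.1) :
    Phi H (grad u z) ^ 2 = radDeriv H u z ^ 2 + tanDeriv H u z ^ 2 := by
  have hΦ : 0 < Phi0 H z := Phi0_pos hH (by rintro rfl; simp at hz)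
  obtain ⟨h1, h2⟩ := dualVec_spec hn hH z.1
  have h3 : fderiv ℝ u z (z.1, 0) = c * dualNorm H z.1 ^ 2 := by
    rw [← inner_grad_fst hu, hc, inner_smul_left, real_inner_comm, h2]; simp
  have h4 : H (grad u z).1 ^ 2 = c ^ 2 * dualNorm H z.1 ^ 2 := by
    rw [hc, map_smul_eq_mul, h1, mul_pow, Real.norm_eq_abs, sq_abs]
  rw [Phi_sq, h4, radDeriv, tanDeriv, h3, grad_snd_eq hu, div_pow, div_pow, ← add_div,
    eq_div_iff (by positivity), Phi0_sq]
  rcases eq_or_ne (dualNorm H z.1) 0 with h | h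
  · rw [h]; ring
  · field_simp; ring

lemma sepFun_polarPt {v : Rn n} (hv : dualNorm H v = 1) (w : ℝ → ℝ) (q : Polynomial ℝ) {θ ρ : ℝ}
    (hθ : θ ∈ Ioo 0 (Real.pi / 2)) (hρ : 0 < ρ) :
    sepFun H w q (polarPt v θ ρ) = w ρ * q.eval (Real.cos θ ^ 2) := by
  rw [sepFun, Phi0_polarPt hv hθ hρ, dualNorm_polarPt hv hθ hρ, mul_pow,
    mul_div_cancel_left₀ _ (by positivity)]

lemma radDeriv_sepFun {v : Rn n} (hv : dualNorm H v = 1) {w : ℝ → ℝ} (hw : ContDiff ℝ 1 w)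
    {q : Polynomial ℝ} (hd : Differentiable ℝ (sepFun H w q)) {θ ρ : ℝ}
    (hθ : θ ∈ Ioo 0 (Real.pi / 2)) (hρ : 0 < ρ) :
    radDeriv H (sepFun H w q) (polarPt v θ ρ) = deriv w ρ * q.eval (Real.cos θ ^ 2) := by
  rw [radDeriv_polarPt hv hθ hρ]
  refine (hasDerivAt_polarPt_radius hd v θ ρ).unique ?_
  have h := (hw.differentiable one_ne_zero ρ).hasDerivAt.mul_const (q.eval (Real.cos θ ^ 2))
  refine h.congr_of_eventuallyEq ?_
  filter_upwards [lt_mem_nhds hρ] with s hs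
  exact sepFun_polarPt hv w q hθ hs

lemma tanDeriv_sepFun {v : Rn n} (hv : dualNorm H v = 1) {w : ℝ → ℝ}
    {q : Polynomial ℝ} (hd : Differentiable ℝ (sepFun H w q)) {θ ρ : ℝ}
    (hθ : θ ∈ Ioo 0 (Real.pi / 2)) (hρ : 0 < ρ) :
    tanDeriv H (sepFun H w q) (polarPt v θ ρ) =
      -(w ρ / ρ) * (2 * Real.cos θ * Real.sin θ * q.derivative.eval (Real.cos θ ^ 2)) := by
  rw [tanDeriv_polarPt hv hθ hρ, div_eq_iff hρ.ne']
  refine (hasDerivAt_polarPt_angle hd v θ ρ).unique ?_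
  have h := ((q.hasDerivAt (Real.cos θ ^ 2)).comp θ
    ((Real.hasDerivAt_cos θ).pow 2)).const_mul (w ρ)
  refine HasDerivAt.congr_deriv (h.congr_of_eventuallyEq ?_) ?_
  · filter_upwards [Ioo_mem_nhds hθ.1 hθ.2] with s hs
    exact sepFun_polarPt hv w q hs hρ
  · push_cast
    field_simp

/-- The integral of a function separated in polar coordinates. -/
lemma setIntegral_separable (hn : 1 ≤ n) {ν : Measure (Rn n)} (hν : IsPolarMeasure H ν)
    {G : Rn n × ℝ → ℝ} (hG : Measurable G) (hG0 : ∀ z, 0 ≤ G z) {A B : ℝ → ℝ} (hA : Measurable A)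
    (hB : Measurable B) (hA0 : ∀ ρ, 0 < ρ → 0 ≤ A ρ) (hB0 : ∀ θ, 0 ≤ B θ)
    (h : ∀ v, dualNorm H v = 1 → ∀ θ ∈ Ioo 0 (Real.pi / 2), ∀ ρ, 0 < ρ →
      G (polarPt v θ ρ) = A ρ * B θ) :
    ∫ z in upperHalf n, z.2 ^ α * G z = ν.real univ *
      (∫ θ in Ioo 0 (Real.pi / 2), angWeight n α θ * B θ) *
        ∫ ρ in Ioi 0, ρ ^ (n + α) * A ρ := by
  have hm : Measurable fun z : Rn n × ℝ => z.2 ^ α * G z := (measurable_snd.pow_const α).mul hG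
  have hmB : Measurable fun θ => angWeight n α θ * B θ := measurable_angWeight.mul hB
  have hmA : Measurable fun ρ : ℝ => ρ ^ ((n : ℝ) + α) * A ρ :=
    (measurable_id.pow_const _).mul hA
  rw [integral_eq_lintegral_of_nonneg_ae ((ae_restrict_iff' measurableSet_upperHalf).2
      (ae_of_all _ fun z hz => mul_nonneg (Real.rpow_nonneg (le_of_lt hz) α) (hG0 z)))
      hm.aestronglyMeasurable,
    integral_eq_lintegral_of_nonneg_ae ((ae_restrict_iff' measurableSet_Ioo).2
      (ae_of_all _ fun θ hθ => mul_nonneg (angWeight_pos hθ).le (hB0 θ)))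
      hmB.aestronglyMeasurable,
    integral_eq_lintegral_of_nonneg_ae ((ae_restrict_iff' measurableSet_Ioi).2
      (ae_of_all _ fun ρ hρ => mul_nonneg (Real.rpow_nonneg (le_of_lt hρ) _) (hA0 ρ hρ)))
      hmA.aestronglyMeasurable, Measure.real, ← ENNReal.toReal_mul, ← ENNReal.toReal_mul]
  congr 1
  rw [upperHalf, lintegral_upper_weighted hn hν hG]
  have step : ∀ᵐ v ∂ν, (∫⁻ θ in Ioo 0 (Real.pi / 2), ENNReal.ofReal (angWeight n α θ) *
        ∫⁻ ρ in Ioi (0 : ℝ), ENNReal.ofReal (ρ ^ ((n : ℝ) + α) * G (polarPt v θ ρ))) =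
      (∫⁻ θ in Ioo 0 (Real.pi / 2), ENNReal.ofReal (angWeight n α θ * B θ)) *
        ∫⁻ ρ in Ioi (0 : ℝ), ENNReal.ofReal (ρ ^ ((n : ℝ) + α) * A ρ) := by
    filter_upwards [hν.ae_eq_one] with v hv
    rw [← lintegral_mul_const _ hmB.ennreal_ofReal]
    refine setLIntegral_congr_fun measurableSet_Ioo fun θ hθ => ?_
    have hwt := (angWeight_pos (n := n) (α := α) hθ).le
    rw [ENNReal.ofReal_mul hwt, mul_assoc, ← lintegral_const_mul _ hmA.ennreal_ofReal]
    congr 1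
    refine setLIntegral_congr_fun measurableSet_Ioi fun ρ hρ => ?_
    rw [h v hv θ hθ ρ hρ, ← ENNReal.ofReal_mul (hB0 θ)]
    congr 1; ring
  rw [lintegral_congr_ae step, lintegral_const]
  ring

lemma integral_traceDensity_sepFun (hn : 1 ≤ n) (hH : IsFinslerNorm H) {ν : Measure (Rn n)}
    (hν : IsPolarMeasure H ν) {w : ℝ → ℝ} {q : Polynomial ℝ} (hu : Continuous (sepFun H w q))
    (hw : Measurable w) :
    ∫ x, traceDensity α H (sepFun H w q) x =
      ν.real univ * q.eval 1 ^ 2 * ∫ ρ in Ioi 0, ρ ^ ((n : ℝ) + α - 2) * w ρ ^ 2 := by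
  have hm := measurable_traceDensity (α := α) hn hH hu
  have hmw : Measurable fun ρ : ℝ => ρ ^ ((n : ℝ) + α - 2) * w ρ ^ 2 := by fun_prop
  rw [integral_eq_lintegral_of_nonneg_ae (ae_of_all _ fun x => traceDensity_nonneg hH _ x)
      hm.aestronglyMeasurable,
    integral_eq_lintegral_of_nonneg_ae ((ae_restrict_iff' measurableSet_Ioi).2
      (ae_of_all _ fun ρ hρ => mul_nonneg (Real.rpow_nonneg (le_of_lt hρ) _) (sq_nonneg _)))
      hmw.aestronglyMeasurable, Measure.real,
    ← ENNReal.toReal_ofReal (sq_nonneg (q.eval 1)), ← ENNReal.toReal_mul, ← ENNReal.toReal_mul]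
  congr 1
  rw [hν.lintegral_eq _ hm.ennreal_ofReal]
  have step : ∀ᵐ v ∂ν, (∫⁻ r in Ioi (0 : ℝ), ENNReal.ofReal (r ^ (n - 1)) *
        ENNReal.ofReal (traceDensity α H (sepFun H w q) (r • v))) =
      ENNReal.ofReal (q.eval 1 ^ 2) *
        ∫⁻ ρ in Ioi (0 : ℝ), ENNReal.ofReal (ρ ^ ((n : ℝ) + α - 2) * w ρ ^ 2) := by
    filter_upwards [hν.ae_eq_one] with v hv
    rw [← lintegral_const_mul _ hmw.ennreal_ofReal]
    refine setLIntegral_congr_fun measurableSet_Ioi fun ρ hρ => ?_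
    have hρ0 : 0 < ρ := hρ
    have hd : dualNorm H (ρ • v) = ρ := by rw [dualNorm_smul H hρ0.le, hv, mul_one]
    have hp : Phi0 H (ρ • v, (0 : ℝ)) = ρ := by
      rw [Phi0, hd, show (0 : ℝ) ^ 2 = 0 by norm_num, add_zero, Real.sqrt_sq hρ0.le]
    rw [← ENNReal.ofReal_mul (by positivity), ← ENNReal.ofReal_mul (sq_nonneg _), traceDensity,
      sepFun, hp, hd, div_self (by positivity)]
    congr 1
    have e3 : ρ ^ ((n : ℝ) + α - 2) = ρ ^ (n - 1) / ρ ^ (1 - α) := by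
      rw [← Real.rpow_natCast, ← Real.rpow_sub hρ0]
      congr 1; push_cast [hn]; ring
    rw [e3]; ring
  rw [lintegral_congr_ae step, lintegral_const]
  ring

end Separable

/-! ### Nearly optimal test functions -/

section Sharpness

variable {n : ℕ} {H : Seminorm ℝ (Rn n)} {α b : ℝ} {U : Set (Rn n × ℝ)}

lemma angular_sharp_integral (hα : α ∈ Ioo (-1 : ℝ) 1) (hb : 2 - α ≤ b) (hbn : b < n + 1) {ε : ℝ}
    (hε : 0 < ε) :
    0 < (∫ θ in Ioo 0 (Real.pi / 2), angWeight n α θ) ∧ ∃ q : Polynomial ℝ,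
      (∫ θ in Ioo 0 (Real.pi / 2), angWeight n α θ) ≤
        (∫ θ in Ioo 0 (Real.pi / 2), angWeight n α θ * q.eval (Real.cos θ ^ 2) ^ 2) ∧
      (∫ θ in Ioo 0 (Real.pi / 2), angWeight n α θ *
          (2 * Real.cos θ * Real.sin θ * q.derivative.eval (Real.cos θ ^ 2)) ^ 2) +
        angEigen n α b *
          (∫ θ in Ioo 0 (Real.pi / 2), angWeight n α θ * q.eval (Real.cos θ ^ 2) ^ 2) ≤
        K n α b * q.eval 1 ^ 2 + ε := by
  obtain ⟨q, hq1, hq⟩ := angular_sharp hα hb hbn hε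
  have hM := angEigen_pos (n := n) hb hbn
  have hK := K_pos hα hb hbn
  have hwm := measurable_angWeight (n := n) (α := α)
  have hm1 : Measurable fun θ : ℝ => q.eval (Real.cos θ ^ 2) :=
    (q.continuous.comp (by fun_prop)).measurable
  have hm2 : Measurable fun θ : ℝ => q.derivative.eval (Real.cos θ ^ 2) :=
    (q.derivative.continuous.comp (by fun_prop)).measurable
  have hae : ∀ {p : ℝ → Prop}, (∀ θ ∈ Ioo 0 (Real.pi / 2), p θ) →
      ∀ᵐ θ ∂volume.restrict (Ioo 0 (Real.pi / 2)), p θ := fun h =>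
    (ae_restrict_iff' measurableSet_Ioo).2 (ae_of_all _ h)
  set f : ℝ → ℝ := fun θ => angWeight n α θ *
    ((2 * Real.cos θ * Real.sin θ * q.derivative.eval (Real.cos θ ^ 2)) ^ 2 +
      angEigen n α b * q.eval (Real.cos θ ^ 2) ^ 2) with hf
  have hfm : Measurable f := by fun_prop
  have hf0 : ∀ᵐ θ ∂volume.restrict (Ioo 0 (Real.pi / 2)), 0 ≤ f θ := hae fun θ hθ => by
    have := (angWeight_pos (n := n) (α := α) hθ).le
    positivity
  have hfi : IntegrableOn f (Ioo 0 (Real.pi / 2)) :=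
    (lintegral_ofReal_ne_top_iff_integrable hfm.aestronglyMeasurable hf0).1
      (ne_top_of_le_ne_top ENNReal.ofReal_ne_top hq)
  have hfle : ∫ θ in Ioo 0 (Real.pi / 2), f θ ≤ K n α b * q.eval 1 ^ 2 + ε := by
    rw [integral_eq_lintegral_of_nonneg_ae hf0 hfm.aestronglyMeasurable]
    exact ENNReal.toReal_le_of_le_ofReal (by positivity) hq
  have hi1 : IntegrableOn (fun θ => angWeight n α θ *
      (2 * Real.cos θ * Real.sin θ * q.derivative.eval (Real.cos θ ^ 2)) ^ 2)
      (Ioo 0 (Real.pi / 2)) := by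
    refine hfi.mono' (Measurable.aestronglyMeasurable (by fun_prop)) (hae fun θ hθ => ?_)
    have hw := (angWeight_pos (n := n) (α := α) hθ).le
    rw [Real.norm_of_nonneg (by positivity)]
    exact mul_le_mul_of_nonneg_left (le_add_of_nonneg_right (by positivity)) hw
  have hi0 : IntegrableOn (fun θ => angWeight n α θ * q.eval (Real.cos θ ^ 2) ^ 2)
      (Ioo 0 (Real.pi / 2)) := by
    refine (hfi.const_mul (angEigen n α b)⁻¹).mono'
      (Measurable.aestronglyMeasurable (by fun_prop)) (hae fun θ hθ => ?_)
    have hw := (angWeight_pos (n := n) (α := α) hθ).le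
    rw [Real.norm_of_nonneg (by positivity), hf, mul_left_comm, mul_add,
      inv_mul_cancel_left₀ hM.ne']
    exact mul_le_mul_of_nonneg_left (le_add_of_nonneg_left (by positivity)) hw
  have hle : ∀ θ ∈ Ioo 0 (Real.pi / 2),
      angWeight n α θ ≤ angWeight n α θ * q.eval (Real.cos θ ^ 2) ^ 2 := fun θ hθ =>
    le_mul_of_one_le_right (angWeight_pos hθ).le (one_le_pow₀ (hq1 _ (sq_nonneg _)))
  have hi : IntegrableOn (angWeight n α) (Ioo 0 (Real.pi / 2)) := by
    refine hi0.mono' hwm.aestronglyMeasurable (hae fun θ hθ => ?_)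
    rw [Real.norm_of_nonneg (angWeight_pos hθ).le]
    exact hle θ hθ
  refine ⟨?_, q, setIntegral_mono_on hi hi0 measurableSet_Ioo hle, ?_⟩
  · rw [setIntegral_pos_iff_support_of_nonneg_ae (hae fun θ hθ => (angWeight_pos hθ).le) hi]
    have : Function.support (angWeight n α) ∩ Ioo 0 (Real.pi / 2) = Ioo 0 (Real.pi / 2) :=
      inter_eq_right.2 fun θ hθ => (angWeight_pos hθ).ne'
    rw [this, Real.volume_Ioo]
    simp [Real.pi_pos]
  · refine le_trans (le_of_eq ?_) hfle
    rw [← integral_const_mul, ← integral_add hi1 (hi0.const_mul _)]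
    refine integral_congr_ae (ae_of_all _ fun θ => ?_)
    simp only [hf]; ring

lemma integrableOn_radial {w : ℝ → ℝ} (hw : Continuous w) {r δ : ℝ} (hr : 0 < r)
    (hw0 : ∀ ρ, ρ ∉ Ioo r δ → w ρ = 0) (s : ℝ) {g : ℝ → ℝ} (hg : Measurable g)
    (hg1 : ∀ ρ, r < ρ → ρ < δ → |g ρ| ≤ 1) :
    IntegrableOn (fun ρ => ρ ^ s * g ρ * w ρ ^ 2) (Ioi 0) := by
  have hc : ContinuousOn (fun ρ : ℝ => ρ ^ s * w ρ ^ 2) (Icc r δ) :=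
    (continuousOn_id.rpow_const fun x hx => Or.inl (hr.trans_le hx.1).ne').mul
      (hw.pow 2).continuousOn
  have hi : IntegrableOn ((Icc r δ).indicator fun ρ : ℝ => ρ ^ s * w ρ ^ 2) (Ioi 0) :=
    ((integrable_indicator_iff measurableSet_Icc).2 (hc.integrableOn_Icc)).integrableOn
  refine hi.mono' (Measurable.aestronglyMeasurable (by fun_prop))
    ((ae_restrict_iff' measurableSet_Ioi).2 (ae_of_all _ fun ρ hρ => ?_))
  by_cases h : ρ ∈ Ioo r δ
  · rw [indicator_of_mem (Ioo_subset_Icc_self h), norm_mul, norm_mul,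
      Real.norm_of_nonneg (sq_nonneg _), Real.norm_of_nonneg (Real.rpow_nonneg (le_of_lt hρ) _)]
    refine mul_le_mul_of_nonneg_right ?_ (sq_nonneg _)
    exact mul_le_of_le_one_right (Real.rpow_nonneg (le_of_lt hρ) _) (hg1 ρ h.1 h.2)
  · rw [hw0 ρ h]
    simp only [ne_eq, OfNat.ofNat_ne_zero, not_false_eq_true, zero_pow, mul_zero, norm_zero]
    exact indicator_nonneg (fun x hx => mul_nonneg (Real.rpow_nonneg (hr.le.trans hx.1) _)
      (sq_nonneg _)) _

/-- The integrals of a separated function. -/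
lemma integrals_sepFun (hn : 1 ≤ n) (hα : -1 < α) (hH : IsFinslerNorm H) {ν : Measure (Rn n)}
    (hν : IsPolarMeasure H ν) {w : ℝ → ℝ} (hw : ContDiff ℝ 1 w) {q : Polynomial ℝ}
    (hu : ContDiff ℝ 1 (sepFun H w q)) (huc : HasCompactSupport (sepFun H w q)) :
    (∫ z in upperHalf n, energyDensity α H (sepFun H w q) z) =
      ν.real univ * ((∫ θ in Ioo 0 (Real.pi / 2), angWeight n α θ * q.eval (Real.cos θ ^ 2) ^ 2) *
        (∫ ρ in Ioi 0, ρ ^ (2 * radExp n α + 1) * deriv w ρ ^ 2) +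
      (∫ θ in Ioo 0 (Real.pi / 2), angWeight n α θ *
          (2 * Real.cos θ * Real.sin θ * q.derivative.eval (Real.cos θ ^ 2)) ^ 2) *
        ∫ ρ in Ioi 0, ρ ^ (2 * radExp n α - 1) * w ρ ^ 2) ∧
    (∫ z in upperHalf n, hardyDensity α H (sepFun H w q) z) =
      ν.real univ * (∫ θ in Ioo 0 (Real.pi / 2), angWeight n α θ * q.eval (Real.cos θ ^ 2) ^ 2) *
        ∫ ρ in Ioi 0, ρ ^ (2 * radExp n α - 1) * w ρ ^ 2 ∧
    (∀ i, (∫ z in upperHalf n, logDensity α H U i (sepFun H w q) z) =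
      ν.real univ * (∫ θ in Ioo 0 (Real.pi / 2), angWeight n α θ * q.eval (Real.cos θ ^ 2) ^ 2) *
        ∫ ρ in Ioi 0, ρ ^ (2 * radExp n α - 1) * P i (ρ / radius H U) ^ 2 * w ρ ^ 2) ∧
    (∫ x, traceDensity α H (sepFun H w q) x) =
      ν.real univ * q.eval 1 ^ 2 * ∫ ρ in Ioi 0, ρ ^ (2 * radExp n α - 1) * w ρ ^ 2 := by
  have hd := hu.differentiable one_ne_zero
  have hΦ := (continuous_Phi0 hn hH).measurable
  have hum := hu.continuous.measurable
  have hwm := hw.continuous.measurable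
  have hdw : Measurable (deriv w) := measurable_deriv w
  have hm1 : Measurable fun θ : ℝ => q.eval (Real.cos θ ^ 2) :=
    (q.continuous.comp (by fun_prop)).measurable
  have hm2 : Measurable fun θ : ℝ => q.derivative.eval (Real.cos θ ^ 2) :=
    (q.derivative.continuous.comp (by fun_prop)).measurable
  have hmr := measurable_radDeriv hn hH hu
  have hmt := measurable_tanDeriv hn hH hu
  have e1 : 2 * radExp n α + 1 = n + α := by unfold radExp; ring
  have e2 : 2 * radExp n α - 1 = n + α - 2 := by unfold radExp; ring
  have pw : ∀ ρ : ℝ, 0 < ρ → ρ ^ ((n : ℝ) + α) = ρ ^ ((n : ℝ) + α - 2) * ρ ^ 2 := fun ρ hρ => by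
    rw [← Real.rpow_natCast, ← Real.rpow_add hρ]; congr 1; push_cast; ring
  rw [e1, e2]
  refine ⟨?_, ?_, fun i => ?_, integral_traceDensity_sepFun hn hH hν hu.continuous hwm⟩
  · have hpt : ∀ z : Rn n × ℝ, z ∈ upperHalf n → energyDensity α H (sepFun H w q) z =
        z.2 ^ α * radDeriv H (sepFun H w q) z ^ 2 +
          z.2 ^ α * tanDeriv H (sepFun H w q) z ^ 2 := fun z hz => by
      have hz : 0 < z.2 := hz
      obtain ⟨c, hc⟩ := exists_grad_fst_sepFun hn hH hw q
        (show z ≠ 0 by rintro rfl; simp at hz)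
      rw [energyDensity, Phi_grad_sq_eq hn hH (hd z) hz hc, mul_add]
    have hE := integrableOn_energyDensity (H := H) hα hu huc
    have dom : ∀ f : Rn n × ℝ → ℝ, Measurable f → (∀ z, f z ^ 2 ≤
        radDeriv H (sepFun H w q) z ^ 2 + tanDeriv H (sepFun H w q) z ^ 2) →
        IntegrableOn (fun z : Rn n × ℝ => z.2 ^ α * f z ^ 2) (upperHalf n) := fun f hf hle => by
      refine hE.mono' ((measurable_snd.pow_const α).mul (hf.pow_const 2)).aestronglyMeasurable
        ((ae_restrict_iff' measurableSet_upperHalf).2 (ae_of_all _ fun z hz => ?_))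
      have hy := Real.rpow_nonneg (le_of_lt (show 0 < z.2 from hz)) α
      rw [Real.norm_of_nonneg (by positivity), hpt z hz, ← mul_add]
      exact mul_le_mul_of_nonneg_left (hle z) hy
    rw [setIntegral_congr_fun measurableSet_upperHalf hpt,
      integral_add (dom _ hmr fun z => le_add_of_nonneg_right (sq_nonneg _))
        (dom _ hmt fun z => le_add_of_nonneg_left (sq_nonneg _)),
      setIntegral_separable hn hν (hmr.pow_const 2) (fun _ => sq_nonneg _)
        (A := fun ρ => deriv w ρ ^ 2) (B := fun θ => q.eval (Real.cos θ ^ 2) ^ 2)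
        (by fun_prop) (by fun_prop) (fun _ _ => sq_nonneg _) (fun _ => sq_nonneg _)
        (fun v hv θ hθ ρ hρ => by rw [radDeriv_sepFun hv hw hd hθ hρ, mul_pow]),
      setIntegral_separable hn hν (hmt.pow_const 2) (fun _ => sq_nonneg _)
        (A := fun ρ => (w ρ / ρ) ^ 2) (B := fun θ => (2 * Real.cos θ * Real.sin θ *
          q.derivative.eval (Real.cos θ ^ 2)) ^ 2)
        (by fun_prop) (by fun_prop) (fun _ _ => sq_nonneg _) (fun _ => sq_nonneg _)
        (fun v hv θ hθ ρ hρ => by rw [tanDeriv_sepFun hv hd hθ hρ]; ring),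
      setIntegral_congr_fun (f := fun ρ : ℝ => ρ ^ ((n : ℝ) + α) * (w ρ / ρ) ^ 2)
        (g := fun ρ : ℝ => ρ ^ ((n : ℝ) + α - 2) * w ρ ^ 2) measurableSet_Ioi
        fun ρ hρ => by
          have hρ : 0 < ρ := hρ
          simp only [pw ρ hρ]; field_simp]
    ring
  · have e : hardyDensity α H (sepFun H w q) =
        fun z => z.2 ^ α * (sepFun H w q z ^ 2 / Phi0 H z ^ 2) := by
      funext z; unfold hardyDensity; ring
    rw [e, setIntegral_separable hn hν (by fun_prop) (fun _ => by positivity)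
      (A := fun ρ => w ρ ^ 2 / ρ ^ 2) (B := fun θ => q.eval (Real.cos θ ^ 2) ^ 2)
      (by fun_prop) (by fun_prop) (fun _ _ => by positivity) (fun _ => sq_nonneg _)
      (fun v hv θ hθ ρ hρ => by
        rw [sepFun_polarPt hv w q hθ hρ, Phi0_polarPt hv hθ hρ]; ring)]
    congr 1
    refine setIntegral_congr_fun measurableSet_Ioi fun ρ hρ => ?_
    have hρ : 0 < ρ := hρ
    simp only [pw ρ hρ]; field_simp
  · have hP := measurable_P i
    have e : logDensity α H U i (sepFun H w q) = fun z => z.2 ^ α *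
        (P i (Phi0 H z / radius H U) ^ 2 / Phi0 H z ^ 2 * sepFun H w q z ^ 2) := by
      funext z; unfold logDensity; ring
    rw [e, setIntegral_separable hn hν (by fun_prop) (fun _ => by positivity)
      (A := fun ρ => P i (ρ / radius H U) ^ 2 / ρ ^ 2 * w ρ ^ 2)
      (B := fun θ => q.eval (Real.cos θ ^ 2) ^ 2)
      (by fun_prop) (by fun_prop) (fun _ _ => by positivity) (fun _ => sq_nonneg _)
      (fun v hv θ hθ ρ hρ => by
        rw [sepFun_polarPt hv w q hθ hρ, Phi0_polarPt hv hθ hρ]; ring)]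
    congr 1
    refine setIntegral_congr_fun measurableSet_Ioi fun ρ hρ => ?_
    have hρ : 0 < ρ := hρ
    simp only [pw ρ hρ]; field_simp

/-- Test functions concentrated near the origin for which the `k`-th remainder term is nearly
sharp. -/
theorem exists_nearly_optimal (hα : α ∈ Ioo (-1 : ℝ) 1) (hb : 2 - α ≤ b) (hbn : b < n + 1)
    (hH : IsFinslerNorm H) (hUo : IsOpen U) (hUb : Bornology.IsBounded U)
    (hU0 : (0 : Rn n × ℝ) ∈ U) {k : ℕ} (hk : 1 ≤ k) {ε η : ℝ} (hε : 0 < ε) (hη : 0 < η) :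
    ∃ (v : Rn n × ℝ → ℝ) (r : ℝ), 0 < r ∧ IsTestFunction U v ∧
      (∀ z, v z ≠ 0 → r < Phi0 H z ∧ Phi0 H z < η) ∧
      0 < (∫ z in upperPart U, logDensity α H U k v z) ∧
      deficit α b H U k v < (1 / 4 + ε) * ∫ z in upperPart U, logDensity α H U k v z := by
  have hn := one_le_dim hα hb hbn
  obtain ⟨ν, hν1, hν2, hν3, hν4⟩ := exists_polar_measure hn hH
  have hν : IsPolarMeasure H ν := ⟨hν1, hν2, hν3, hν4⟩
  have hN : 0 < ν.real univ := by
    rw [Measure.real]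
    exact ENNReal.toReal_pos (by simpa using hν2) (measure_ne_top ν univ)
  obtain ⟨δ₀, hδ₀, hδD, hδU⟩ := exists_ball_Phi0 hn hH hUo hUb hU0
  have hD : 0 < radius H U := hδ₀.trans_le hδD
  set D := radius H U with hDdef
  set a := radExp n α with hadef
  have hm : 0 < min δ₀ η := lt_min hδ₀ hη
  set δ := min δ₀ η / 2 with hδdef
  have hδ : 0 < δ := half_pos hm
  have hδm : δ < min δ₀ η := half_lt_self hm
  obtain ⟨w, r, hr, hw, hw0, hJ, hI⟩ := radial_sharp (a := a) hD k (half_pos hε) hδ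
    ((hδm.le.trans (min_le_left _ _)).trans hδD)
  set I₀ := ∫ ρ in Ioi 0, ρ ^ (2 * a - 1) * w ρ ^ 2 with hI₀
  set J : ℕ → ℝ := fun i => ∫ ρ in Ioi 0, ρ ^ (2 * a - 1) * P i (ρ / D) ^ 2 * w ρ ^ 2 with hJdef
  have hI₀0 : 0 ≤ I₀ := setIntegral_nonneg measurableSet_Ioi fun ρ hρ =>
    mul_nonneg (Real.rpow_nonneg (le_of_lt hρ) _) (sq_nonneg _)
  have hw0' : ∀ ρ, ρ ∉ Ioo r δ → w ρ = 0 := fun ρ h => (hw0 ρ h).1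
  have hint : ∀ i, IntegrableOn (fun ρ => ρ ^ (2 * a - 1) * P i (ρ / D) ^ 2 * w ρ ^ 2) (Ioi 0) :=
    fun i => by
      have hP := measurable_P i
      refine integrableOn_radial hw.continuous hr hw0' _ (by fun_prop) fun ρ h1 h2 => ?_
      have hp := P_mem (div_pos (hr.trans h1) hD) ((div_le_one hD).2
        ((h2.le.trans (hδm.le.trans (min_le_left _ _))).trans hδD)) i
      rw [abs_of_nonneg (sq_nonneg _)]
      exact pow_le_one₀ hp.1.le hp.2
  have hint0 : IntegrableOn (fun ρ => ρ ^ (2 * a - 1) * w ρ ^ 2) (Ioi 0) := by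
    simpa using integrableOn_radial hw.continuous hr hw0' (2 * a - 1)
      (g := fun _ => 1) measurable_const (by simp)
  have hsplit : ∫ ρ in Ioi 0, ρ ^ (2 * a - 1) * (a ^ 2 + sumSqP k (ρ / D) / 4) * w ρ ^ 2 =
      a ^ 2 * I₀ + 1 / 4 * ∑ i ∈ Finset.Icc 1 k, J i := by
    rw [hI₀, hJdef, ← integral_const_mul, ← integral_finsetSum _ fun i _ => hint i,
      ← integral_const_mul, ← integral_add (hint0.const_mul _)
        ((integrable_finsetSum _ fun i _ => hint i).const_mul _)]
    refine integral_congr_ae (ae_of_all _ fun ρ => ?_)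
    simp only [sumSqP]
    rw [← Finset.sum_mul, ← Finset.mul_sum]
    ring
  rw [hsplit] at hI
  -- Only the positivity of the total weight W is taken here. W bounds G₀ below independently of q,
  -- so it can enter the accuracy with which q is then chosen.
  obtain ⟨hW, -⟩ := angular_sharp_integral hα hb hbn one_pos
  set W := ∫ θ in Ioo 0 (Real.pi / 2), angWeight n α θ
  -- The angular error gets multiplied by I₀, which may be far larger than J k. Hence w is fixed
  -- first and the accuracy scaled by J k/(I₀+1), so that the contribution is at most (ε/4) G₀ J k.
  obtain ⟨-, q, hG0, hG1⟩ := angular_sharp_integral hα hb hbn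
    (show 0 < ε / 4 * W * J k / (I₀ + 1) by positivity)
  set G₀ := ∫ θ in Ioo 0 (Real.pi / 2), angWeight n α θ * q.eval (Real.cos θ ^ 2) ^ 2
  set G₁ := ∫ θ in Ioo 0 (Real.pi / 2), angWeight n α θ *
    (2 * Real.cos θ * Real.sin θ * q.derivative.eval (Real.cos θ ^ 2)) ^ 2
  have hu : ContDiff ℝ 1 (sepFun H w q) :=
    contDiff_sepFun hn hH hw q hr fun ρ hρ => hw0' ρ fun h => absurd h.1 (not_lt.2 hρ.le)
  have hsupp : ∀ z, sepFun H w q z ≠ 0 → r ≤ Phi0 H z ∧ Phi0 H z ≤ δ := fun z hz => by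
    by_contra hcon
    exact hz (by rw [sepFun, hw0' _ fun h => hcon ⟨h.1.le, h.2.le⟩, zero_mul])
  have hcpt := isCompact_Phi0_le hn hH δ
  have huc : HasCompactSupport (sepFun H w q) := HasCompactSupport.intro hcpt fun z hz =>
    by_contra fun h => hz (hsupp z h).2
  have hsub : tsupport (sepFun H w q) ⊆ U := by
    refine (closure_minimal (fun z hz => (hsupp z hz).2) hcpt.isClosed).trans fun z hz => ?_
    exact hδU z ((le_trans hz hδm.le).trans (min_le_left _ _))
  have hout : ∀ z, z ∉ U → sepFun H w q z = 0 := fun z hz =>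
    image_eq_zero_of_notMem_tsupport fun h => hz (hsub h)
  obtain ⟨hEn, hHd, hLog, hTr⟩ := integrals_sepFun (U := U) hn hα.1 hH hν hw hu huc
  have hlogk : ∫ z in upperPart U, logDensity α H U k (sepFun H w q) z =
      ν.real univ * G₀ * J k := by rw [setIntegral_logDensity hout, hLog]
  have hG0pos : 0 < G₀ := hW.trans_le hG0
  have hJk : 0 < J k := hJ
  have hdef : deficit α b H U k (sepFun H w q) <
      (1 / 4 + ε) * ∫ z in upperPart U, logDensity α H U k (sepFun H w q) z := by
    rw [hlogk, deficit_eq hu hsub, hEn, hHd, hTr]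
    simp only [hLog]
    rw [← Finset.mul_sum]
    obtain ⟨j, rfl⟩ : ∃ j, k = j + 1 := ⟨k - 1, by omega⟩
    rw [Finset.sum_Icc_succ_top (by omega)] at hI
    simp only [Nat.add_sub_cancel]
    change _ * (_ * _ + G₁ * I₀) - _ * (_ * I₀) - _ * (_ * I₀) -
      1 / 4 * (_ * ∑ i ∈ Finset.Icc 1 j, J i) < _
    set I₁ := ∫ ρ in Ioi 0, ρ ^ (2 * a + 1) * deriv w ρ ^ 2
    set S := ∑ i ∈ Finset.Icc 1 j, J i
    have hrel : (α + b - 2) ^ 2 / 4 = a ^ 2 - angEigen n α b := by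
      rw [hadef]; unfold radExp angEigen; ring
    have h1 : G₀ * I₁ ≤ G₀ * (a ^ 2 * I₀ + 1 / 4 * (S + J (j + 1)) + ε / 2 * J (j + 1)) :=
      mul_le_mul_of_nonneg_left hI hG0pos.le
    have h2 : I₀ * (G₁ + angEigen n α b * G₀) ≤
        I₀ * (K n α b * q.eval 1 ^ 2 + ε / 4 * W * J (j + 1) / (I₀ + 1)) :=
      mul_le_mul_of_nonneg_left hG1 hI₀0
    have h3 : I₀ * (ε / 4 * W * J (j + 1) / (I₀ + 1)) ≤ ε / 4 * G₀ * J (j + 1) := by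
      have : I₀ / (I₀ + 1) ≤ 1 := (div_le_one (by positivity)).2 (by linarith)
      calc _ = I₀ / (I₀ + 1) * (ε / 4 * W * J (j + 1)) := by ring
        _ ≤ 1 * (ε / 4 * W * J (j + 1)) := mul_le_mul_of_nonneg_right this (by positivity)
        _ ≤ _ := by rw [one_mul]; gcongr
    -- The radial error uses ε/2 and the angular one ε/4; the remaining ε/4 makes the inequality
    -- strict.
    have h4 : 0 < ε / 4 * (G₀ * J (j + 1)) := by positivity
    have h5 : G₀ * I₁ + G₁ * I₀ - K n α b * (q.eval 1 ^ 2 * I₀) -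
        (a ^ 2 - angEigen n α b) * (G₀ * I₀) - 1 / 4 * (G₀ * S) <
        (1 / 4 + ε) * (G₀ * J (j + 1)) := by nlinarith
    have h6 := mul_lt_mul_of_pos_left h5 hN
    rw [hrel]
    linarith
  obtain ⟨v, hv, hvs, hv1, hv2⟩ := exists_test_of_contDiff_one hn hα hH hu hr hδm
    ((min_le_left _ _).trans hδD) (fun z hz => hδU z (hz.trans (min_le_left _ _))) hsupp
    (by rw [hlogk]; positivity) hdef
  exact ⟨v, r / 2, half_pos hr, hv, fun z hz => ⟨(hvs z hz).1,
    (hvs z hz).2.trans_le (min_le_right _ _)⟩, hv1, hv2⟩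

end Sharpness

/-! ### Optimality of the constant and of the power -/

section Optimality

variable {n : ℕ} {H : Seminorm ℝ (Rn n)} {α b : ℝ} {U : Set (Rn n × ℝ)}

/-- The constant `1/4` of the remainder terms is optimal. -/
theorem isGLB_deficit_quotient (hα : α ∈ Ioo (-1 : ℝ) 1) (hb : 2 - α ≤ b) (hbn : b < n + 1)
    (hH : IsFinslerNorm H) (hUo : IsOpen U) (hUb : Bornology.IsBounded U)
    (hU0 : (0 : Rn n × ℝ) ∈ U) {k : ℕ} (hk : 1 ≤ k) :
    IsGLB {q : ℝ | ∃ u : Rn n × ℝ → ℝ, IsTestFunction U u ∧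
      0 < (∫ z in upperPart U, logDensity α H U k u z) ∧
      q = deficit α b H U k u / (∫ z in upperPart U, logDensity α H U k u z)} (1 / 4) := by
  refine ⟨?_, fun c hc => le_of_forall_pos_le_add fun ε hε => ?_⟩
  · rintro _ ⟨u, hu, hpos, rfl⟩
    exact (le_div_iff₀ hpos).2 (quarter_mul_le_deficit hα hb hbn hH hUo hUb hU0 hu hk)
  · obtain ⟨v, r, -, hv, -, hpos, hlt⟩ :=
      exists_nearly_optimal hα hb hbn hH hUo hUb hU0 hk hε one_pos
    exact (hc ⟨v, hv, hpos, rfl⟩).trans ((div_lt_iff₀ hpos).2 hlt).le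

/-- The power `2` of the last logarithmic weight cannot be lowered. -/
theorem exists_deficit_lt_powerLog (hα : α ∈ Ioo (-1 : ℝ) 1) (hb : 2 - α ≤ b) (hbn : b < n + 1)
    (hH : IsFinslerNorm H) (hUo : IsOpen U) (hUb : Bornology.IsBounded U)
    (hU0 : (0 : Rn n × ℝ) ∈ U) {k : ℕ} (hk : 1 ≤ k) {p : ℝ} (hp : p < 2) {C : ℝ} (hC : 0 < C) :
    ∃ u : Rn n × ℝ → ℝ, IsTestFunction U u ∧
      deficit α b H U k u < C * ∫ z in upperPart U, powerLogDensity α H U k p u z := by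
  have hn := one_le_dim hα hb hbn
  obtain ⟨δ₀, hδ₀, hδD, -⟩ := exists_ball_Phi0 hn hH hUo hUb hU0
  have hD : 0 < radius H U := hδ₀.trans_le hδD
  have hX : Tendsto (fun ρ => X k ρ ^ (p - 2)) (𝓝[>] 0) atTop :=
    (tendsto_rpow_neg_nhdsGT_zero (by linarith)).comp (tendsto_X k)
  -- Here 1/4 + 1 is the constant given by `exists_nearly_optimal` with ε = 1. For ρ < s the factor
  -- X_k^(p-2) times C exceeds it, so test functions concentrated in Φ₀ < sD violate the inequality.
  obtain ⟨s, hs, hsX⟩ := mem_nhdsGT_iff_exists_Ioo_subset.1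
    (hX.eventually_ge_atTop ((1 / 4 + 1) / C))
  have hs : 0 < s := hs
  obtain ⟨v, r, hr, hv, hvs, hpos, hlt⟩ := exists_nearly_optimal hα hb hbn hH hUo hUb hU0 hk
    one_pos (show 0 < min (s * radius H U) (radius H U) by positivity)
  refine ⟨v, hv, hlt.trans_le ?_⟩
  have hout : ∀ z, z ∉ U → v z = 0 := fun z hz =>
    image_eq_zero_of_notMem_tsupport fun h => hz (hv.tsupport_subset h)
  have hvc := hv.contDiff.continuous
  have hρ : ∀ z, v z ≠ 0 → 0 < Phi0 H z / radius H U ∧ Phi0 H z / radius H U < s ∧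
      Phi0 H z / radius H U ≤ 1 := fun z hz => by
    obtain ⟨h1, h2⟩ := hvs z hz
    exact ⟨div_pos (hr.trans h1) hD, (div_lt_iff₀ hD).2 (h2.trans_le (min_le_left _ _)),
      (div_le_one hD).2 (h2.le.trans (min_le_right _ _))⟩
  have hrD : ∀ z, v z ≠ 0 → r / radius H U ≤ Phi0 H z / radius H U := fun z hz =>
    div_le_div_of_nonneg_right (hvs z hz).1.le hD.le
  have hΦm := (continuous_Phi0 hn hH).measurable
  have hP := measurable_P (k - 1)
  have hXm := measurable_X k
  have hvm := hvc.measurable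
  have hm : Measurable (powerLogDensity α H U k p v) := by
    unfold powerLogDensity; fun_prop
  have hfac : ∀ z, v z ≠ 0 → powerLogDensity α H U k p v z =
      X k (Phi0 H z / radius H U) ^ (p - 2) * logDensity α H U k v z := fun z h => by
    obtain ⟨h0, -, h2⟩ := hρ z h
    have e1 : P k (Phi0 H z / radius H U) =
        P (k - 1) (Phi0 H z / radius H U) * X k (Phi0 H z / radius H U) := by
      obtain ⟨j, rfl⟩ : ∃ j, k = j + 1 := ⟨k - 1, by omega⟩
      exact P_succ j _
    have e2 : X k (Phi0 H z / radius H U) ^ p =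
        X k (Phi0 H z / radius H U) ^ (p - 2) * X k (Phi0 H z / radius H U) ^ 2 := by
      rw [← Real.rpow_natCast, ← Real.rpow_add (X_mem h0 h2 k).1]; congr 1; push_cast; ring
    rw [powerLogDensity, logDensity, e1, e2]; ring
  have hl := (hardy_trace_finite hα hb hbn hH hUo hUb hU0 (hv.contDiff.of_le (by norm_cast))
    hv.hasCompactSupport hv.tsupport_subset k).2.2.2.1 k (Finset.mem_Icc.2 ⟨hk, le_rfl⟩)
  have hl0 : ∀ z ∈ upperHalf n, 0 ≤ logDensity α H U k v z := fun z hz => by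
    have := Real.rpow_nonneg (le_of_lt (show 0 < z.2 from hz)) α
    unfold logDensity; positivity
  -- On the support Φ₀ > r, and X_k^(p-2) decreases with ρ, so it is bounded by its value at r/D.
  have hi : IntegrableOn (powerLogDensity α H U k p v) (upperHalf n) := by
    refine (hl.const_mul (X k (r / radius H U) ^ (p - 2))).mono' hm.aestronglyMeasurable
      ((ae_restrict_iff' measurableSet_upperHalf).2 (ae_of_all _ fun z hz => ?_))
    rcases eq_or_ne (v z) 0 with h | h
    · simp [logDensity, powerLogDensity, h]
    · obtain ⟨h0, -, h2⟩ := hρ z h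
      have hrp : 0 < r / radius H U := div_pos hr hD
      rw [hfac z h, Real.norm_of_nonneg (mul_nonneg (Real.rpow_nonneg (X_mem h0 h2 k).1.le _)
        (hl0 z hz))]
      exact mul_le_mul_of_nonneg_right (Real.rpow_le_rpow_of_nonpos
        (X_mem hrp ((hrD z h).trans h2) k).1 (X_mono hrp (hrD z h) h2 k) (by linarith)) (hl0 z hz)
  rw [setIntegral_logDensity hout, setIntegral_upperPart (f := powerLogDensity α H U k p v)
    fun z hz => by simp [powerLogDensity, hout z hz], ← integral_const_mul, ← integral_const_mul]
  refine setIntegral_mono_on (hl.const_mul _) (hi.const_mul _) measurableSet_upperHalf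
    fun z hz => ?_
  rcases eq_or_ne (v z) 0 with h | h
  · simp [logDensity, powerLogDensity, h]
  · have key := hsX ⟨(hρ z h).1, (hρ z h).2.1⟩
    simp only [mem_ofPred_eq] at key
    rw [div_le_iff₀ hC] at key
    rw [hfac z h]
    linarith [mul_le_mul_of_nonneg_right key (hl0 z hz)]

end Optimality

end FinslerHardy

end

theorem theorem2 (n : ℕ) (α b : ℝ) (hα : α ∈ Set.Ioo (-1 : ℝ) 1) (hb : 2 - α ≤ b)
    (hbn : b < n + 1)
    (H : Seminorm ℝ (Rn n)) (hH : IsFinslerNorm H)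
    (U : Set (Rn n × ℝ)) (hUo : IsOpen U) (hUc : IsConnected U)
    (hUb : Bornology.IsBounded U) (hU0 : (0 : Rn n × ℝ) ∈ U) :
    -- the inequality with the infinite series
    (∀ u : Rn n × ℝ → ℝ, IsTestFunction U u →
      IntegrableOn (energyDensity α H u) (upperPart U) ∧
      IntegrableOn (traceDensity α H u) (bottomPart U) ∧
      IntegrableOn (hardyDensity α H u) (upperPart U) ∧
      (∀ i : ℕ, 1 ≤ i →
        IntegrableOn (logDensity α H U i u) (upperPart U)) ∧
      Summable (fun i : ℕ =>
        ∫ z in upperPart U, logDensity α H U (i + 1) u z) ∧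
      K n α b *
            (∫ x in bottomPart U, traceDensity α H u x)
          + (α + b - 2) ^ 2 / 4 *
            (∫ z in upperPart U, hardyDensity α H u z)
          + 1 / 4 * (∑' i : ℕ,
            ∫ z in upperPart U, logDensity α H U (i + 1) u z)
        ≤ ∫ z in upperPart U, energyDensity α H u z) ∧
    -- the constant 1/4 of the k-th remainder term is optimal
    (∀ k : ℕ, 1 ≤ k →
      IsGLB {q : ℝ | ∃ u : Rn n × ℝ → ℝ, IsTestFunction U u ∧
          0 < (∫ z in upperPart U, logDensity α H U k u z) ∧
          q = deficit α b H U k u /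
            (∫ z in upperPart U, logDensity α H U k u z)}
        (1 / 4)) ∧
    -- the power 2 of the k-th logarithmic weight cannot be lowered, whatever the constant
    (∀ k : ℕ, 1 ≤ k → ∀ p : ℝ, p < 2 → ∀ C : ℝ, 0 < C →
      ∃ u : Rn n × ℝ → ℝ, IsTestFunction U u ∧
        deficit α b H U k u <
          C * ∫ z in upperPart U, powerLogDensity α H U k p u z) :=
  ⟨fun _ hu => hardy_trace_series hα hb hbn hH hUo hUb hU0 hu,
    fun _ hk => isGLB_deficit_quotient hα hb hbn hH hUo hUb hU0 hk,
    fun _ hk _ hp _ hC => exists_deficit_lt_powerLog hα hb hbn hH hUo hUb hU0 hk hp hC⟩
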